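/- Let $d, k \ge 2$ be integers and let $\mathcal T_{d,k}$ be the rooted tree whose root has $k$ children and all of whose other vertices have $d$ children. An almost automorphism of $\mathcal T_{d,k}$ is a triple $(A,B,\varphi)$, where $A, B$ are finite subtrees containing the root with $|\partial A| = |\partial B|$ and $\varphi : \mathcal T_{d,k}\setminus A \to \mathcal T_{d,k}\setminus B$ is an isomorphism of forests. The Neretin group $G = \mathcal N_{d,k}$ is the group of almost automorphisms, where $(A,B,\varphi)$ and $(A',B',\varphi')$ are identified if $\varphi$ and $\varphi'$ coincide outside some finite subtree containing $A \cup A'$; it acts faithfully on the set of ends $\partial \mathcal T_{d,k}$. It carries the unique group topology for which the inclusion of the profinite group $\mathrm{Aut}(\mathcal T_{d,k})$ (automorphisms of the rooted tree) in $\mathcal N_{d,k}$ is continuous and open; this topology is locally compact. A closed subgroup $H \le G$ is cocompact if the quotient space $G/H$ is compact. (1) Every proper closed cocompact subgroup $H$ of $G$ fixes an end $\xi \in \partial \mathcal T_{d,k}$ such that $H$ has finite index in the stabilizer $G_\xi$. (2) The group $G$ is unimodular, and it is the only closed cocompact unimodular subgroup of $G$. -/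

import Mathlib

open Filter Topology MeasureTheory

namespace NeretinTree

/-! ### The rooted tree `T_{d,k}` and its ends -/

/-- Vertices of the rooted tree whose root has `k` children and all of whose other vertices have
`d` children: the root, and the vertices `node i w`, lying below the `i`-th child of the root. The
list `w` records the choices made below that child, the most recent choice first. -/
inductive Vertex (d k : ℕ) : Type
  | root : Vertex d k
  | node (i : Fin k) (w : List (Fin d)) : Vertex d k

/-- `IsChild u v` means that `v` is a child of `u`; these are the (oriented) edges of the tree. -/
inductive IsChild {d k : ℕ} : Vertex d k → Vertex d k → Prop
  | root (i : Fin k) : IsChild Vertex.root (Vertex.node i [])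
  | node (i : Fin k) (w : List (Fin d)) (a : Fin d) :
      IsChild (Vertex.node i w) (Vertex.node i (a :: w))

/-- Ends of the tree, as infinite rays starting at the root. -/
@[ext]
structure End (d k : ℕ) : Type where
  ray : ℕ → Vertex d k
  ray_zero : ray 0 = Vertex.root
  ray_succ : ∀ n, IsChild (ray n) (ray (n + 1))

/-- `∂T_v`: the set of ends whose ray passes through `v`. -/
def shadow {d k : ℕ} (v : Vertex d k) : Set (End d k) := {ξ | ∃ n, ξ.ray n = v}

/-- `A` is the vertex set of a finite subtree containing the root. -/
structure IsFiniteSubtree {d k : ℕ} (A : Set (Vertex d k)) : Prop where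
  finite : A.Finite
  root_mem : Vertex.root ∈ A
  parent_mem : ∀ u v, IsChild u v → v ∈ A → u ∈ A

/-- The (outer) boundary of a set of vertices: the children of its vertices that lie outside it. -/
def outerBoundary {d k : ℕ} (A : Set (Vertex d k)) : Set (Vertex d k) :=
  {v | v ∉ A ∧ ∃ u ∈ A, IsChild u v}

/-- The rooted forest `T ∖ A` obtained by removing the vertices of `A`, given by the restriction of
the child relation to the complement of `A`. -/
def forestRel {d k : ℕ} (A : Set (Vertex d k)) (u v : (Aᶜ : Set (Vertex d k))) : Prop :=
  IsChild (u : Vertex d k) (v : Vertex d k)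

/-- Almost automorphisms `(A, B, φ)` of the tree: `A`, `B` are finite subtrees containing the root
and `φ : T ∖ A → T ∖ B` is an isomorphism of rooted forests. The equality `|∂A| = |∂B|` is then
automatic, see `AlmostAut.ncard_outerBoundary_eq`. -/
structure AlmostAut (d k : ℕ) : Type where
  A : Set (Vertex d k)
  B : Set (Vertex d k)
  isFiniteSubtree_A : IsFiniteSubtree A
  isFiniteSubtree_B : IsFiniteSubtree B
  φ : forestRel A ≃r forestRel B

/-- The permutation `g` of the set of ends is induced by the almost automorphism `p = (A, B, φ)`:
an end passes through a vertex `v` outside `A` iff its image under `g` passes through `φ v`. -/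
def AlmostAut.Induces {d k : ℕ} (p : AlmostAut d k) (g : Equiv.Perm (End d k)) : Prop :=
  ∀ (v : (p.Aᶜ : Set (Vertex d k))) (ξ : End d k),
    ξ ∈ shadow (v : Vertex d k) ↔ g ξ ∈ shadow (p.φ v : Vertex d k)

/-- Two almost automorphisms `(A, B, φ)` and `(A', B', φ')` are equivalent if there is a finite
subtree `C` containing `A ∪ A'` such that `φ` and `φ'` coincide outside `C`. -/
def AlmostAut.Equivalent {d k : ℕ} (p q : AlmostAut d k) : Prop :=
  ∃ C : Set (Vertex d k), IsFiniteSubtree C ∧ p.A ∪ q.A ⊆ C ∧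
    ∀ (v : Vertex d k) (hp : v ∉ p.A) (hq : v ∉ q.A), v ∉ C →
      (p.φ ⟨v, hp⟩ : Vertex d k) = q.φ ⟨v, hq⟩

/-! ### Elementary facts on the tree -/

section Basic

variable {d k : ℕ}

theorem IsChild.parent_unique {u u' v : Vertex d k} (h : IsChild u v) (h' : IsChild u' v) :
    u = u' := by
  cases h <;> cases h' <;> rfl

theorem not_isChild_root (u : Vertex d k) : ¬ IsChild u Vertex.root := by
  intro h; cases h

theorem exists_parent {v : Vertex d k} (h : v ≠ Vertex.root) : ∃ u, IsChild u v := by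
  cases v with
  | root => exact absurd rfl h
  | node i w =>
    cases w with
    | nil => exact ⟨_, IsChild.root i⟩
    | cons a w => exact ⟨_, IsChild.node i w a⟩

/-- The distance of a vertex to the root. -/
def depth : Vertex d k → ℕ
  | Vertex.root => 0
  | Vertex.node _ w => w.length + 1

theorem IsChild.depth_eq {u v : Vertex d k} (h : IsChild u v) : depth v = depth u + 1 := by
  cases h <;> simp [depth]

theorem End.depth_ray (ξ : End d k) (n : ℕ) : depth (ξ.ray n) = n := by
  induction n with
  | zero => rw [ξ.ray_zero]; rfl
  | succ n ih => rw [(ξ.ray_succ n).depth_eq, ih]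

theorem mem_shadow_iff {ξ : End d k} {v : Vertex d k} : ξ ∈ shadow v ↔ ξ.ray (depth v) = v := by
  constructor
  · rintro ⟨n, rfl⟩
    rw [ξ.depth_ray]
  · exact fun h => ⟨_, h⟩

theorem mem_shadow_of_isChild {ξ : End d k} {u v : Vertex d k} (h : IsChild u v)
    (hv : ξ ∈ shadow v) : ξ ∈ shadow u := by
  obtain ⟨n, rfl⟩ := hv
  cases n with
  | zero => rw [ξ.ray_zero] at h; exact absurd h (not_isChild_root u)
  | succ n => exact ⟨n, (ξ.ray_succ n).parent_unique h⟩

theorem End.ray_eq_of_le {ξ η : End d k} {n : ℕ} (h : ξ.ray n = η.ray n) :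
    ∀ m ≤ n, ξ.ray m = η.ray m := by
  induction n with
  | zero => intro m hm; obtain rfl : m = 0 := by omega
            exact h
  | succ n ih =>
    intro m hm
    rcases Nat.lt_or_ge n m with h1 | h1
    · obtain rfl : m = n + 1 := by omega
      exact h
    · have h2 := ξ.ray_succ n
      rw [h] at h2
      exact ih (h2.parent_unique (η.ray_succ n)) m h1

theorem depth_chain {c : ℕ → Vertex d k} (hc : ∀ n, IsChild (c n) (c (n + 1))) (n : ℕ) :
    depth (c n) = depth (c 0) + n := by
  induction n with
  | zero => rfl
  | succ n ih => rw [(hc n).depth_eq, ih]; omega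

/-- An end is determined by the vertices of any descending chain through which it passes. -/
theorem End.eq_of_chain {c : ℕ → Vertex d k} (hc : ∀ n, IsChild (c n) (c (n + 1)))
    {ξ η : End d k} (hξ : ∀ n, ξ ∈ shadow (c n)) (hη : ∀ n, η ∈ shadow (c n)) : ξ = η := by
  ext1
  funext n
  have h : ξ.ray (depth (c n)) = η.ray (depth (c n)) := by
    rw [mem_shadow_iff.1 (hξ n), mem_shadow_iff.1 (hη n)]
  exact End.ray_eq_of_le h n (by rw [depth_chain hc]; omega)

/-- Every descending chain of vertices lies on an end. -/
theorem exists_end_of_chain (m : ℕ) : ∀ (c : ℕ → Vertex d k),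
    (∀ n, IsChild (c n) (c (n + 1))) → depth (c 0) = m →
    ∃ ξ : End d k, ∀ n, ξ ∈ shadow (c n) := by
  induction m with
  | zero =>
    intro c hc h0
    refine ⟨⟨c, ?_, hc⟩, fun n => ⟨n, rfl⟩⟩
    cases h : c 0 with
    | root => rfl
    | node i w => rw [h] at h0; simp [depth] at h0
  | succ m ih =>
    intro c hc h0
    have hne : c 0 ≠ Vertex.root := by
      intro h; rw [h] at h0; simp [depth] at h0
    obtain ⟨u, hu⟩ := exists_parent hne
    obtain ⟨ξ, hξ⟩ := ih (fun n => Nat.casesOn n u c)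
      (by intro n; cases n with
          | zero => exact hu
          | succ n => exact hc n)
      (by have := hu.depth_eq; change depth u = m; omega)
    exact ⟨ξ, fun n => hξ (n + 1)⟩

theorem IsFiniteSubtree.union {A B : Set (Vertex d k)} (hA : IsFiniteSubtree A)
    (hB : IsFiniteSubtree B) : IsFiniteSubtree (A ∪ B) where
  finite := hA.finite.union hB.finite
  root_mem := Or.inl hA.root_mem
  parent_mem u v h hv := hv.imp (hA.parent_mem u v h) (hB.parent_mem u v h)

theorem isFiniteSubtree_root : IsFiniteSubtree ({Vertex.root} : Set (Vertex d k)) where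
  finite := Set.finite_singleton _
  root_mem := rfl
  parent_mem u v h hv := by
    rw [Set.mem_singleton_iff] at hv
    subst hv
    exact absurd h (not_isChild_root u)

/-- A ray eventually leaves every finite subtree. -/
theorem End.exists_forall_notMem (ξ : End d k) {A : Set (Vertex d k)} (hA : IsFiniteSubtree A) :
    ∃ N, ∀ n, ξ.ray (N + n) ∉ A := by
  obtain ⟨N, hN⟩ := (hA.finite.image depth).bddAbove
  refine ⟨N + 1, fun n hn => ?_⟩
  have := hN (Set.mem_image_of_mem _ hn)
  rw [ξ.depth_ray] at this
  omega

theorem finite_children {A : Set (Vertex d k)} (hA : A.Finite) :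
    {v | ∃ u ∈ A, IsChild u v}.Finite := by
  have : {v | ∃ u ∈ A, IsChild u v} = ⋃ u ∈ A, {v | IsChild u v} := by
    ext v; simp
  rw [this]
  refine hA.biUnion fun u _ => ?_
  cases u with
  | root =>
    refine (Set.finite_range fun i : Fin k => (Vertex.node i [] : Vertex d k)).subset ?_
    rintro v ⟨⟩
    exact ⟨_, rfl⟩
  | node i w =>
    refine (Set.finite_range fun a : Fin d => (Vertex.node i (a :: w) : Vertex d k)).subset ?_
    rintro v ⟨⟩
    exact ⟨_, rfl⟩

end Basic

/-! ### Almost automorphisms: identity, inverse, composition -/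

namespace AlmostAut

variable {d k : ℕ}

/-- The identity, as an almost automorphism. -/
def one : AlmostAut d k where
  A := {Vertex.root}
  B := {Vertex.root}
  isFiniteSubtree_A := isFiniteSubtree_root
  isFiniteSubtree_B := isFiniteSubtree_root
  φ := RelIso.refl _

/-- The inverse `(B, A, φ⁻¹)` of the almost automorphism `(A, B, φ)`. -/
def symm (p : AlmostAut d k) : AlmostAut d k where
  A := p.B
  B := p.A
  isFiniteSubtree_A := p.isFiniteSubtree_B
  isFiniteSubtree_B := p.isFiniteSubtree_A
  φ := p.φ.symm

theorem symm_apply_apply (p : AlmostAut d k) (v : (p.Aᶜ : Set (Vertex d k))) :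
    p.symm.φ (p.φ v) = v :=
  p.φ.symm_apply_apply v

theorem apply_symm_apply (p : AlmostAut d k) (v : (p.Bᶜ : Set (Vertex d k))) :
    p.φ (p.symm.φ v) = v :=
  p.φ.apply_symm_apply v

theorem symm_apply_of_eq (p : AlmostAut d k) {u : (p.Aᶜ : Set (Vertex d k))}
    {x : (p.symm.Aᶜ : Set (Vertex d k))} (h : (x : Vertex d k) = p.φ u) :
    (p.symm.φ x : Vertex d k) = u := by
  obtain rfl : x = p.φ u := Subtype.ext h
  exact congrArg Subtype.val (p.symm_apply_apply u)

theorem apply_of_eq (p : AlmostAut d k) {u : (p.symm.Aᶜ : Set (Vertex d k))}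
    {x : (p.Aᶜ : Set (Vertex d k))} (h : (x : Vertex d k) = p.symm.φ u) :
    (p.φ x : Vertex d k) = u := by
  obtain rfl : x = p.symm.φ u := Subtype.ext h
  exact congrArg Subtype.val (p.apply_symm_apply u)

/-- `A` together with the vertices mapped by `φ` into `C`. -/
def pullback (p : AlmostAut d k) (C : Set (Vertex d k)) : Set (Vertex d k) :=
  {v | ∀ h : v ∉ p.A, (p.φ ⟨v, h⟩ : Vertex d k) ∈ C}

theorem isFiniteSubtree_pullback (p : AlmostAut d k) {C : Set (Vertex d k)}
    (hC : IsFiniteSubtree C) : IsFiniteSubtree (p.pullback C) where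
  finite := by
    have hfin : ((fun w : (p.Bᶜ : Set (Vertex d k)) => (p.φ.symm w : Vertex d k)) ''
        {w | (w : Vertex d k) ∈ C}).Finite :=
      (hC.finite.preimage Subtype.val_injective.injOn).image _
    refine (p.isFiniteSubtree_A.finite.union hfin).subset fun v hv => ?_
    by_cases h : v ∈ p.A
    · exact Or.inl h
    · exact Or.inr ⟨p.φ ⟨v, h⟩, hv h, by simp⟩
  root_mem := fun h => absurd p.isFiniteSubtree_A.root_mem h
  parent_mem u v huv hv hu := by
    have hvA : v ∉ p.A := fun h => hu (p.isFiniteSubtree_A.parent_mem u v huv h)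
    have : forestRel p.B (p.φ ⟨u, hu⟩) (p.φ ⟨v, hvA⟩) := p.φ.map_rel_iff.2 huv
    exact hC.parent_mem _ _ this (hv hvA)

theorem notMem_A_of_notMem_pullback {p : AlmostAut d k} {C : Set (Vertex d k)} {v : Vertex d k}
    (h : v ∉ p.pullback C) : v ∉ p.A := fun h' => h fun h'' => absurd h' h''

theorem apply_notMem_of_notMem_pullback {p : AlmostAut d k} {C : Set (Vertex d k)} {v : Vertex d k}
    (h : v ∉ p.pullback C) : (p.φ ⟨v, notMem_A_of_notMem_pullback h⟩ : Vertex d k) ∉ C :=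
  fun h' => h fun _ => h'

/-- The composition `q ∘ p`, defined outside a larger finite subtree. -/
def comp (q p : AlmostAut d k) : AlmostAut d k where
  A := p.pullback q.A
  B := q.symm.pullback p.B
  isFiniteSubtree_A := p.isFiniteSubtree_pullback q.isFiniteSubtree_A
  isFiniteSubtree_B := q.symm.isFiniteSubtree_pullback p.isFiniteSubtree_B
  φ :=
    { toFun := fun v => ⟨q.φ ⟨p.φ ⟨v, notMem_A_of_notMem_pullback v.2⟩,
          apply_notMem_of_notMem_pullback v.2⟩, fun h => by
            have h1 := h (Subtype.coe_prop (q.φ _))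
            have e := congrArg Subtype.val (q.symm_apply_apply
              ⟨p.φ ⟨v, notMem_A_of_notMem_pullback v.2⟩, apply_notMem_of_notMem_pullback v.2⟩)
            exact Subtype.coe_prop (p.φ _) (e.subst (motive := (· ∈ p.B)) h1)⟩
      invFun := fun v => ⟨p.symm.φ ⟨q.symm.φ ⟨v, notMem_A_of_notMem_pullback v.2⟩,
          apply_notMem_of_notMem_pullback (p := q.symm) v.2⟩, fun h => by
            have h1 := h (Subtype.coe_prop (p.symm.φ _))
            have e := congrArg Subtype.val (p.apply_symm_apply
              ⟨q.symm.φ ⟨v, notMem_A_of_notMem_pullback v.2⟩,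
                apply_notMem_of_notMem_pullback (p := q.symm) v.2⟩)
            exact Subtype.coe_prop (q.symm.φ _) (e.subst (motive := (· ∈ q.A)) h1)⟩
      left_inv := fun v => Subtype.ext <|
        p.symm_apply_of_eq (u := ⟨v, notMem_A_of_notMem_pullback v.2⟩) <|
          q.symm_apply_of_eq (u := ⟨p.φ ⟨v, notMem_A_of_notMem_pullback v.2⟩,
            apply_notMem_of_notMem_pullback v.2⟩) rfl
      right_inv := fun v => Subtype.ext <|
        q.apply_of_eq (u := ⟨v, notMem_A_of_notMem_pullback v.2⟩) <|
          p.apply_of_eq (u := ⟨q.symm.φ ⟨v, notMem_A_of_notMem_pullback v.2⟩,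
            apply_notMem_of_notMem_pullback (p := q.symm) v.2⟩) rfl
      map_rel_iff' := fun {u v} => by
        have h1 := p.φ.map_rel_iff (a := ⟨u, notMem_A_of_notMem_pullback u.2⟩)
          (b := ⟨v, notMem_A_of_notMem_pullback v.2⟩)
        have h2 := q.φ.map_rel_iff (a := ⟨p.φ ⟨u, notMem_A_of_notMem_pullback u.2⟩,
          apply_notMem_of_notMem_pullback u.2⟩) (b := ⟨p.φ ⟨v, notMem_A_of_notMem_pullback v.2⟩,
          apply_notMem_of_notMem_pullback v.2⟩)
        exact h2.trans h1 }

theorem one_induces : (one : AlmostAut d k).Induces 1 := fun _ _ => Iff.rfl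

theorem Induces.symm {p : AlmostAut d k} {g : Equiv.Perm (End d k)} (h : p.Induces g) :
    p.symm.Induces g⁻¹ := fun v ξ => by
  have := h (p.symm.φ v) (g⁻¹ ξ)
  rw [p.apply_symm_apply v, show g (g⁻¹ ξ) = ξ from g.apply_symm_apply ξ] at this
  exact this.symm

theorem Induces.comp {p q : AlmostAut d k} {g h : Equiv.Perm (End d k)} (hp : p.Induces g)
    (hq : q.Induces h) : (q.comp p).Induces (h * g) := fun v ξ =>
  (hp ⟨v, notMem_A_of_notMem_pullback v.2⟩ ξ).trans
    (hq ⟨p.φ ⟨v, notMem_A_of_notMem_pullback v.2⟩, apply_notMem_of_notMem_pullback v.2⟩ (g ξ))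

end AlmostAut

/-! ### The Neretin group -/

/-- The group of all permutations of the set of ends induced by almost automorphisms. -/
def neretinSubgroup (d k : ℕ) : Subgroup (Equiv.Perm (End d k)) where
  carrier := {g | ∃ p : AlmostAut d k, p.Induces g}
  one_mem' := ⟨_, AlmostAut.one_induces⟩
  inv_mem' := fun ⟨_, hp⟩ => ⟨_, hp.symm⟩
  mul_mem' := fun ⟨_, hq⟩ ⟨_, hp⟩ => ⟨_, hp.comp hq⟩

/-- The Neretin group `𝓝_{d,k}` of almost automorphisms of the tree, realised through its faithful
action on the set of ends. For `d ≥ 2` this is the set of almost automorphisms modulo equivalence: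
every almost automorphism induces exactly one permutation of the ends
(`AlmostAut.existsUnique_induces`), and two of them induce the same permutation iff they are
equivalent (`AlmostAut.induces_same_iff`). -/
def NeretinGroup (d k : ℕ) : Type := neretinSubgroup d k

instance (d k : ℕ) : Group (NeretinGroup d k) := inferInstanceAs (Group (neretinSubgroup d k))

instance (d k : ℕ) : MulAction (NeretinGroup d k) (End d k) :=
  inferInstanceAs (MulAction (neretinSubgroup d k) (End d k))

/-- The permutation of the ends given by an element of the Neretin group. -/
def NeretinGroup.toPerm {d k : ℕ} : NeretinGroup d k →* Equiv.Perm (End d k) :=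
  (neretinSubgroup d k).subtype

theorem NeretinGroup.smul_def {d k : ℕ} (g : NeretinGroup d k) (ξ : End d k) :
    g • ξ = NeretinGroup.toPerm g ξ := rfl

theorem NeretinGroup.toPerm_injective {d k : ℕ} :
    Function.Injective (NeretinGroup.toPerm (d := d) (k := k)) :=
  Subtype.val_injective

theorem NeretinGroup.exists_induces {d k : ℕ} (g : NeretinGroup d k) :
    ∃ p : AlmostAut d k, p.Induces (NeretinGroup.toPerm g) := g.2

/-- The automorphism group of the rooted tree. -/
abbrev TreeAut (d k : ℕ) : Type := (IsChild (d := d) (k := k)) ≃r (IsChild (d := d) (k := k))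

/-- The topology of pointwise convergence on the discrete set of vertices; it is the profinite
topology of the automorphism group. -/
instance (d k : ℕ) : TopologicalSpace (TreeAut d k) :=
  TopologicalSpace.induced (fun a : TreeAut d k => (a : Vertex d k → Vertex d k))
    (@Pi.topologicalSpace (Vertex d k) (fun _ => Vertex d k) (fun _ => ⊥))

namespace TreeAut

variable {d k : ℕ}

theorem map_root (a : TreeAut d k) : a Vertex.root = Vertex.root := by
  by_contra h
  obtain ⟨u, hu⟩ := exists_parent h
  have : IsChild (a.symm u) Vertex.root := by
    rw [← a.map_rel_iff, RelIso.apply_symm_apply]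
    exact hu
  exact not_isChild_root _ this

/-- A tree automorphism acts on ends by moving their rays. -/
def endMap (a : TreeAut d k) (ξ : End d k) : End d k where
  ray n := a (ξ.ray n)
  ray_zero := by rw [ξ.ray_zero, map_root]
  ray_succ n := a.map_rel_iff.2 (ξ.ray_succ n)

/-- The permutation of the ends given by a tree automorphism. -/
def endPerm (a : TreeAut d k) : Equiv.Perm (End d k) where
  toFun := endMap a
  invFun := endMap a⁻¹
  left_inv ξ := by ext1; funext n; exact a.symm_apply_apply _
  right_inv ξ := by ext1; funext n; exact a.apply_symm_apply _

theorem endMap_mem_shadow (a : TreeAut d k) (ξ : End d k) (v : Vertex d k) :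
    ξ ∈ shadow v ↔ endMap a ξ ∈ shadow (a v) :=
  exists_congr fun _ => a.injective.eq_iff.symm

/-- A tree automorphism as an almost automorphism. -/
def toAlmostAut (a : TreeAut d k) : AlmostAut d k where
  A := {Vertex.root}
  B := {Vertex.root}
  isFiniteSubtree_A := isFiniteSubtree_root
  isFiniteSubtree_B := isFiniteSubtree_root
  φ :=
    { toFun := fun v => ⟨a v, fun h => v.2 (a.injective (h.trans (map_root a).symm))⟩
      invFun := fun v => ⟨a.symm v, fun h => v.2 (by
        have := congrArg a (Set.mem_singleton_iff.1 h)
        rwa [RelIso.apply_symm_apply, map_root] at this)⟩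
      left_inv := fun v => Subtype.ext (a.symm_apply_apply _)
      right_inv := fun v => Subtype.ext (a.apply_symm_apply _)
      map_rel_iff' := a.map_rel_iff }

/-- The natural inclusion of the automorphism group of the tree in the Neretin group. -/
def toNeretin : TreeAut d k →* NeretinGroup d k where
  toFun a := ⟨endPerm a, toAlmostAut a, fun v ξ => endMap_mem_shadow a ξ v⟩
  map_one' := rfl
  map_mul' _ _ := rfl

end TreeAut

/-- The topology of the Neretin group: a set `U` is open iff, for every `g`, the set of all
automorphisms `a` of the tree with `g * a ∈ U` is open. It is the group topology
(`NeretinGroup.isTopologicalGroup`) for which the inclusion of the automorphism group of the tree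
is continuous and open (`TreeAut.continuous_toNeretin`, `TreeAut.isOpenMap_toNeretin`). -/
instance (d k : ℕ) : TopologicalSpace (NeretinGroup d k) :=
  ⨆ g : NeretinGroup d k,
    TopologicalSpace.coinduced (fun a : TreeAut d k => g * TreeAut.toNeretin a) inferInstance

/-- A locally compact group is unimodular if it has a Haar measure (a nonzero left-invariant Radon
measure) that is also right-invariant. -/
def IsUnimodular (G : Type*) [Group G] [TopologicalSpace G] : Prop :=
  letI : MeasurableSpace G := borel G
  ∃ μ : Measure G, μ.IsHaarMeasure ∧ μ.Regular ∧ μ.IsMulRightInvariant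

/-! ### Consistency of the definitions -/

namespace AlmostAut

variable {d k : ℕ}

theorem mapsTo_outerBoundary (p : AlmostAut d k) (v : Vertex d k) (hv : v ∈ outerBoundary p.A) :
    (p.φ ⟨v, hv.1⟩ : Vertex d k) ∈ outerBoundary p.B := by
  refine ⟨(p.φ ⟨v, hv.1⟩).2, ?_⟩
  obtain ⟨hvA, u, huA, huv⟩ := hv
  have hne : (p.φ ⟨v, hvA⟩ : Vertex d k) ≠ Vertex.root := fun h =>
    (p.φ ⟨v, hvA⟩).2 (h ▸ p.isFiniteSubtree_B.root_mem)
  obtain ⟨w, hw⟩ := exists_parent hne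
  refine ⟨w, ?_, hw⟩
  by_contra hwB
  have h1 : forestRel p.A (p.φ.symm ⟨w, hwB⟩) ⟨v, hvA⟩ := by
    rw [← p.φ.map_rel_iff, RelIso.apply_symm_apply]
    exact hw
  exact (p.φ.symm ⟨w, hwB⟩).2 (IsChild.parent_unique h1 huv ▸ huA)

/-- The condition `|∂A| = |∂B|` is automatic for almost automorphisms. -/
theorem ncard_outerBoundary_eq (p : AlmostAut d k) :
    (outerBoundary p.A).ncard = (outerBoundary p.B).ncard := by
  refine Set.ncard_congr (fun v hv => (p.φ ⟨v, hv.1⟩ : Vertex d k)) p.mapsTo_outerBoundary ?_ ?_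
  · intro u v hu hv h
    exact congrArg Subtype.val (p.φ.injective (Subtype.ext h))
  · intro w hw
    exact ⟨_, p.symm.mapsTo_outerBoundary w hw,
      congrArg Subtype.val (p.apply_symm_apply ⟨w, hw.1⟩)⟩

theorem exists_image (p : AlmostAut d k) (ξ : End d k) :
    ∃ η : End d k, ∀ v : (p.Aᶜ : Set (Vertex d k)), ξ ∈ shadow (v : Vertex d k) →
      η ∈ shadow (p.φ v : Vertex d k) := by
  classical
  obtain ⟨N, hN⟩ := ξ.exists_forall_notMem p.isFiniteSubtree_A
  obtain ⟨η, hη⟩ := exists_end_of_chain _ (fun n => (p.φ ⟨ξ.ray (N + n), hN n⟩ : Vertex d k))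
    (fun n => p.φ.map_rel_iff.2 (ξ.ray_succ (N + n))) rfl
  refine ⟨η, ?_⟩
  rintro ⟨v, hvA⟩ ⟨n, rfl⟩
  rcases Nat.le_total N n with h | h
  · obtain ⟨m, rfl⟩ := Nat.exists_eq_add_of_le h
    exact hη m
  · -- descend from `N` to `n`
    have key : ∀ m, n + m ≤ N → ∀ h' : ξ.ray (N - m) ∉ p.A,
        η ∈ shadow (p.φ ⟨ξ.ray (N - m), h'⟩ : Vertex d k) := by
      intro m
      induction m with
      | zero => intro _ _; exact hη 0
      | succ m ih =>
        intro hm h'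
        have hs : IsChild (ξ.ray (N - (m + 1))) (ξ.ray (N - m)) := by
          have := ξ.ray_succ (N - (m + 1))
          rwa [show N - (m + 1) + 1 = N - m by omega] at this
        have h'' : ξ.ray (N - m) ∉ p.A := fun hh => h' (p.isFiniteSubtree_A.parent_mem _ _ hs hh)
        have hrel : forestRel p.B (p.φ ⟨_, h'⟩) (p.φ ⟨_, h''⟩) := p.φ.map_rel_iff.2 hs
        exact mem_shadow_of_isChild hrel (ih (by omega) h'')
    have hNn : N - (N - n) = n := by omega
    have := key (N - n) (by omega)
    rw [hNn] at this
    exact this hvA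

theorem image_unique (p : AlmostAut d k) {ξ η η' : End d k}
    (h : ∀ v : (p.Aᶜ : Set (Vertex d k)), ξ ∈ shadow (v : Vertex d k) →
      η ∈ shadow (p.φ v : Vertex d k))
    (h' : ∀ v : (p.Aᶜ : Set (Vertex d k)), ξ ∈ shadow (v : Vertex d k) →
      η' ∈ shadow (p.φ v : Vertex d k)) : η = η' := by
  obtain ⟨N, hN⟩ := ξ.exists_forall_notMem p.isFiniteSubtree_A
  exact End.eq_of_chain (c := fun n => (p.φ ⟨ξ.ray (N + n), hN n⟩ : Vertex d k))
    (fun n => p.φ.map_rel_iff.2 (ξ.ray_succ (N + n)))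
    (fun n => h _ ⟨_, rfl⟩) (fun n => h' _ ⟨_, rfl⟩)

/-- Every almost automorphism induces exactly one permutation of the set of ends. -/
theorem existsUnique_induces (p : AlmostAut d k) :
    ∃! g : Equiv.Perm (End d k), p.Induces g := by
  choose f hf using p.exists_image
  choose f' hf' using p.symm.exists_image
  have hff' : ∀ ξ, f' (f ξ) = ξ := fun ξ => by
    obtain ⟨N, hN⟩ := ξ.exists_forall_notMem p.isFiniteSubtree_A
    refine End.eq_of_chain (c := fun n => ξ.ray (N + n)) (fun n => ξ.ray_succ (N + n))
      (fun n => ?_) (fun n => ⟨_, rfl⟩)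
    have := hf' (f ξ) (p.φ ⟨_, hN n⟩) (hf ξ ⟨_, hN n⟩ ⟨_, rfl⟩)
    rwa [p.symm_apply_apply] at this
  have hf'f : ∀ ξ, f (f' ξ) = ξ := fun ξ => by
    obtain ⟨N, hN⟩ := ξ.exists_forall_notMem p.isFiniteSubtree_B
    refine End.eq_of_chain (c := fun n => ξ.ray (N + n)) (fun n => ξ.ray_succ (N + n))
      (fun n => ?_) (fun n => ⟨_, rfl⟩)
    have := hf (f' ξ) (p.symm.φ ⟨_, hN n⟩) (hf' ξ ⟨_, hN n⟩ ⟨_, rfl⟩)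
    exact (congrArg Subtype.val (p.apply_symm_apply ⟨_, hN n⟩)).subst
      (motive := fun w => f (f' ξ) ∈ shadow w) this
  refine ⟨⟨f, f', hff', hf'f⟩, fun v ξ => ⟨hf ξ v, fun h => ?_⟩, fun g hg => ?_⟩
  · have := hf' (f ξ) (p.φ v) h
    rwa [hff', p.symm_apply_apply] at this
  · ext1 ξ
    exact p.image_unique (fun v => (hg v ξ).1) (hf ξ)

theorem exists_end_through (hd : 0 < d) (hk : 0 < k) (v : Vertex d k) :
    ∃ ξ : End d k, ξ ∈ shadow v := by
  have hex : ∀ u : Vertex d k, ∃ w, IsChild u w := fun u => by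
    cases u with
    | root => exact ⟨_, IsChild.root ⟨0, hk⟩⟩
    | node i w => exact ⟨_, IsChild.node i w ⟨0, hd⟩⟩
  choose s hs using hex
  obtain ⟨ξ, hξ⟩ := exists_end_of_chain _ (fun n => s^[n] v)
    (fun n => by rw [Function.iterate_succ_apply']; exact hs _) rfl
  exact ⟨ξ, hξ 0⟩

/-- The ends below a vertex determine it, provided that branching occurs. -/
theorem shadow_injective (hd : 2 ≤ d) (hk : 2 ≤ k) {u v : Vertex d k} (h : shadow u = shadow v) :
    u = v := by
  have key : ∀ u v : Vertex d k, shadow u = shadow v → depth u ≤ depth v := by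
    intro u v h
    by_contra! hlt
    have hch : ∀ w : Vertex d k, ∃ a b, a ≠ b ∧ IsChild w a ∧ IsChild w b := fun w => by
      cases w with
      | root =>
        refine ⟨_, _, ?_, IsChild.root ⟨0, by omega⟩, IsChild.root ⟨1, by omega⟩⟩
        simp
      | node i w =>
        refine ⟨_, _, ?_, IsChild.node i w ⟨0, by omega⟩, IsChild.node i w ⟨1, by omega⟩⟩
        simp
    obtain ⟨a, b, hab, ha, hb⟩ := hch v
    obtain ⟨ξ, hξ⟩ := exists_end_through (by omega) (by omega) a
    obtain ⟨η, hη⟩ := exists_end_through (by omega) (by omega) b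
    have hξu : ξ ∈ shadow u := h ▸ mem_shadow_of_isChild ha hξ
    have hηu : η ∈ shadow u := h ▸ mem_shadow_of_isChild hb hη
    rw [mem_shadow_iff] at hξ hη hξu hηu
    rw [ha.depth_eq] at hξ
    rw [hb.depth_eq] at hη
    have := End.ray_eq_of_le (hξu.trans hηu.symm) (depth v + 1) hlt
    exact hab (hξ.symm.trans (this.trans hη))
  have hdep : depth u = depth v := le_antisymm (key u v h) (key v u h.symm)
  obtain ⟨ξ, hξ⟩ := exists_end_through (by omega) (by omega) u
  have hξ' : ξ ∈ shadow v := h ▸ hξ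
  rw [mem_shadow_iff] at hξ hξ'
  rw [← hξ, ← hξ', hdep]

/-- Two almost automorphisms induce the same permutation of the ends iff they are equivalent. -/
theorem induces_same_iff (hd : 2 ≤ d) (hk : 2 ≤ k) (p q : AlmostAut d k)
    {g h : Equiv.Perm (End d k)} (hp : p.Induces g) (hq : q.Induces h) :
    g = h ↔ p.Equivalent q := by
  constructor
  · rintro rfl
    refine ⟨p.A ∪ q.A, p.isFiniteSubtree_A.union q.isFiniteSubtree_A, subset_rfl,
      fun v hvp hvq _ => shadow_injective hd hk ?_⟩
    ext ξ
    have h1 := hp ⟨v, hvp⟩ (g⁻¹ ξ)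
    have h2 := hq ⟨v, hvq⟩ (g⁻¹ ξ)
    rw [show g (g⁻¹ ξ) = ξ from g.apply_symm_apply ξ] at h1 h2
    exact h1.symm.trans h2
  · rintro ⟨C, hC, hsub, heq⟩
    ext1 ξ
    obtain ⟨N, hN⟩ := ξ.exists_forall_notMem hC
    have hNp : ∀ n, ξ.ray (N + n) ∉ p.A := fun n hh => hN n (hsub (Or.inl hh))
    have hNq : ∀ n, ξ.ray (N + n) ∉ q.A := fun n hh => hN n (hsub (Or.inr hh))
    refine End.eq_of_chain (c := fun n => (p.φ ⟨ξ.ray (N + n), hNp n⟩ : Vertex d k))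
      (fun n => p.φ.map_rel_iff.2 (ξ.ray_succ (N + n)))
      (fun n => (hp ⟨_, hNp n⟩ ξ).1 ⟨_, rfl⟩) (fun n => ?_)
    rw [heq _ (hNp n) (hNq n) (hN n)]
    exact (hq ⟨_, hNq n⟩ ξ).1 ⟨_, rfl⟩

end AlmostAut

namespace TreeAut

variable {d k : ℕ}

theorem mem_nhds_iff {a : TreeAut d k} {S : Set (TreeAut d k)} :
    S ∈ 𝓝 a ↔ ∃ F : Set (Vertex d k), F.Finite ∧ ∀ b : TreeAut d k, (∀ v ∈ F, b v = a v) → b ∈ S := by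
  let _ : TopologicalSpace (Vertex d k) := ⊥
  have : DiscreteTopology (Vertex d k) := ⟨rfl⟩
  rw [nhds_induced, Filter.mem_comap]
  constructor
  · rintro ⟨T, hT, hTS⟩
    rw [nhds_pi, Filter.mem_pi] at hT
    obtain ⟨F, hF, t, ht, hsub⟩ := hT
    exact ⟨F, hF, fun b hb => hTS (hsub fun v hv => by
      change b v ∈ t v
      rw [hb v hv]
      exact mem_of_mem_nhds (ht v))⟩
  · rintro ⟨F, hF, h⟩
    refine ⟨F.pi fun v => {a v}, ?_, fun b hb => h b fun v hv => hb v hv⟩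
    exact set_pi_mem_nhds hF fun v _ => by simp

theorem isTopologicalGroup : IsTopologicalGroup (TreeAut d k) where
  continuous_mul := by
    rw [continuous_iff_continuousAt]
    rintro ⟨a, b⟩ S hS
    obtain ⟨F, hF, h⟩ := mem_nhds_iff.1 hS
    have h1 : {a' : TreeAut d k | ∀ v ∈ b '' F, a' v = a v} ∈ 𝓝 a :=
      mem_nhds_iff.2 ⟨_, hF.image _, fun _ h => h⟩
    have h2 : {b' : TreeAut d k | ∀ v ∈ F, b' v = b v} ∈ 𝓝 b :=
      mem_nhds_iff.2 ⟨_, hF, fun _ h => h⟩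
    rw [Filter.mem_map, nhds_prod_eq]
    refine Filter.mem_of_superset (Filter.prod_mem_prod h1 h2) ?_
    rintro ⟨a', b'⟩ ⟨ha, hb⟩
    refine h _ fun v hv => ?_
    change a' (b' v) = a (b v)
    rw [hb v hv, ha _ ⟨v, hv, rfl⟩]
  continuous_inv := by
    rw [continuous_iff_continuousAt]
    intro a S hS
    obtain ⟨F, hF, h⟩ := mem_nhds_iff.1 hS
    rw [Filter.mem_map]
    refine mem_nhds_iff.2 ⟨_, hF.image (a⁻¹ : TreeAut d k), fun b hb => h _ fun v hv => ?_⟩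
    have h1 := hb _ ⟨v, hv, rfl⟩
    rw [RelIso.apply_inv_self] at h1
    rw [← RelIso.inv_apply_self b (a⁻¹ v), h1]

theorem isOpen_iff {U : Set (NeretinGroup d k)} :
    IsOpen U ↔ ∀ g : NeretinGroup d k, IsOpen {a : TreeAut d k | g * toNeretin a ∈ U} := by
  refine isOpen_iSup_iff.trans (forall_congr' fun g => ?_)
  exact isOpen_coinduced

theorem continuous_toNeretin : Continuous (toNeretin (d := d) (k := k)) :=
  ⟨fun U hU => by
    have h := isOpen_iff.1 hU 1
    simp only [one_mul] at h
    exact h⟩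

theorem isOpenMap_toNeretin : IsOpenMap (toNeretin (d := d) (k := k)) := by
  have := isTopologicalGroup (d := d) (k := k)
  intro U hU
  refine isOpen_iff.2 fun g => ?_
  by_cases hg : ∃ b : TreeAut d k, toNeretin b = g
  · obtain ⟨b, rfl⟩ := hg
    have : {a : TreeAut d k | toNeretin b * toNeretin a ∈ toNeretin '' U} =
        ⋃ c ∈ {c : TreeAut d k | toNeretin c = 1}, (fun a => b * a * c) ⁻¹' U := by
      ext a
      simp only [Set.mem_ofPred_eq, Set.mem_image, Set.mem_iUnion, Set.mem_preimage, exists_prop]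
      constructor
      · rintro ⟨x, hx, hxa⟩
        refine ⟨(b * a)⁻¹ * x, ?_, by rwa [mul_inv_cancel_left]⟩
        rw [map_mul, hxa, map_inv, map_mul, inv_mul_cancel]
      · rintro ⟨c, hc, hU⟩
        exact ⟨_, hU, by rw [map_mul, hc, map_mul, mul_one]⟩
    rw [this]
    exact isOpen_biUnion fun c _ => hU.preimage (by fun_prop)
  · convert isOpen_empty
    ext a
    simp only [Set.mem_ofPred_eq, Set.mem_empty_iff_false, iff_false]
    rintro ⟨x, -, hx⟩
    exact hg ⟨x * a⁻¹, by rw [map_mul, hx, map_inv, mul_inv_cancel_right]⟩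

end TreeAut

namespace NeretinGroup

variable {d k : ℕ}

theorem continuous_mul_left' (g : NeretinGroup d k) : Continuous (g * ·) := by
  refine ⟨fun U hU => TreeAut.isOpen_iff.2 fun h => ?_⟩
  simpa [mul_assoc] using TreeAut.isOpen_iff.1 hU (g * h)

theorem nhds_eq_map (g : NeretinGroup d k) : 𝓝 g = map (g * ·) (𝓝 1) := by
  let e : NeretinGroup d k ≃ₜ NeretinGroup d k :=
    { toFun := (g * ·)
      invFun := (g⁻¹ * ·)
      left_inv := fun x => by simp
      right_inv := fun x => by simp
      continuous_toFun := continuous_mul_left' g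
      continuous_invFun := continuous_mul_left' g⁻¹ }
  have := e.map_nhds_eq 1
  rw [show e 1 = g from mul_one g] at this
  exact this.symm

theorem nhds_one : 𝓝 (1 : NeretinGroup d k) = map TreeAut.toNeretin (𝓝 1) := by
  have := TreeAut.isOpenMap_toNeretin.nhds_le (1 : TreeAut d k)
  rw [map_one] at this
  refine le_antisymm this ?_
  have := (TreeAut.continuous_toNeretin (d := d) (k := k)).tendsto 1
  rwa [map_one] at this

open Classical in
/-- If `w` fixes `A` and its boundary pointwise, then `φ w φ⁻¹` extended by the identity on `B`. -/
noncomputable def conjFun (p : AlmostAut d k) (w : TreeAut d k) (v : Vertex d k) : Vertex d k :=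
  if h : v ∈ p.B then v else
    if h' : w (p.symm.φ ⟨v, h⟩) ∈ p.A then v else p.φ ⟨w (p.symm.φ ⟨v, h⟩), h'⟩

theorem conjFun_of_mem {p : AlmostAut d k} {w : TreeAut d k} {v : Vertex d k} (h : v ∈ p.B) :
    conjFun p w v = v := by
  rw [conjFun, dif_pos h]

theorem apply_notMem {p : AlmostAut d k} {w : TreeAut d k} (hw : ∀ v ∈ p.A, w v = v)
    {v : Vertex d k} (h : v ∉ p.A) : w v ∉ p.A := fun h' => by
  have := w.injective (hw _ h')
  rw [this] at h'
  exact h h'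

theorem conjFun_of_notMem {p : AlmostAut d k} {w : TreeAut d k} (hw : ∀ v ∈ p.A, w v = v)
    {v : Vertex d k} (h : v ∉ p.B) :
    conjFun p w v = p.φ ⟨w (p.symm.φ ⟨v, h⟩), apply_notMem hw (p.symm.φ ⟨v, h⟩).2⟩ := by
  rw [conjFun, dif_neg h, dif_neg]

theorem conjFun_notMem {p : AlmostAut d k} {w : TreeAut d k} (hw : ∀ v ∈ p.A, w v = v)
    {v : Vertex d k} (h : v ∉ p.B) : conjFun p w v ∉ p.B := by
  rw [conjFun_of_notMem hw h]
  exact Subtype.coe_prop (p.φ _)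

theorem conjFun_conjFun {p : AlmostAut d k} {w w' : TreeAut d k} (hw : ∀ v ∈ p.A, w v = v)
    (hw' : ∀ v ∈ p.A, w' v = v) (hww' : ∀ v, w' (w v) = v) (v : Vertex d k) :
    conjFun p w' (conjFun p w v) = v := by
  by_cases h : v ∈ p.B
  · rw [conjFun_of_mem h, conjFun_of_mem h]
  · rw [conjFun_of_notMem hw' (conjFun_notMem hw h)]
    refine p.apply_of_eq (u := ⟨v, h⟩) ?_
    change w' (p.symm.φ ⟨conjFun p w v, conjFun_notMem hw h⟩) = _
    rw [p.symm_apply_of_eq (u := ⟨w (p.symm.φ ⟨v, h⟩), apply_notMem hw (p.symm.φ ⟨v, h⟩).2⟩)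
      (conjFun_of_notMem hw h)]
    exact hww' _

theorem conjFun_isChild {p : AlmostAut d k} {w : TreeAut d k} (hw : ∀ v ∈ p.A, w v = v)
    (hw' : ∀ v ∈ outerBoundary p.A, w v = v) {u v : Vertex d k} (huv : IsChild u v) :
    IsChild (conjFun p w u) (conjFun p w v) := by
  by_cases hv : v ∈ p.B
  · rwa [conjFun_of_mem hv, conjFun_of_mem (p.isFiniteSubtree_B.parent_mem u v huv hv)]
  · by_cases hu : u ∈ p.B
    · have e : conjFun p w v = v := by
        rw [conjFun_of_notMem hw hv]
        have e1 := hw' _ (p.symm.mapsTo_outerBoundary v ⟨hv, u, hu, huv⟩)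
        exact p.apply_of_eq (u := ⟨v, hv⟩) e1
      rwa [e, conjFun_of_mem hu]
    · rw [conjFun_of_notMem hw hu, conjFun_of_notMem hw hv]
      refine p.φ.map_rel_iff.2 (w.map_rel_iff.2 ?_)
      exact p.symm.φ.map_rel_iff (a := ⟨u, hu⟩) (b := ⟨v, hv⟩) |>.2 huv

theorem inv_apply_eq {w : TreeAut d k} {v : Vertex d k} (h : w v = v) : w⁻¹ v = v := by
  conv_lhs => rw [← h]
  exact RelIso.inv_apply_self w v

/-- The automorphism `φ w φ⁻¹`, for `w` fixing `A` and its boundary pointwise. -/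
noncomputable def conjAut (p : AlmostAut d k) (w : TreeAut d k) (hw : ∀ v ∈ p.A, w v = v)
    (hw' : ∀ v ∈ outerBoundary p.A, w v = v) : TreeAut d k where
  toFun := conjFun p w
  invFun := conjFun p w⁻¹
  left_inv := conjFun_conjFun hw (fun v hv => inv_apply_eq (hw v hv)) (RelIso.inv_apply_self w)
  right_inv := conjFun_conjFun (fun v hv => inv_apply_eq (hw v hv)) hw (RelIso.apply_inv_self w)
  map_rel_iff' := fun {u v} => by
    refine ⟨fun h => ?_, fun h => conjFun_isChild hw hw' h⟩
    have hi : ∀ v ∈ p.A, w⁻¹ v = v := fun v hv => inv_apply_eq (hw v hv)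
    have := conjFun_isChild (p := p) hi (fun v hv => inv_apply_eq (hw' v hv)) h
    simp only [Equiv.coe_fn_mk] at this
    rwa [conjFun_conjFun hw hi (RelIso.inv_apply_self w),
      conjFun_conjFun hw hi (RelIso.inv_apply_self w)] at this

theorem tendsto_conj (g : NeretinGroup d k) :
    Tendsto (g * · * g⁻¹) (𝓝 (1 : NeretinGroup d k)) (𝓝 1) := by
  obtain ⟨p, hp⟩ := g.exists_induces
  rw [nhds_one, Filter.tendsto_map'_iff]
  intro S hS
  rw [Filter.mem_map] at hS
  obtain ⟨F, hF, hFS⟩ := TreeAut.mem_nhds_iff.1 hS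
  rw [Filter.mem_map]
  have hfin : ((fun v : (p.Bᶜ : Set (Vertex d k)) => (p.symm.φ v : Vertex d k)) ''
      {v | (v : Vertex d k) ∈ F}).Finite :=
    (hF.preimage Subtype.val_injective.injOn).image _
  refine TreeAut.mem_nhds_iff.2 ⟨_, (p.isFiniteSubtree_A.finite.union
    ((finite_children p.isFiniteSubtree_A.finite).union hfin)), fun w hfix => ?_⟩
  have hw : ∀ v ∈ p.A, w v = v := fun v hv => hfix v (Or.inl hv)
  have hw' : ∀ v ∈ outerBoundary p.A, w v = v := fun v hv => hfix v (Or.inr (Or.inl hv.2))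
  have hmem : conjAut p w hw hw' ∈ TreeAut.toNeretin ⁻¹' S := by
    refine hFS _ fun v hv => ?_
    change conjFun p w v = v
    by_cases h : v ∈ p.B
    · exact conjFun_of_mem h
    · rw [conjFun_of_notMem hw h]
      have e1 := hfix _ (Or.inr (Or.inr ⟨⟨v, h⟩, hv, rfl⟩))
      exact p.apply_of_eq (u := ⟨v, h⟩) e1
  suffices h : TreeAut.toNeretin (conjAut p w hw hw') = g * TreeAut.toNeretin w * g⁻¹ by
    rw [Set.mem_preimage, h] at hmem
    exact hmem
  rw [eq_mul_inv_iff_mul_eq]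
  apply toPerm_injective
  ext1 ξ
  change TreeAut.endMap _ (toPerm g ξ) = toPerm g (TreeAut.endMap w ξ)
  obtain ⟨N, hN⟩ := ξ.exists_forall_notMem p.isFiniteSubtree_A
  refine End.eq_of_chain
    (c := fun n => (p.φ ⟨w (ξ.ray (N + n)), apply_notMem hw (hN n)⟩ : Vertex d k))
    (fun n => p.φ.map_rel_iff.2 (w.map_rel_iff.2 (ξ.ray_succ (N + n)))) (fun n => ?_) (fun n => ?_)
  · have h1 : toPerm g ξ ∈ shadow (p.φ ⟨_, hN n⟩ : Vertex d k) := (hp ⟨_, hN n⟩ ξ).1 ⟨_, rfl⟩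
    have h2 := (TreeAut.endMap_mem_shadow (conjAut p w hw hw') _ _).1 h1
    have h3 : conjAut p w hw hw' (p.φ ⟨_, hN n⟩) =
        (p.φ ⟨w (ξ.ray (N + n)), apply_notMem hw (hN n)⟩ : Vertex d k) := by
      change conjFun p w _ = _
      rw [conjFun_of_notMem hw (Subtype.coe_prop (p.φ ⟨_, hN n⟩))]
      congr 3
      exact congrArg w (p.symm_apply_of_eq (u := ⟨_, hN n⟩) rfl)
    rwa [h3] at h2
  · exact (hp ⟨_, apply_notMem hw (hN n)⟩ _).1 ⟨N + n, rfl⟩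

instance isTopologicalGroup : IsTopologicalGroup (NeretinGroup d k) := by
  have := TreeAut.isTopologicalGroup (d := d) (k := k)
  refine IsTopologicalGroup.of_nhds_one ?_ ?_ nhds_eq_map tendsto_conj
  · rw [nhds_one, Filter.prod_map_map_eq, Filter.tendsto_map'_iff]
    have h : Tendsto (fun x : TreeAut d k × TreeAut d k => x.1 * x.2) (𝓝 1 ×ˢ 𝓝 1) (𝓝 1) := by
      have := (continuous_mul (M := TreeAut d k)).tendsto (1, 1)
      rwa [mul_one, nhds_prod_eq] at this
    convert (Filter.tendsto_map (f := TreeAut.toNeretin)).comp h using 1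
    funext x
    exact (map_mul TreeAut.toNeretin x.1 x.2).symm
  · rw [nhds_one, Filter.tendsto_map'_iff]
    have h : Tendsto (fun x : TreeAut d k => x⁻¹) (𝓝 1) (𝓝 1) := by
      have := (continuous_inv (G := TreeAut d k)).tendsto 1
      rwa [inv_one] at this
    convert (Filter.tendsto_map (f := TreeAut.toNeretin)).comp h using 1
    funext x
    exact (map_inv TreeAut.toNeretin x).symm

end NeretinGroup

end NeretinTree

namespace NeretinTree

set_option linter.unusedSectionVars false

/-! ### Streams of digits -/

section Streams

variable {A : Type*}

/-! Write `G` for the Neretin group, `ξ` for `zeroEnd`, `G_ξ` for its stabilizer and `K` for the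
compact open subgroup `levelSubgroup d k 0`. Everything is done with transformations of the ends: an
element of `G` is a permutation that is tree-like on every cone of some level
(`exists_neretin_of_table`, `exists_table`). Let `zeroGerm` be the group of the elements that fix
`ξ` and preserve levels near it. The heart of the matter is that every closed cocompact subgroup `H`
has a conjugate containing `zeroGerm` (`exists_zeroGerm_le_stabilizer`).

By cocompactness `G = K T H` with `T` finite. The elements of `K` induce on a level with `N`
vertices a number of permutations at most exponential in `N`, whereas the permutations of a fixed
proportion of these vertices are factorially many. By pigeonhole, `H` induces a nontrivial
permutation supported in any such set of vertices (`exists_mem_levelAction`). Commutators then yield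
3-cycles, and even the alternating group of a set of `q` vertices, for any prescribed `q` and all
large levels (`exists_containsCycle_levelAction`). Conjugation spreads these vertices over a whole
level except the vertex on the ray to `ξ`. Hence some point of `G ⧸ H` has a stabilizer inducing all
even permutations of level `n` that fix this vertex (`evenPoints_nonempty`). Such points form
decreasing compact sets, so one point `ω` serves all `n`. As the stabilizer `Γ` of `ω` is closed, it
contains all elements that fix `ξ` and permute some level (`mem_of_isClosed_of_levelAction`).

Cocompactness is used again to find in `Γ` an element that changes the relative depth of two cones.
This produces exchanges of cones of different depths (`exists_exchanges_succ`), and Kraft's equality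
shows that these, together with the level-permuting elements, generate `zeroGerm`
(`zeroGerm_le_of_exchanges`).

An element moving `ξ` generates `G` together with `zeroGerm` (`eq_top_of_zeroGerm_le`), so for
proper `H` the group `Γ` fixes `ξ`. Since `zeroGerm` is normal in `G_ξ` and contains `K ∩ G_ξ`, the
finite set `T` bounds the index of `Γ` in `G_ξ`.

For unimodularity, the elements whose right translation preserves Haar measure form a subgroup. It
contains the level-permuting elements, which normalize a compact open subgroup, and all involutions,
hence everything (`rightInvariance_eq_top`). A proper cocompact `H` contains, up to conjugacy, a
power of an element of `G_ξ` that conjugates a compact open subgroup of `H` strictly into itself,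
which is impossible in a unimodular group (`IsUnimodular.conj_mem`). -/

theorem perm_apply_inv (α : Equiv.Perm A) (x : A) : α (α⁻¹ x) = x := α.apply_symm_apply x

theorem perm_inv_apply (α : Equiv.Perm A) (x : A) : α⁻¹ (α x) = x := α.symm_apply_apply x

theorem appendStream_injective (l : List A) :
    Function.Injective (fun x : Stream' A => l ++ₛ x) := fun x y h => by
  have := congrArg (Stream'.drop l.length) h
  simpa only [Stream'.drop_append_stream] using this

theorem take_length_append (l : List A) (x : Stream' A) : (l ++ₛ x).take l.length = l := by
  rw [Stream'.take_append_of_le_length (h := le_rfl), List.take_length]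

theorem take_add_append (l : List A) (n : ℕ) (x : Stream' A) :
    (l ++ₛ x).take (l.length + n) = l ++ x.take n := by
  induction l with
  | nil => simp
  | cons a l ih =>
    rw [Stream'.cons_append_stream, List.length_cons, Nat.add_right_comm, Stream'.take_succ_cons,
      ih, List.cons_append]

theorem take_of_take_eq {x y : Stream' A} {m n : ℕ} (h : x.take n = y.take n) (hm : m ≤ n) :
    x.take m = y.take m := by
  have := congrArg (List.take m) h
  rwa [Stream'.take_take, Stream'.take_take, min_eq_right hm] at this

theorem eq_append_of_take {x : Stream' A} {l : List A} (h : x.take l.length = l) :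
    l ++ₛ x.drop l.length = x := by
  conv_rhs => rw [← Stream'.append_take_drop l.length x, h]

theorem exists_append_of_append_eq {l m : List A} {x y : Stream' A} (h : l ++ₛ x = m ++ₛ y)
    (hl : l.length ≤ m.length) : ∃ s, m = l ++ s ∧ x = s ++ₛ y := by
  have h1 := congrArg (Stream'.take l.length) h
  rw [take_length_append, Stream'.take_append_of_le_length (h := hl)] at h1
  refine ⟨m.drop l.length, ?_, ?_⟩
  · conv_rhs => rw [h1]
    rw [List.length_take, min_eq_left hl, List.take_append_drop]
  · have h2 : m = l ++ m.drop l.length := by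
      conv_rhs => rw [h1]
      rw [List.length_take, min_eq_left hl, List.take_append_drop]
    rw [h2, Stream'.append_append_stream] at h
    exact appendStream_injective l h

end Streams

/-! ### Automorphisms of the regular rooted tree of digits -/

/-- The permutations of the streams which preserve the length of common prefixes. -/
def digitAut (d : ℕ) : Subgroup (Equiv.Perm (Stream' (Fin d))) where
  carrier := {α | ∀ x y n, (α x).take n = (α y).take n ↔ x.take n = y.take n}
  one_mem' := fun _ _ _ => Iff.rfl
  mul_mem' := fun {α β} ha hb x y n => (ha (β x) (β y) n).trans (hb x y n)
  inv_mem' := fun {α} ha x y n => by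
    have := ha (α⁻¹ x) (α⁻¹ y) n
    rw [perm_apply_inv, perm_apply_inv] at this
    exact this.symm

section DigitAut

variable {d : ℕ}

theorem take_append_iff {A : Type*} {l : List A} {x y : Stream' A} {n : ℕ} :
    (l ++ₛ x).take (l.length + n) = (l ++ₛ y).take (l.length + n) ↔ x.take n = y.take n := by
  rw [take_add_append, take_add_append, List.append_cancel_left_eq]

/-- An automorphism of the tree of digits maps subtrees to subtrees. -/
theorem exists_section [Nonempty (Fin d)] {α : Equiv.Perm (Stream' (Fin d))} (hα : α ∈ digitAut d)
    (s : List (Fin d)) :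
    ∃ s' : List (Fin d), s'.length = s.length ∧ ∃ β ∈ digitAut d, ∀ x, α (s ++ₛ x) = s' ++ₛ β x := by
  obtain ⟨a⟩ := ‹Nonempty (Fin d)›
  set s' := (α (s ++ₛ Stream'.const a)).take s.length with hs'
  have hl : s'.length = s.length := Stream'.length_take _ _
  have h1 : ∀ x, (α (s ++ₛ x)).take s'.length = s' := fun x => by
    rw [hl]
    exact (hα _ _ _).2 (by rw [take_length_append, take_length_append])
  have h2 : ∀ y, (α⁻¹ (s' ++ₛ y)).take s.length = s := fun y => by
    have : (α (α⁻¹ (s' ++ₛ y))).take s.length = (α (s ++ₛ Stream'.const a)).take s.length := by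
      rw [perm_apply_inv, ← hs', ← hl, take_length_append]
    rw [hα, take_length_append] at this
    exact this
  let β : Equiv.Perm (Stream' (Fin d)) :=
    { toFun := fun x => (α (s ++ₛ x)).drop s'.length
      invFun := fun y => (α⁻¹ (s' ++ₛ y)).drop s.length
      left_inv := fun x => by
        simp only
        rw [eq_append_of_take (h1 x), perm_inv_apply, Stream'.drop_append_stream]
      right_inv := fun y => by
        simp only
        rw [eq_append_of_take (h2 y), perm_apply_inv, Stream'.drop_append_stream] }
  have h3 : ∀ x, α (s ++ₛ x) = s' ++ₛ β x := fun x => (eq_append_of_take (h1 x)).symm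
  refine ⟨s', hl, β, fun x y n => ?_, h3⟩
  rw [← take_append_iff (l := s'), ← h3, ← h3, hα, hl, take_append_iff]

end DigitAut

/-! ### Addresses and cones -/

/-- Addresses of the vertices other than the root, the first choice first. -/
abbrev Addr (d k : ℕ) : Type := Fin k × List (Fin d)

section Address

variable {d k : ℕ}

/-- The end that passes through the `i`-th child of the root and then makes the choices `x`. -/
def pt (i : Fin k) (x : Stream' (Fin d)) : End d k where
  ray n := Nat.casesOn n Vertex.root fun n => Vertex.node i (x.take n).reverse
  ray_zero := rfl
  ray_succ n := by
    cases n with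
    | zero => exact IsChild.root i
    | succ n =>
      change IsChild (Vertex.node i (x.take n).reverse) (Vertex.node i (x.take (n + 1)).reverse)
      rw [Stream'.take_succ', List.reverse_append]
      exact IsChild.node _ _ _

theorem pt_ray_succ (i : Fin k) (x : Stream' (Fin d)) (n : ℕ) :
    (pt i x).ray (n + 1) = Vertex.node i (x.take n).reverse := rfl

theorem pt_inj {i j : Fin k} {x y : Stream' (Fin d)} : pt i x = pt j y ↔ i = j ∧ x = y := by
  refine ⟨fun h => ?_, fun ⟨h1, h2⟩ => by rw [h1, h2]⟩
  have h1 : ∀ n, Vertex.node i (x.take n).reverse = Vertex.node j (y.take n).reverse := fun n => by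
    rw [← pt_ray_succ, ← pt_ray_succ, h]
  refine ⟨(Vertex.node.inj (h1 0)).1, Stream'.take_theorem _ _ fun n => ?_⟩
  exact List.reverse_injective (Vertex.node.inj (h1 n)).2

theorem exists_pt (ξ : End d k) : ∃ i x, ξ = pt i x := by
  have h0 := ξ.ray_succ 0
  rw [ξ.ray_zero] at h0
  generalize hv : ξ.ray (0 + 1) = v at h0
  cases h0 with
  | root i =>
    have hstep : ∀ n (w : List (Fin d)), ξ.ray (n + 1) = Vertex.node i w →
        ∃ a, ξ.ray (n + 2) = Vertex.node i (a :: w) := fun n w h => by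
      have h1 := ξ.ray_succ (n + 1)
      rw [h] at h1
      change IsChild _ (ξ.ray (n + 2)) at h1
      generalize ξ.ray (n + 2) = u at h1
      cases h1 with
      | node _ _ a => exact ⟨a, rfl⟩
    have hex : ∀ n, ∃ w : List (Fin d), ξ.ray (n + 1) = Vertex.node i w := fun n => by
      induction n with
      | zero => exact ⟨[], hv⟩
      | succ n ih =>
        obtain ⟨w, hw⟩ := ih
        obtain ⟨a, ha⟩ := hstep n w hw
        exact ⟨_, ha⟩
    choose w hw using hex
    have hw' : ∀ n, ∃ a, w (n + 1) = a :: w n := fun n => by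
      obtain ⟨a, ha⟩ := hstep n (w n) (hw n)
      exact ⟨a, (Vertex.node.inj ((hw (n + 1)).symm.trans ha)).2⟩
    choose a' ha using hw'
    obtain ⟨a, rfl⟩ : ∃ a : Stream' (Fin d), a.get = a' := ⟨a', rfl⟩
    have hw0 : w 0 = [] := (Vertex.node.inj ((hw 0).symm.trans hv)).2
    have hwn : ∀ n, w n = (a.take n).reverse := fun n => by
      induction n with
      | zero => rw [hw0]; rfl
      | succ n ih =>
        rw [ha, ih, Stream'.take_succ', List.reverse_append]
        rfl
    refine ⟨i, a, End.ext (funext fun n => ?_)⟩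
    cases n with
    | zero => rw [ξ.ray_zero]; rfl
    | succ n => rw [hw, hwn, pt_ray_succ]

/-- The vertex with a given address. -/
def vert (u : Addr d k) : Vertex d k := Vertex.node u.1 u.2.reverse

/-- The end below the vertex with address `u` which continues with the choices `x`. -/
def below (u : Addr d k) (x : Stream' (Fin d)) : End d k := pt u.1 (u.2 ++ₛ x)

/-- The set of ends below the vertex with address `u`. -/
def cone (u : Addr d k) : Set (End d k) := Set.range (below u)

/-- The address obtained by making further choices. -/
def extend (u : Addr d k) (s : List (Fin d)) : Addr d k := (u.1, u.2 ++ s)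

/-- The number of choices in an address, after the first one. -/
def len (u : Addr d k) : ℕ := u.2.length

@[simp] theorem len_extend (u : Addr d k) (s : List (Fin d)) :
    len (extend u s) = len u + s.length := List.length_append

@[simp] theorem extend_nil (u : Addr d k) : extend u [] = u := by
  simp [extend]

theorem extend_extend (u : Addr d k) (s t : List (Fin d)) :
    extend (extend u s) t = extend u (s ++ t) := by
  simp [extend]

theorem extend_right_inj {u : Addr d k} {s t : List (Fin d)} :
    extend u s = extend u t ↔ s = t := by
  simp [extend]

theorem below_extend (u : Addr d k) (s : List (Fin d)) (x : Stream' (Fin d)) :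
    below (extend u s) x = below u (s ++ₛ x) := by
  rw [below, extend, Stream'.append_append_stream]
  rfl

theorem below_injective (u : Addr d k) : Function.Injective (below u) := fun _ _ h =>
  appendStream_injective _ (pt_inj.1 h).2

theorem below_mem_cone (u : Addr d k) (x : Stream' (Fin d)) : below u x ∈ cone u := ⟨x, rfl⟩

theorem mem_cone_iff {u : Addr d k} {i : Fin k} {x : Stream' (Fin d)} :
    pt i x ∈ cone u ↔ i = u.1 ∧ x.take (len u) = u.2 := by
  constructor
  · rintro ⟨y, hy⟩
    obtain ⟨h1, h2⟩ := pt_inj.1 hy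
    exact ⟨h1.symm, by rw [← h2]; exact take_length_append _ _⟩
  · rintro ⟨rfl, h⟩
    exact ⟨x.drop (len u), pt_inj.2 ⟨rfl, eq_append_of_take h⟩⟩

theorem cone_extend_subset (u : Addr d k) (s : List (Fin d)) : cone (extend u s) ⊆ cone u := by
  rintro _ ⟨x, rfl⟩
  rw [below_extend]
  exact below_mem_cone _ _

theorem exists_extend_of_below_eq {u v : Addr d k} {x y : Stream' (Fin d)}
    (h : below u x = below v y) (hl : len u ≤ len v) : ∃ s, v = extend u s ∧ x = s ++ₛ y := by
  obtain ⟨h1, h2⟩ := pt_inj.1 h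
  obtain ⟨s, hs, hx⟩ := exists_append_of_append_eq h2 hl
  exact ⟨s, Prod.ext h1.symm hs, hx⟩

theorem exists_extend_of_mem {u v : Addr d k} {p : End d k} (hu : p ∈ cone u) (hv : p ∈ cone v)
    (hl : len u ≤ len v) : ∃ s, v = extend u s := by
  obtain ⟨x, rfl⟩ := hu
  obtain ⟨y, hy⟩ := hv
  obtain ⟨s, hs, -⟩ := exists_extend_of_below_eq hy.symm hl
  exact ⟨s, hs⟩

/-- Cones are the balls of an ultrametric: two that meet are nested, and the longer address then
continues the shorter one. -/
theorem disjoint_or_extend {u v : Addr d k} (hl : len u ≤ len v) :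
    Disjoint (cone u) (cone v) ∨ ∃ s, v = extend u s := by
  by_cases h : Disjoint (cone u) (cone v)
  · exact Or.inl h
  · obtain ⟨p, hu, hv⟩ := Set.not_disjoint_iff.1 h
    exact Or.inr (exists_extend_of_mem hu hv hl)

theorem eq_of_mem_of_len_eq {u v : Addr d k} {p : End d k} (hu : p ∈ cone u) (hv : p ∈ cone v)
    (hl : len u = len v) : u = v := by
  obtain ⟨s, rfl⟩ := exists_extend_of_mem hu hv hl.le
  rw [len_extend] at hl
  obtain rfl : s = [] := List.length_eq_zero_iff.1 (by omega)
  rw [extend_nil]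

theorem disjoint_of_ne {u v : Addr d k} (hl : len u = len v) (h : u ≠ v) :
    Disjoint (cone u) (cone v) :=
  Set.disjoint_left.2 fun _ hu hv => h (eq_of_mem_of_len_eq hu hv hl)

/-- Every end lies in a cone of each level. -/
theorem exists_mem_cone (p : End d k) (n : ℕ) : ∃ u : Addr d k, len u = n ∧ p ∈ cone u := by
  obtain ⟨i, x, rfl⟩ := exists_pt p
  exact ⟨(i, x.take n), Stream'.length_take _ _, mem_cone_iff.2 ⟨rfl, by
    rw [len, Stream'.length_take]⟩⟩

theorem exists_extend_mem_cone {u : Addr d k} {p : End d k} (hp : p ∈ cone u) (n : ℕ) :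
    ∃ s : List (Fin d), s.length = n ∧ p ∈ cone (extend u s) := by
  obtain ⟨x, rfl⟩ := hp
  refine ⟨x.take n, Stream'.length_take _ _, x.drop n, ?_⟩
  rw [below_extend, Stream'.append_take_drop]

theorem vert_injective : Function.Injective (vert : Addr d k → Vertex d k) := fun u v h => by
  obtain ⟨h1, h2⟩ := Vertex.node.inj h
  exact Prod.ext h1 (List.reverse_injective h2)

theorem vert_ne_root (u : Addr d k) : vert u ≠ Vertex.root := by
  simp [vert]

theorem exists_vert {v : Vertex d k} (hv : v ≠ Vertex.root) : ∃ u : Addr d k, v = vert u := by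
  cases v with
  | root => exact absurd rfl hv
  | node i w => exact ⟨(i, w.reverse), by simp [vert]⟩

theorem depth_vert (u : Addr d k) : depth (vert u) = len u + 1 := by
  simp [depth, vert, len]

theorem shadow_vert (u : Addr d k) : shadow (vert u) = cone u := by
  ext p
  obtain ⟨i, x, rfl⟩ := exists_pt p
  rw [mem_shadow_iff, depth_vert, pt_ray_succ, mem_cone_iff]
  simp only [vert, Vertex.node.injEq, List.reverse_inj]

theorem isChild_vert_iff {u v : Addr d k} :
    IsChild (vert u) (vert v) ↔ ∃ a, v = extend u [a] := by
  constructor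
  · intro h
    generalize hx : vert u = x at h
    generalize hy : vert v = y at h
    cases h with
    | root i => exact absurd hx (vert_ne_root u)
    | node i w a =>
      refine ⟨a, vert_injective ?_⟩
      obtain ⟨h1, h2⟩ := Vertex.node.inj hx
      rw [hy]
      simp [vert, extend, h1, h2]
  · rintro ⟨a, rfl⟩
    simp only [vert, extend, List.reverse_append]
    exact IsChild.node _ _ _

theorem isChild_root_vert_iff {v : Addr d k} : IsChild Vertex.root (vert v) ↔ len v = 0 := by
  constructor
  · intro h
    have := h.depth_eq
    rw [depth_vert] at this
    simpa [depth] using this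
  · intro h
    obtain ⟨i, w⟩ := v
    obtain rfl : w = [] := List.length_eq_zero_iff.1 h
    exact IsChild.root i

theorem finite_len_lt (n : ℕ) : {u : Addr d k | len u < n}.Finite := by
  have : {u : Addr d k | len u < n} = Set.univ ×ˢ {w : List (Fin d) | w.length < n} := by
    ext u; simp [len]
  rw [this]
  exact Set.finite_univ.prod (List.finite_length_lt _ _)

end Address

/-- Makes the digits `0` and `1` available through instance search; the base end and the choices of
siblings below rely on them. -/
instance neZeroOfFactTwoLe {n : ℕ} [h : Fact (2 ≤ n)] : NeZero n :=
  ⟨by have := h.out; omega⟩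

theorem fin_zero_ne_one {n : ℕ} [h : Fact (2 ≤ n)] : (0 : Fin n) ≠ 1 := by
  have := h.out
  intro h0
  have h1 := congrArg Fin.val h0
  rw [Fin.val_zero, Fin.val_one', Nat.mod_eq_of_lt (by omega)] at h1
  omega

theorem exists_fin_ne {n : ℕ} [h : Fact (2 ≤ n)] (a : Fin n) : ∃ b, b ≠ a := by
  by_cases h0 : a = 0
  · exact ⟨1, fun h1 => fin_zero_ne_one (h0.symm.trans h1.symm)⟩
  · exact ⟨0, fun h1 => h0 h1.symm⟩

section Cones

variable {d k : ℕ} [hd : Fact (2 ≤ d)] [hk : Fact (2 ≤ k)]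

theorem cone_injective : Function.Injective (cone : Addr d k → Set (End d k)) := fun u v h => by
  rw [← shadow_vert, ← shadow_vert] at h
  exact vert_injective (AlmostAut.shadow_injective hd.out hk.out h)

theorem disjoint_extend_cons {u : Addr d k} {a b : Fin d} (h : a ≠ b) :
    Disjoint (cone (extend u [a])) (cone (extend u [b])) :=
  disjoint_of_ne (by simp) fun he => h (by simpa using extend_right_inj.1 he)

end Cones

/-! ### Transformations that map one cone onto another as trees -/

/-- The transformation `g` maps the ends below `u` onto the ends below `v`, and this is induced by
an isomorphism between the subtrees hanging at `u` and at `v`. -/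
def TreeLike {d k : ℕ} {M : Type*} [Group M] [MulAction M (End d k)] (g : M) (u v : Addr d k) :
    Prop :=
  ∃ α ∈ digitAut d, ∀ x, g • below u x = below v (α x)

section TreeLike

variable {d k : ℕ} {M : Type*} [Group M] [MulAction M (End d k)] {g h : M} {u v w : Addr d k}

theorem TreeLike.of_forall_below (H : ∀ x, g • below u x = below v x) : TreeLike g u v :=
  ⟨1, one_mem _, H⟩

theorem TreeLike.of_forall_eq (H : ∀ p ∈ cone u, g • p = p) : TreeLike g u u :=
  .of_forall_below fun x => H _ (below_mem_cone u x)

theorem TreeLike.one (u : Addr d k) : TreeLike (1 : M) u u :=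
  .of_forall_below fun _ => one_smul M _

theorem TreeLike.mul (hh : TreeLike h v w) (hg : TreeLike g u v) : TreeLike (h * g) u w := by
  obtain ⟨β, hβ, H'⟩ := hh
  obtain ⟨α, hα, H⟩ := hg
  exact ⟨β * α, mul_mem hβ hα, fun x => by rw [mul_smul, H, H']; rfl⟩

theorem TreeLike.inv (hg : TreeLike g u v) : TreeLike g⁻¹ v u := by
  obtain ⟨α, hα, H⟩ := hg
  exact ⟨α⁻¹, inv_mem hα, fun x => by rw [inv_smul_eq_iff, H, perm_apply_inv]⟩

theorem TreeLike.inv_iff : TreeLike g⁻¹ v u ↔ TreeLike g u v :=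
  ⟨fun h => inv_inv g ▸ h.inv, TreeLike.inv⟩

theorem TreeLike.smul_mem (hg : TreeLike g u v) {p : End d k} (hp : p ∈ cone u) :
    g • p ∈ cone v := by
  obtain ⟨α, hα, H⟩ := hg
  obtain ⟨x, rfl⟩ := hp
  rw [H]
  exact below_mem_cone _ _

theorem TreeLike.smul_mem_iff (hg : TreeLike g u v) {p : End d k} :
    g • p ∈ cone v ↔ p ∈ cone u :=
  ⟨fun hp => by simpa using hg.inv.smul_mem hp, hg.smul_mem⟩

theorem TreeLike.extend [Nonempty (Fin d)] (hg : TreeLike g u v) (s : List (Fin d)) :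
    ∃ s' : List (Fin d), s'.length = s.length ∧
      TreeLike g (extend u s) (NeretinTree.extend v s') := by
  obtain ⟨α, hα, H⟩ := hg
  obtain ⟨s', hl, β, hβ, H'⟩ := exists_section hα s
  exact ⟨s', hl, β, hβ, fun x => by rw [below_extend, below_extend, H, H']⟩

/-- A common prefix of length `n` is membership in a common subcone of relative depth `n`, so
matching subcones of equal relative depth already forces an automorphism of digits. -/
theorem TreeLike.of_forall_extend
    (H : ∀ s : List (Fin d), ∃ s' : List (Fin d), s'.length = s.length ∧
      ∀ p, g • p ∈ cone (NeretinTree.extend v s') ↔ p ∈ cone (NeretinTree.extend u s)) :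
    TreeLike g u v := by
  obtain ⟨s0, hs0, H0⟩ := H []
  obtain rfl : s0 = [] := List.length_eq_zero_iff.1 hs0
  simp only [extend_nil] at H0
  have h1 : ∀ x, ∃ y, g • below u x = below v y := fun x => by
    obtain ⟨y, hy⟩ := (H0 _).2 (below_mem_cone u x)
    exact ⟨y, hy.symm⟩
  have h2 : ∀ y, ∃ x, g • below u x = below v y := fun y => by
    obtain ⟨x, hx⟩ := (H0 (g⁻¹ • below v y)).1 (by rw [smul_inv_smul]; exact below_mem_cone v y)
    exact ⟨x, by rw [hx, smul_inv_smul]⟩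
  choose f hf using h1
  have hinj : Function.Injective f := fun x x' hx => by
    have := hf x
    rw [hx, ← hf x'] at this
    exact below_injective u (smul_left_cancel g this)
  have hsurj : Function.Surjective f := fun y => by
    obtain ⟨x, hx⟩ := h2 y
    exact ⟨x, below_injective v ((hf x).symm.trans hx)⟩
  refine ⟨Equiv.ofBijective f ⟨hinj, hsurj⟩, fun x x' n => ?_, hf⟩
  change (f x).take n = (f x').take n ↔ _
  have hm : ∀ (w : Addr d k) (z : Stream' (Fin d)) (t : List (Fin d)), t.length = n →
      (below w z ∈ cone (NeretinTree.extend w t) ↔ z.take n = t) := fun w z t ht => by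
    constructor
    · rintro ⟨z', hz'⟩
      rw [below_extend] at hz'
      rw [← below_injective w hz', ← ht, take_length_append]
    · intro hz
      refine ⟨z.drop n, ?_⟩
      rw [below_extend, ← hz, Stream'.append_take_drop]
  obtain ⟨t, ht, H1⟩ := H (x.take n)
  rw [Stream'.length_take] at ht
  have e1 : (f x).take n = t := by
    rw [← hm v _ _ ht, ← hf, H1, hm u _ _ (Stream'.length_take _ _)]
  rw [e1, eq_comm, ← hm v _ _ ht, ← hf, H1, hm u _ _ (Stream'.length_take _ _), eq_comm]

theorem TreeLike.disjoint (hg : TreeLike g u v) {u' v' : Addr d k} (hg' : TreeLike g u' v')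
    (hd : Disjoint (cone u) (cone u')) : Disjoint (cone v) (cone v') :=
  Set.disjoint_left.2 fun p hp hp' => by
    have h1 := hg.inv.smul_mem hp
    exact Set.disjoint_left.1 hd h1 (hg'.inv.smul_mem hp')

variable [hd : Fact (2 ≤ d)] [hk : Fact (2 ≤ k)]

/-- Passes from a level to the previous one: disjoint children have disjoint images, so the
assignment of children is a bijection of `Fin d`. -/
theorem TreeLike.of_children
    (H : ∀ a : Fin d, ∃ a', TreeLike g (NeretinTree.extend u [a]) (NeretinTree.extend v [a'])) :
    TreeLike g u v := by
  choose f hf using H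
  have hinj : Function.Injective f := fun a b hab => by
    by_contra hne
    have h1 := (hf a).disjoint (hf b) (disjoint_extend_cons hne)
    rw [hab] at h1
    exact Set.disjoint_left.1 h1 (below_mem_cone _ (Stream'.const 0)) (below_mem_cone _ _)
  have hsurj := Finite.surjective_of_injective hinj
  have hkids : ∀ (w : Addr d k) (p : End d k),
      p ∈ cone w ↔ ∃ a, p ∈ cone (NeretinTree.extend w [a]) := fun w p => by
    constructor
    · intro hp
      obtain ⟨s, hs, h⟩ := exists_extend_mem_cone hp 1
      obtain ⟨a, rfl⟩ := List.length_eq_one_iff.1 hs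
      exact ⟨a, h⟩
    · rintro ⟨a, h⟩
      exact cone_extend_subset _ _ h
  refine .of_forall_extend fun s => ?_
  cases s with
  | nil =>
    refine ⟨[], rfl, fun p => ?_⟩
    rw [extend_nil, extend_nil, hkids, hkids]
    constructor
    · rintro ⟨a', h⟩
      obtain ⟨a, rfl⟩ := hsurj a'
      exact ⟨a, (hf a).smul_mem_iff.1 h⟩
    · rintro ⟨a, h⟩
      exact ⟨f a, (hf a).smul_mem h⟩
  | cons a s =>
    obtain ⟨s', hs', h⟩ := (hf a).extend s
    refine ⟨f a :: s', by simp [hs'], fun p => ?_⟩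
    rw [extend_extend, extend_extend] at h
    exact h.smul_mem_iff

/-- Branching makes `cone` injective, so the image cone has only one address. This turns `TreeLike
g` into a partial map on vertices. -/
theorem TreeLike.unique (hg : TreeLike g u v) (hg' : TreeLike g u w) : v = w := by
  refine cone_injective (Set.ext fun p => ?_)
  rw [← smul_inv_smul g p, hg.smul_mem_iff, hg'.smul_mem_iff]

theorem TreeLike.unique_left (hg : TreeLike g u w) (hg' : TreeLike g v w) : u = v :=
  hg.inv.unique hg'.inv

end TreeLike

/-! ### The Neretin group as a group of piecewise tree-like transformations -/

section Table

variable {d k : ℕ} [hd : Fact (2 ≤ d)] [hk : Fact (2 ≤ k)]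

theorem exists_table_extend {M : Type*} [Group M] [MulAction M (End d k)] {g : M} {n : ℕ}
    (h : ∀ u : Addr d k, len u = n → ∃ v, TreeLike g u v) (u : Addr d k) (hu : n ≤ len u) :
    ∃ v, TreeLike g u v := by
  obtain ⟨w, hw, hm⟩ := exists_mem_cone (below u (Stream'.const 0)) n
  obtain ⟨s, rfl⟩ := exists_extend_of_mem hm (below_mem_cone u _) (by omega)
  obtain ⟨v, hv⟩ := h w hw
  obtain ⟨s', -, hs'⟩ := hv.extend s
  exact ⟨_, hs'⟩

/-- Piecewise tree-like permutations of the ends belong to the Neretin group. -/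
theorem exists_neretin_of_table (f : Equiv.Perm (End d k)) (n : ℕ)
    (h : ∀ u : Addr d k, len u = n → ∃ v, TreeLike f u v) :
    ∃ g : NeretinGroup d k, ∀ p, g • p = f p := by
  have h' := exists_table_extend h
  -- `R` is the graph of the map induced by `f` on vertices of length at least `n`. The finite
  -- subtrees `A` and `B` are the complements of its domain and of its range.
  let R : Vertex d k → Vertex d k → Prop := fun w w' =>
    ∃ u v : Addr d k, w = vert u ∧ w' = vert v ∧ n ≤ len u ∧ TreeLike f u v
  let A : Set (Vertex d k) := {w | ∀ w', ¬ R w w'}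
  let B : Set (Vertex d k) := {w' | ∀ w, ¬ R w w'}
  have hAv : ∀ u : Addr d k, vert u ∈ A ↔ len u < n := fun u => by
    constructor
    · intro hu
      by_contra! hn
      obtain ⟨v, hv⟩ := h' u hn
      exact hu _ ⟨u, v, rfl, rfl, hn, hv⟩
    · rintro hu w' ⟨u', v, h1, -, h2, -⟩
      rw [vert_injective h1] at hu
      omega
  have hA : IsFiniteSubtree A :=
    { finite := by
        refine (((finite_len_lt n).image vert).union (Set.finite_singleton Vertex.root)).subset ?_
        intro w hw
        by_cases hr : w = Vertex.root
        · exact Or.inr hr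
        · obtain ⟨u, rfl⟩ := exists_vert hr
          exact Or.inl ⟨u, (hAv u).1 hw, rfl⟩
      root_mem := by
        rintro w' ⟨u, v, h1, -⟩
        exact vert_ne_root u h1.symm
      parent_mem := by
        rintro w1 w2 h12 h2 w' ⟨u, v, rfl, -, hn, -⟩
        have hr : w2 ≠ Vertex.root := by
          rintro rfl
          exact not_isChild_root _ h12
        obtain ⟨u2, rfl⟩ := exists_vert hr
        obtain ⟨a, rfl⟩ := isChild_vert_iff.1 h12
        have := (hAv _).1 h2
        rw [len_extend] at this
        omega }
  have hB : IsFiniteSubtree B :=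
    { finite := by
        choose F hF using h
        have hfin : {u : Addr d k | len u = n}.Finite :=
          (finite_len_lt (n + 1)).subset fun u hu => by
            change len u = n at hu
            change len u < n + 1
            omega
        -- Every vertex of length at least `K` lies below the image of some vertex of level `n`,
        -- hence is in the range of `R`; this bounds `B`.
        obtain ⟨K, hK⟩ : ∃ K, ∀ u (hu : len u = n), len (F u hu) ≤ K := by
          have := hfin.to_subtype
          obtain ⟨K, hK⟩ := (Set.finite_range
            fun u : {u : Addr d k | len u = n} => len (F u.1 u.2)).bddAbove
          exact ⟨K, fun u hu => hK ⟨⟨u, hu⟩, rfl⟩⟩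
        refine (((finite_len_lt K).image vert).union (Set.finite_singleton Vertex.root)).subset ?_
        intro w hw
        by_cases hr : w = Vertex.root
        · exact Or.inr hr
        · obtain ⟨v, rfl⟩ := exists_vert hr
          refine Or.inl ⟨v, ?_, rfl⟩
          change len v < K
          by_contra! hKv
          have hp := below_mem_cone v (Stream'.const (0 : Fin d))
          obtain ⟨u, hu, hm⟩ := exists_mem_cone (f⁻¹ • below v (Stream'.const (0 : Fin d))) n
          have h1 := (hF u hu).smul_mem hm
          rw [smul_inv_smul] at h1
          obtain ⟨s, rfl⟩ := exists_extend_of_mem h1 hp ((hK u hu).trans hKv)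
          obtain ⟨s', hs', h2⟩ := (hF u hu).inv.extend s
          exact hw _ ⟨_, _, rfl, rfl, by rw [len_extend]; omega, TreeLike.inv_iff.1 h2⟩
      root_mem := by
        rintro w ⟨u, v, -, h1, -⟩
        exact vert_ne_root v h1.symm
      parent_mem := by
        rintro w1 w2 h12 h2 w ⟨u, v, rfl, rfl, hn, hT⟩
        have hr : w2 ≠ Vertex.root := by
          rintro rfl
          exact not_isChild_root _ h12
        obtain ⟨v2, rfl⟩ := exists_vert hr
        obtain ⟨a, rfl⟩ := isChild_vert_iff.1 h12
        obtain ⟨s', hs', h3⟩ := hT.inv.extend [a]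
        exact h2 _ ⟨_, _, rfl, rfl, by rw [len_extend]; omega, TreeLike.inv_iff.1 h3⟩ }
  have hR1 : ∀ {w w1 w2}, R w w1 → R w w2 → w1 = w2 := by
    rintro w w1 w2 ⟨u, v, rfl, rfl, -, hT⟩ ⟨u', v', h1, rfl, -, hT'⟩
    rw [← vert_injective h1] at hT'
    rw [hT.unique hT']
  have hR2 : ∀ {w w1 w2}, R w1 w → R w2 w → w1 = w2 := by
    rintro w w1 w2 ⟨u, v, rfl, rfl, -, hT⟩ ⟨u', v', rfl, h1, -, hT'⟩
    rw [← vert_injective h1] at hT'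
    rw [hT.unique_left hT']
  have hRc : ∀ {w1 w2 w1' w2'}, R w1 w1' → R w2 w2' → (IsChild w1' w2' ↔ IsChild w1 w2) := by
    rintro w1 w2 w1' w2' ⟨u1, v1, rfl, rfl, h1, hT1⟩ ⟨u2, v2, rfl, rfl, h2, hT2⟩
    rw [isChild_vert_iff, isChild_vert_iff]
    constructor
    · rintro ⟨a, rfl⟩
      obtain ⟨s', hs', hT⟩ := hT1.inv.extend [a]
      obtain ⟨a', rfl⟩ := List.length_eq_one_iff.1 hs'
      exact ⟨a', hT2.inv.unique hT⟩
    · rintro ⟨a, rfl⟩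
      obtain ⟨s', hs', hT⟩ := hT1.extend [a]
      obtain ⟨a', rfl⟩ := List.length_eq_one_iff.1 hs'
      exact ⟨a', hT2.unique hT⟩
  have hex1 : ∀ w : (Aᶜ : Set (Vertex d k)), ∃ w' : (Bᶜ : Set (Vertex d k)), R w w' := fun w => by
    have := w.2
    simp only [A, Set.mem_compl_iff, Set.mem_ofPred_eq, not_forall, not_not] at this
    obtain ⟨w', hw'⟩ := this
    exact ⟨⟨w', fun hB => hB _ hw'⟩, hw'⟩
  have hex2 : ∀ w' : (Bᶜ : Set (Vertex d k)), ∃ w : (Aᶜ : Set (Vertex d k)), R w w' := fun w' => by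
    have := w'.2
    simp only [B, Set.mem_compl_iff, Set.mem_ofPred_eq, not_forall, not_not] at this
    obtain ⟨w, hw⟩ := this
    exact ⟨⟨w, fun hA => hA _ hw⟩, hw⟩
  choose f1 hf1 using hex1
  choose f2 hf2 using hex2
  let p : AlmostAut d k :=
    { A := A
      B := B
      isFiniteSubtree_A := hA
      isFiniteSubtree_B := hB
      φ :=
        { toFun := f1
          invFun := f2
          left_inv := fun w => Subtype.ext (hR2 (hf2 (f1 w)) (hf1 w))
          right_inv := fun w => Subtype.ext (hR1 (hf1 (f2 w)) (hf2 w))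
          map_rel_iff' := fun {a b} => hRc (hf1 a) (hf1 b) } }
  have hp : p.Induces f := fun w ξ => by
    obtain ⟨u, v, h1, h2, -, hT⟩ := hf1 w
    change ξ ∈ shadow (w : Vertex d k) ↔ f ξ ∈ shadow (f1 w : Vertex d k)
    rw [h1, h2, shadow_vert, shadow_vert]
    exact hT.smul_mem_iff.symm
  exact ⟨⟨f, p, hp⟩, fun _ => rfl⟩

/-- The elements of the Neretin group are piecewise tree-like. -/
theorem exists_table (g : NeretinGroup d k) :
    ∃ n, ∀ u : Addr d k, n ≤ len u → ∃ v, TreeLike g u v := by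
  obtain ⟨p, hp⟩ := g.exists_induces
  obtain ⟨n, hn⟩ := (p.isFiniteSubtree_A.finite.image depth).bddAbove
  have hA : ∀ u : Addr d k, n ≤ len u → vert u ∉ p.A := fun u hu hA => by
    have := hn (Set.mem_image_of_mem _ hA)
    rw [depth_vert] at this
    omega
  have hnr : ∀ w : (p.Aᶜ : Set (Vertex d k)), ∃ v, (p.φ w : Vertex d k) = vert v := fun w =>
    exists_vert fun h => (p.φ w).2 (h ▸ p.isFiniteSubtree_B.root_mem)
  refine ⟨n, fun u hu => ?_⟩
  obtain ⟨v, hv⟩ := hnr ⟨_, hA u hu⟩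
  refine ⟨v, .of_forall_extend fun s => ?_⟩
  have hA' : ∀ t, vert (extend u t) ∉ p.A := fun t => hA _ (by rw [len_extend]; omega)
  obtain ⟨s', hs', h2⟩ : ∃ s' : List (Fin d), s'.length = s.length ∧
      (p.φ ⟨_, hA' s⟩ : Vertex d k) = vert (extend v s') := by
    induction s using List.reverseRecOn with
    | nil => exact ⟨[], rfl, by simpa only [extend_nil] using hv⟩
    | append_singleton s a ih =>
      obtain ⟨s', hs', h2⟩ := ih
      have hc : forestRel p.A ⟨_, hA' s⟩ ⟨_, hA' (s ++ [a])⟩ :=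
        isChild_vert_iff.2 ⟨a, by rw [extend_extend]⟩
      rw [← p.φ.map_rel_iff] at hc
      obtain ⟨v', hv'⟩ := hnr ⟨_, hA' (s ++ [a])⟩
      change IsChild (p.φ ⟨_, hA' s⟩ : Vertex d k) (p.φ ⟨_, hA' (s ++ [a])⟩ : Vertex d k) at hc
      rw [h2, hv', isChild_vert_iff] at hc
      obtain ⟨a', rfl⟩ := hc
      exact ⟨s' ++ [a'], by simp [hs'], by rw [hv', extend_extend]⟩
  refine ⟨s', hs', fun q => ?_⟩
  have := hp ⟨_, hA' s⟩ q
  rw [h2, shadow_vert, shadow_vert] at this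
  exact this.symm

end Table

/-! ### Compact open subgroups -/

section TreeAutCompact

variable {d k : ℕ}

theorem finite_depth_eq (m : ℕ) : {w : Vertex d k | depth w = m}.Finite := by
  refine (((finite_len_lt m).image vert).union (Set.finite_singleton Vertex.root)).subset ?_
  intro w hw
  by_cases hr : w = Vertex.root
  · exact Or.inr hr
  · obtain ⟨u, rfl⟩ := exists_vert hr
    change depth _ = m at hw
    rw [depth_vert] at hw
    exact Or.inl ⟨u, by change len u < m; omega, rfl⟩

/-- Automorphisms form a closed subset of a product of finite levels: edges and injectivity are
conditions on pairs of coordinates, and surjectivity is automatic on a finite level. -/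
instance : CompactSpace (TreeAut d k) := by
  let _ : TopologicalSpace (Vertex d k) := ⊥
  have : DiscreteTopology (Vertex d k) := ⟨rfl⟩
  let ι : TreeAut d k → (Vertex d k → Vertex d k) := fun a => a
  have hι : IsInducing ι := ⟨rfl⟩
  rw [← isCompact_univ_iff, hι.isCompact_iff, Set.image_univ]
  let P : Set (Vertex d k → Vertex d k) := Set.univ.pi fun v => {w | depth w = depth v}
  have hP : IsCompact P := isCompact_univ_pi fun v => (finite_depth_eq _).isCompact
  have hrange : Set.range ι =
      P ∩ ((⋂ u, ⋂ v, {f | IsChild u v → IsChild (f u) (f v)}) ∩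
        ⋂ u, ⋂ v, {f | f u = f v → u = v}) := by
    ext f
    simp only [Set.mem_range, Set.mem_inter_iff, Set.mem_iInter, Set.mem_ofPred_eq]
    constructor
    · rintro ⟨a, rfl⟩
      have hc : ∀ u v, IsChild u v → IsChild (ι a u) (ι a v) := fun u v h => a.map_rel_iff.2 h
      refine ⟨fun v _ => ?_, hc, fun u v h => a.injective h⟩
      change depth (ι a v) = depth v
      generalize hm : depth v = m
      induction m generalizing v with
      | zero =>
        have : v = Vertex.root := by
          by_contra hr
          obtain ⟨u, hu⟩ := exists_parent hr
          have := hu.depth_eq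
          omega
        rw [this]
        change depth (a Vertex.root) = 0
        rw [TreeAut.map_root]
        rfl
      | succ m ih =>
        obtain ⟨u, hu⟩ : ∃ u, IsChild u v := exists_parent (by rintro rfl; simp [depth] at hm)
        have h1 := hu.depth_eq
        rw [(hc u v hu).depth_eq, ih u trivial (by omega)]
    · rintro ⟨h1, h2, h3⟩
      have hdep : ∀ v, depth (f v) = depth v := fun v => h1 v trivial
      have hinj : Function.Injective f := fun u v h => h3 u v h
      have hsurj : Function.Surjective f := fun w => by
        have hfin := (finite_depth_eq (d := d) (k := k) (depth w)).to_subtype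
        let f' : {v : Vertex d k | depth v = depth w} → {v : Vertex d k | depth v = depth w} :=
          fun v => ⟨f v, (hdep v).trans v.2⟩
        have hf' : Function.Injective f' := fun u v h => Subtype.ext (hinj (congrArg Subtype.val h))
        obtain ⟨v, hv⟩ := Finite.surjective_of_injective hf' ⟨w, rfl⟩
        exact ⟨v, congrArg Subtype.val hv⟩
      refine ⟨⟨Equiv.ofBijective f ⟨hinj, hsurj⟩, fun {u v} => ⟨fun h => ?_, h2 u v⟩⟩, rfl⟩
      change IsChild (f u) (f v) at h
      have hr : v ≠ Vertex.root := by
        rintro rfl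
        have h4 := h.depth_eq
        rw [hdep] at h4
        simp [depth] at h4
      obtain ⟨u', hu'⟩ := exists_parent hr
      rwa [hinj (h.parent_unique (h2 u' v hu'))]
  rw [hrange]
  refine hP.inter_right (IsClosed.inter ?_ ?_)
  · refine isClosed_iInter fun u => isClosed_iInter fun v => ?_
    have : Continuous fun f : Vertex d k → Vertex d k => (f u, f v) := by fun_prop
    exact (isClosed_discrete {q : Vertex d k × Vertex d k | IsChild u v → IsChild q.1 q.2}).preimage
      this
  · refine isClosed_iInter fun u => isClosed_iInter fun v => ?_
    have : Continuous fun f : Vertex d k → Vertex d k => (f u, f v) := by fun_prop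
    exact (isClosed_discrete {q : Vertex d k × Vertex d k | q.1 = q.2 → u = v}).preimage this

end TreeAutCompact

/-! ### The level subgroups as a basis of compact open neighbourhoods of `1`. -/

section LevelSubgroup

variable {d k : ℕ} [hd : Fact (2 ≤ d)] [hk : Fact (2 ≤ k)]

/-- The group of all transformations that preserve each subtree of level `n`. -/
def levelSubgroup (d k n : ℕ) : Subgroup (NeretinGroup d k) where
  carrier := {g | ∀ u : Addr d k, len u = n → TreeLike g u u}
  one_mem' := fun u _ => .one u
  mul_mem' := fun hg hh u hu => (hg u hu).mul (hh u hu)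
  inv_mem' := fun hg u hu => (hg u hu).inv

theorem mem_levelSubgroup {g : NeretinGroup d k} {n : ℕ} :
    g ∈ levelSubgroup d k n ↔ ∀ u : Addr d k, len u = n → TreeLike g u u := Iff.rfl

theorem levelSubgroup_antitone : Antitone (levelSubgroup d k) := by
  refine antitone_nat_of_succ_le fun n g hg u hu => .of_children fun a => ⟨a, hg _ ?_⟩
  simp [hu]

theorem exists_treeLike_of_mem {g : NeretinGroup d k} (hg : g ∈ levelSubgroup d k 0)
    (u : Addr d k) : ∃ v, len v = len u ∧ TreeLike g u v := by
  obtain ⟨s', hs', h⟩ := (hg (u.1, []) rfl).extend u.2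
  refine ⟨_, ?_, h⟩
  rw [len_extend, hs']
  simp [len]

theorem TreeAut.treeLike_toNeretin (b : TreeAut d k) {u v : Addr d k} (h : b (vert u) = vert v) :
    TreeLike (TreeAut.toNeretin b) u v := by
  refine .of_forall_extend fun s => ?_
  obtain ⟨s', hs', h2⟩ : ∃ s' : List (Fin d), s'.length = s.length ∧
      b (vert (extend u s)) = vert (extend v s') := by
    induction s using List.reverseRecOn with
    | nil => exact ⟨[], rfl, by simpa only [extend_nil] using h⟩
    | append_singleton s a ih =>
      obtain ⟨s', hs', h2⟩ := ih
      have hc : IsChild (vert (extend u s)) (vert (extend u (s ++ [a]))) :=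
        isChild_vert_iff.2 ⟨a, by rw [extend_extend]⟩
      rw [← b.map_rel_iff, h2] at hc
      obtain ⟨v', hv'⟩ : ∃ v', b (vert (extend u (s ++ [a]))) = vert v' := exists_vert fun h => by
        rw [h] at hc
        exact not_isChild_root _ hc
      rw [hv', isChild_vert_iff] at hc
      obtain ⟨a', rfl⟩ := hc
      exact ⟨s' ++ [a'], by simp [hs'], by rw [hv', extend_extend]⟩
  refine ⟨s', hs', fun p => ?_⟩
  have := TreeAut.endMap_mem_shadow b p (vert (extend u s))
  rw [h2, shadow_vert, shadow_vert] at this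
  exact this.symm

/-- An element that is tree-like on each subtree below a child of the root moves every vertex to a
unique vertex of the same depth, which defines a tree automorphism. The level subgroups thereby
inherit compactness from `TreeAut`. -/
theorem exists_treeAut_of_mem {g : NeretinGroup d k} (hg : g ∈ levelSubgroup d k 0) :
    ∃ b : TreeAut d k, TreeAut.toNeretin b = g ∧ b Vertex.root = Vertex.root ∧
      ∀ u v, TreeLike g u v → b (vert u) = vert v := by
  let R : NeretinGroup d k → Vertex d k → Vertex d k → Prop := fun g w w' =>
    (w = Vertex.root ∧ w' = Vertex.root) ∨
      ∃ u v : Addr d k, w = vert u ∧ w' = vert v ∧ len v = len u ∧ TreeLike g u v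
  have hex : ∀ g ∈ levelSubgroup d k 0, ∀ w, ∃ w', R g w w' := fun g hg w => by
    by_cases hr : w = Vertex.root
    · exact ⟨_, Or.inl ⟨hr, rfl⟩⟩
    · obtain ⟨u, rfl⟩ := exists_vert hr
      obtain ⟨v, hl, hv⟩ := exists_treeLike_of_mem hg u
      exact ⟨_, Or.inr ⟨u, v, rfl, rfl, hl, hv⟩⟩
  have hR1 : ∀ g {w w1 w2}, R g w w1 → R g w w2 → w1 = w2 := by
    rintro g w w1 w2 (⟨rfl, rfl⟩ | ⟨u, v, rfl, rfl, -, hT⟩) (⟨h1, rfl⟩ | ⟨u', v', h1, rfl, -, hT'⟩)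
    · rfl
    · exact absurd h1.symm (vert_ne_root _)
    · exact absurd h1 (vert_ne_root _)
    · rw [← vert_injective h1] at hT'
      rw [hT.unique hT']
  have hRinv : ∀ g {w w'}, R g w w' → R g⁻¹ w' w := by
    rintro g w w' (⟨rfl, rfl⟩ | ⟨u, v, rfl, rfl, hl, hT⟩)
    · exact Or.inl ⟨rfl, rfl⟩
    · exact Or.inr ⟨_, _, rfl, rfl, hl.symm, hT.inv⟩
  have hRc : ∀ g {w1 w2 w1' w2'}, R g w1 w1' → R g w2 w2' → IsChild w1 w2 → IsChild w1' w2' := by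
    rintro g w1 w2 w1' w2' (⟨rfl, rfl⟩ | ⟨u1, v1, rfl, rfl, h1, hT1⟩)
      (⟨rfl, rfl⟩ | ⟨u2, v2, rfl, rfl, h2, hT2⟩) h
    · exact h
    · rw [isChild_root_vert_iff] at h ⊢
      omega
    · exact absurd h (not_isChild_root _)
    · rw [isChild_vert_iff] at h ⊢
      obtain ⟨a, rfl⟩ := h
      obtain ⟨s', hs', hT⟩ := hT1.extend [a]
      obtain ⟨a', rfl⟩ := List.length_eq_one_iff.1 hs'
      exact ⟨a', hT2.unique hT⟩
  choose f1 hf1 using hex g hg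
  choose f2 hf2 using hex g⁻¹ (inv_mem hg)
  have hl : ∀ w, f2 (f1 w) = w := fun w => hR1 g⁻¹ (hf2 _) (hRinv g (hf1 w))
  have hr : ∀ w, f1 (f2 w) = w := fun w => by
    have := hRinv g⁻¹ (hf2 w)
    rw [inv_inv] at this
    exact hR1 g (hf1 _) this
  let b : TreeAut d k :=
    { toFun := f1
      invFun := f2
      left_inv := hl
      right_inv := hr
      map_rel_iff' := fun {u v} => by
        refine ⟨fun h => ?_, hRc g (hf1 u) (hf1 v)⟩
        have := hRc g⁻¹ (hRinv g (hf1 u)) (hRinv g (hf1 v)) h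
        exact this }
  have hb : ∀ u v, TreeLike g u v → b (vert u) = vert v := fun u v hT => by
    obtain ⟨v', hl', hT'⟩ := exists_treeLike_of_mem hg u
    rw [hT.unique hT']
    exact hR1 g (hf1 _) (Or.inr ⟨u, v', rfl, rfl, hl', hT'⟩)
  refine ⟨b, ?_, hR1 g (hf1 _) (Or.inl ⟨rfl, rfl⟩), hb⟩
  apply NeretinGroup.toPerm_injective
  ext1 p
  change TreeAut.toNeretin b • p = g • p
  obtain ⟨i, x, hx⟩ := exists_pt (g • p)
  obtain ⟨j, y, hy⟩ := exists_pt (TreeAut.toNeretin b • p)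
  have key : ∀ n, j = i ∧ y.take n = x.take n := fun n => by
    obtain ⟨u, hu, hm⟩ := exists_mem_cone p n
    obtain ⟨v, hv, hT⟩ := exists_treeLike_of_mem hg u
    have h1 := hT.smul_mem hm
    have h2 := (TreeAut.treeLike_toNeretin b (hb u v hT)).smul_mem hm
    rw [hx, mem_cone_iff, hv, hu] at h1
    rw [hy, mem_cone_iff, hv, hu] at h2
    exact ⟨h2.1.trans h1.1.symm, h2.2.trans h1.2.symm⟩
  rw [hx, hy]
  exact pt_inj.2 ⟨(key 0).1, Stream'.take_theorem _ _ fun n => (key n).2⟩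

theorem levelSubgroup_mem_nhds (n : ℕ) :
    (levelSubgroup d k n : Set (NeretinGroup d k)) ∈ 𝓝 1 := by
  rw [NeretinGroup.nhds_one, Filter.mem_map, TreeAut.mem_nhds_iff]
  refine ⟨vert '' {u | len u < n + 1}, (finite_len_lt _).image _, fun b hb u hu => ?_⟩
  exact TreeAut.treeLike_toNeretin b (hb _ ⟨u, by change len u < n + 1; omega, rfl⟩)

theorem isOpen_levelSubgroup (n : ℕ) :
    IsOpen (levelSubgroup d k n : Set (NeretinGroup d k)) :=
  Subgroup.isOpen_of_mem_nhds _ (levelSubgroup_mem_nhds n)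

/-- A finite set of vertices is contained in the part of the tree up to some level, which the
corresponding level subgroup fixes pointwise. From here on the topology is handled through these
subgroups only. -/
theorem mem_nhds_one_iff {S : Set (NeretinGroup d k)} :
    S ∈ 𝓝 (1 : NeretinGroup d k) ↔ ∃ n, (levelSubgroup d k n : Set (NeretinGroup d k)) ⊆ S := by
  refine ⟨fun hS => ?_, fun ⟨n, hn⟩ => Filter.mem_of_superset (levelSubgroup_mem_nhds n) hn⟩
  rw [NeretinGroup.nhds_one, Filter.mem_map, TreeAut.mem_nhds_iff] at hS
  obtain ⟨F, hF, hFS⟩ := hS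
  obtain ⟨n, hn⟩ := (hF.image depth).bddAbove
  refine ⟨n, fun g hg => ?_⟩
  obtain ⟨b, rfl, hbr, hb⟩ := exists_treeAut_of_mem (levelSubgroup_antitone (Nat.zero_le n) hg)
  refine hFS b fun w hw => ?_
  change b w = w
  by_cases hr : w = Vertex.root
  · rw [hr, hbr]
  · obtain ⟨u, rfl⟩ := exists_vert hr
    have hdn := hn (Set.mem_image_of_mem _ hw)
    rw [depth_vert] at hdn
    exact hb u u (levelSubgroup_antitone (by omega : len u ≤ n) hg u rfl)

theorem isCompact_levelSubgroup (n : ℕ) :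
    IsCompact (levelSubgroup d k n : Set (NeretinGroup d k)) := by
  have h1 : IsCompact (Set.range (TreeAut.toNeretin (d := d) (k := k))) :=
    isCompact_range TreeAut.continuous_toNeretin
  refine h1.of_isClosed_subset (Subgroup.isClosed_of_isOpen _ (isOpen_levelSubgroup n)) ?_
  intro g hg
  obtain ⟨b, hb, -⟩ := exists_treeAut_of_mem (levelSubgroup_antitone (Nat.zero_le n) hg)
  exact ⟨b, hb⟩

instance : LocallyCompactSpace (NeretinGroup d k) :=
  (isCompact_levelSubgroup 0).locallyCompactSpace_of_mem_nhds_of_group (levelSubgroup_mem_nhds 0)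

/-- Membership in a closed set is tested with the level subgroups. -/
theorem mem_of_isClosed_of_forall_exists {S : Set (NeretinGroup d k)} (hS : IsClosed S)
    {f : NeretinGroup d k} (h : ∀ n, ∃ g ∈ S, g⁻¹ * f ∈ levelSubgroup d k n) : f ∈ S := by
  rw [← hS.closure_eq, mem_closure_iff_nhds]
  intro t ht
  have hc : Tendsto (fun l : NeretinGroup d k => f * l⁻¹) (𝓝 1) (𝓝 f) := by
    have : Continuous fun l : NeretinGroup d k => f * l⁻¹ := by fun_prop
    simpa using this.tendsto 1
  obtain ⟨n, hn⟩ := mem_nhds_one_iff.1 (hc ht)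
  obtain ⟨g, hg, hgf⟩ := h n
  refine ⟨g, ?_, hg⟩
  have := hn hgf
  simpa using this

end LevelSubgroup

/-! ### Elementary transformations -/

section Elements

variable {d k : ℕ} [hd : Fact (2 ≤ d)] [hk : Fact (2 ≤ k)]

theorem neretin_ext {g h : NeretinGroup d k} (H : ∀ p : End d k, g • p = h • p) : g = h :=
  NeretinGroup.toPerm_injective (Equiv.ext H)

/-- Every automorphism of a subtree extends by the identity to an element of the group. -/
theorem exists_local (u : Addr d k) {α : Equiv.Perm (Stream' (Fin d))} (hα : α ∈ digitAut d) :
    ∃ g : NeretinGroup d k, (∀ x, g • below u x = below u (α x)) ∧ ∀ p ∉ cone u, g • p = p := by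
  classical
  let e : Stream' (Fin d) ≃ cone u := Equiv.ofInjective _ (below_injective u)
  let f : Equiv.Perm (End d k) := (e.permCongr α).extendDomain (Equiv.refl (cone u))
  have h1 : ∀ x, f (below u x) = below u (α x) := fun x => by
    have := Equiv.Perm.extendDomain_apply_image (e.permCongr α) (Equiv.refl (cone u)) (e x)
    simp only [Equiv.refl_apply, Equiv.permCongr_apply, Equiv.symm_apply_apply] at this
    exact this
  have h2 : ∀ p ∉ cone u, f p = p := fun p hp =>
    Equiv.Perm.extendDomain_apply_not_subtype _ _ hp
  obtain ⟨g, hg⟩ := exists_neretin_of_table f (len u) fun v hv => by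
    by_cases huv : v = u
    · subst huv
      exact ⟨v, α, hα, h1⟩
    · exact ⟨v, .of_forall_eq fun p hp => h2 p fun hp' => huv (eq_of_mem_of_len_eq hp hp' hv)⟩
  exact ⟨g, fun x => (hg _).trans (h1 x), fun p hp => (hg _).trans (h2 p hp)⟩

/-- Two disjoint subtrees can be exchanged. -/
theorem exists_swap {u v : Addr d k} (huv : Disjoint (cone u) (cone v)) :
    ∃ g : NeretinGroup d k, (∀ x, g • below u x = below v x) ∧ (∀ x, g • below v x = below u x) ∧
      ∀ p ∉ cone u, p ∉ cone v → g • p = p := by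
  classical
  let f : End d k → End d k := fun p =>
    if h : p ∈ cone u then below v h.choose else if h : p ∈ cone v then below u h.choose else p
  have h1 : ∀ x, f (below u x) = below v x := fun x => by
    have h : below u x ∈ cone u := below_mem_cone u x
    simp only [f, dif_pos h]
    rw [below_injective u h.choose_spec]
  have h2 : ∀ x, f (below v x) = below u x := fun x => by
    have h : below v x ∈ cone v := below_mem_cone v x
    simp only [f, dif_neg (Set.disjoint_right.1 huv h), dif_pos h]
    rw [below_injective v h.choose_spec]
  have h3 : ∀ p ∉ cone u, p ∉ cone v → f p = p := fun p hu hv => by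
    simp only [f, dif_neg hu, dif_neg hv]
  have hf : Function.Involutive f := fun p => by
    by_cases hu : p ∈ cone u
    · obtain ⟨x, rfl⟩ := hu
      rw [h1, h2]
    · by_cases hv : p ∈ cone v
      · obtain ⟨x, rfl⟩ := hv
        rw [h2, h1]
      · rw [h3 p hu hv, h3 p hu hv]
  -- At the larger of the two lengths every cone is inside `cone u`, inside `cone v`, or disjoint
  -- from both.
  obtain ⟨g, hg⟩ := exists_neretin_of_table hf.toPerm (max (len u) (len v)) fun w hw => by
    rcases disjoint_or_extend (show len u ≤ len w by omega) with hdu | ⟨s, rfl⟩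
    · rcases disjoint_or_extend (show len v ≤ len w by omega) with hdv | ⟨s, rfl⟩
      · exact ⟨w, .of_forall_eq fun p hp => h3 p (Set.disjoint_right.1 hdu hp)
          (Set.disjoint_right.1 hdv hp)⟩
      · refine ⟨extend u s, .of_forall_below fun x => ?_⟩
        rw [below_extend, below_extend]
        exact h2 _
    · refine ⟨extend v s, .of_forall_below fun x => ?_⟩
      rw [below_extend, below_extend]
      exact h1 _
  exact ⟨g, fun x => (hg _).trans (h1 x), fun x => (hg _).trans (h2 x),
    fun p hu hv => (hg p).trans (h3 p hu hv)⟩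

/-- The transformation exchanging the subtrees at `u` and `v`. -/
noncomputable def swapCones {u v : Addr d k} (huv : Disjoint (cone u) (cone v)) :
    NeretinGroup d k :=
  (exists_swap huv).choose

theorem swapCones_below_left {u v : Addr d k} (huv : Disjoint (cone u) (cone v))
    (x : Stream' (Fin d)) : swapCones huv • below u x = below v x :=
  (exists_swap huv).choose_spec.1 x

theorem swapCones_below_right {u v : Addr d k} (huv : Disjoint (cone u) (cone v))
    (x : Stream' (Fin d)) : swapCones huv • below v x = below u x :=
  (exists_swap huv).choose_spec.2.1 x

theorem swapCones_of_notMem {u v : Addr d k} (huv : Disjoint (cone u) (cone v)) {p : End d k}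
    (hu : p ∉ cone u) (hv : p ∉ cone v) : swapCones huv • p = p :=
  (exists_swap huv).choose_spec.2.2 p hu hv

theorem swapCones_treeLike_left {u v : Addr d k} (huv : Disjoint (cone u) (cone v))
    (s : List (Fin d)) : TreeLike (swapCones huv) (extend u s) (extend v s) :=
  .of_forall_below fun x => by rw [below_extend, below_extend, swapCones_below_left]

theorem swapCones_treeLike_right {u v : Addr d k} (huv : Disjoint (cone u) (cone v))
    (s : List (Fin d)) : TreeLike (swapCones huv) (extend v s) (extend u s) :=
  .of_forall_below fun x => by rw [below_extend, below_extend, swapCones_below_right]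

theorem swapCones_mul_self {u v : Addr d k} (huv : Disjoint (cone u) (cone v)) :
    swapCones huv * swapCones huv = 1 := by
  refine neretin_ext fun p => ?_
  rw [mul_smul, one_smul]
  by_cases hu : p ∈ cone u
  · obtain ⟨x, rfl⟩ := hu
    rw [swapCones_below_left, swapCones_below_right]
  · by_cases hv : p ∈ cone v
    · obtain ⟨x, rfl⟩ := hv
      rw [swapCones_below_right, swapCones_below_left]
    · rw [swapCones_of_notMem huv hu hv, swapCones_of_notMem huv hu hv]

/-- Two partitions into the same number of subtrees differ by an element of the group. -/
theorem exists_glue {I : Type*} [Finite I] (u v : I → Addr d k)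
    (hu : ∀ p, ∃! i, p ∈ cone (u i)) (hv : ∀ p, ∃! i, p ∈ cone (v i)) :
    ∃ g : NeretinGroup d k, ∀ i x, g • below (u i) x = below (v i) x := by
  have key : ∀ w : I → Addr d k, (∀ p, ∃! i, p ∈ cone (w i)) →
      Function.Bijective fun q : I × Stream' (Fin d) => below (w q.1) q.2 := fun w hw => by
    constructor
    · rintro ⟨i, x⟩ ⟨j, y⟩ h
      simp only at h
      obtain rfl : i = j := (hw (below (w i) x)).unique (below_mem_cone _ _)
        (by rw [h]; exact below_mem_cone _ _)
      rw [below_injective _ h]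
    · intro p
      obtain ⟨i, ⟨x, hx⟩, -⟩ := hw p
      exact ⟨(i, x), hx⟩
  let f : Equiv.Perm (End d k) :=
    (Equiv.ofBijective _ (key u hu)).symm.trans (Equiv.ofBijective _ (key v hv))
  have hf : ∀ i x, f (below (u i) x) = below (v i) x := fun i x => by
    have h1 : (Equiv.ofBijective _ (key u hu)).symm (below (u i) x) = (i, x) := by
      rw [Equiv.symm_apply_eq]
      rfl
    simp only [f, Equiv.trans_apply, h1]
    rfl
  obtain ⟨n, hn⟩ := (Set.finite_range fun i => len (u i)).bddAbove
  obtain ⟨g, hg⟩ := exists_neretin_of_table f n fun w hw => by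
    obtain ⟨i, hi, -⟩ := hu (below w (Stream'.const 0))
    have hi' : len (u i) ≤ n := hn ⟨i, rfl⟩
    obtain ⟨s, rfl⟩ := exists_extend_of_mem hi (below_mem_cone w _) (by omega)
    refine ⟨extend (v i) s, .of_forall_below fun x => ?_⟩
    rw [below_extend, below_extend]
    exact hf _ _
  exact ⟨g, fun i x => (hg _).trans (hf i x)⟩

end Elements

/-! ### Levels -/

/-- The addresses of a given length. -/
abbrev Level (d k n : ℕ) : Type := {u : Addr d k // len u = n}

section Level

variable {d k : ℕ} [hd : Fact (2 ≤ d)] [hk : Fact (2 ≤ k)]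

/-- Addresses of length `n` as pairs. -/
def levelEquiv (d k n : ℕ) : Level d k n ≃ Fin k × List.Vector (Fin d) n where
  toFun u := (u.1.1, ⟨u.1.2, u.2⟩)
  invFun p := ⟨(p.1, p.2.1), p.2.2⟩
  left_inv _ := rfl
  right_inv _ := rfl

instance (n : ℕ) : Fintype (Level d k n) := Fintype.ofEquiv _ (levelEquiv d k n).symm

theorem card_level (n : ℕ) : Fintype.card (Level d k n) = k * d ^ n := by
  rw [Fintype.card_congr (levelEquiv d k n), Fintype.card_prod, Fintype.card_fin, card_vector,
    Fintype.card_fin]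

theorem existsUnique_level (n : ℕ) (p : End d k) : ∃! u : Level d k n, p ∈ cone u.1 := by
  obtain ⟨u, hu, hm⟩ := exists_mem_cone p n
  exact ⟨⟨u, hu⟩, hm, fun v hv => Subtype.ext (eq_of_mem_of_len_eq hv hm (v.2.trans hu.symm))⟩

theorem exists_levelPerm {n : ℕ} (σ : Equiv.Perm (Level d k n)) :
    ∃ g : NeretinGroup d k, ∀ (u : Level d k n) x, g • below u.1 x = below (σ u).1 x :=
  exists_glue (fun u : Level d k n => u.1) (fun u => (σ u).1) (existsUnique_level n) fun p => by
    obtain ⟨u, hu, huu⟩ := existsUnique_level n p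
    exact ⟨σ.symm u, by simpa using hu, fun v hv => by rw [← huu _ hv, Equiv.symm_apply_apply]⟩

end Level

/-! ### The base end -/

section BaseEnd

variable (d k : ℕ) [hd : Fact (2 ≤ d)] [hk : Fact (2 ≤ k)]

/-- The end all of whose choices are `0`. -/
def zeroEnd : End d k := pt 0 (Stream'.const 0)

/-- The address of the vertex of level `n` on the ray to `zeroEnd`. -/
def zeroAddr (n : ℕ) : Addr d k := (0, List.replicate n 0)

variable {d k}

@[simp] theorem len_zeroAddr (n : ℕ) : len (zeroAddr d k n) = n := List.length_replicate

theorem zeroAddr_add (m n : ℕ) :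
    zeroAddr d k (m + n) = extend (zeroAddr d k m) (List.replicate n 0) := by
  rw [zeroAddr, zeroAddr, extend, List.replicate_add]

theorem take_const {A : Type*} (a : A) (n : ℕ) :
    (Stream'.const a).take n = List.replicate n a := by
  induction n with
  | zero => rfl
  | succ n ih =>
    rw [Stream'.take_succ, List.replicate_succ]
    exact congrArg _ ih

theorem zeroEnd_mem_cone_iff {u : Addr d k} : zeroEnd d k ∈ cone u ↔ u = zeroAddr d k (len u) := by
  rw [zeroEnd, mem_cone_iff, take_const, zeroAddr, Prod.ext_iff]
  simp only [eq_comm]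

theorem zeroEnd_mem_cone (n : ℕ) : zeroEnd d k ∈ cone (zeroAddr d k n) := by
  rw [zeroEnd_mem_cone_iff, len_zeroAddr]

/-- The shift `l - i` along the ray to `zeroEnd` persists further down, so it is an invariant of the
germ at `zeroEnd`; `zeroGerm` consists of the elements with shift zero. -/
theorem TreeLike.zeroAddr_of_le {f : NeretinGroup d k} (hf : f • zeroEnd d k = zeroEnd d k)
    {i j l : ℕ} (hij : i ≤ j) (hT : TreeLike f (zeroAddr d k i) (zeroAddr d k l)) :
    TreeLike f (zeroAddr d k j) (zeroAddr d k (l + (j - i))) := by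
  obtain ⟨r, rfl⟩ := Nat.exists_eq_add_of_le hij
  rw [Nat.add_sub_cancel_left]
  obtain ⟨s', hs', hT'⟩ := hT.extend (List.replicate r 0)
  rw [← zeroAddr_add] at hT'
  have h3 := hT'.smul_mem (zeroEnd_mem_cone _)
  rw [hf, zeroEnd_mem_cone_iff, len_extend, len_zeroAddr, hs', List.length_replicate] at h3
  rwa [h3] at hT'

/-- The group of the transformations fixing `zeroEnd` and preserving the levels near it. -/
def zeroGerm (d k : ℕ) [Fact (2 ≤ d)] [Fact (2 ≤ k)] : Subgroup (NeretinGroup d k) where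
  carrier := {g | g • zeroEnd d k = zeroEnd d k ∧
    ∃ n, TreeLike g (zeroAddr d k n) (zeroAddr d k n)}
  one_mem' := ⟨one_smul _ _, 0, .one _⟩
  inv_mem' := fun {g} ⟨h1, n, h2⟩ => ⟨by rw [inv_smul_eq_iff, h1], n, h2.inv⟩
  mul_mem' := by
    rintro g h ⟨hg1, n, hg2⟩ ⟨hh1, m, hh2⟩
    refine ⟨by rw [mul_smul, hh1, hg1], max n m, ?_⟩
    have h1 := hg2.zeroAddr_of_le hg1 (le_max_left n m)
    have h2 := hh2.zeroAddr_of_le hh1 (le_max_right n m)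
    rw [Nat.add_sub_cancel' (le_max_left n m)] at h1
    rw [Nat.add_sub_cancel' (le_max_right n m)] at h2
    exact h1.mul h2

end BaseEnd

/-! ### Generation -/

section Separation

variable {d k : ℕ} [hd : Fact (2 ≤ d)] [hk : Fact (2 ≤ k)]

theorem exists_forall_notMem_cone {p q : End d k} (h : p ≠ q) :
    ∃ n, ∀ u : Addr d k, n ≤ len u → p ∈ cone u → q ∉ cone u := by
  by_contra! H
  obtain ⟨i, x, rfl⟩ := exists_pt p
  obtain ⟨j, y, rfl⟩ := exists_pt q
  have key : ∀ n, i = j ∧ x.take n = y.take n := fun n => by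
    obtain ⟨u, hu, h1, h2⟩ := H n
    rw [mem_cone_iff] at h1 h2
    exact ⟨h1.1.trans h2.1.symm, take_of_take_eq (h1.2.trans h2.2.symm) hu⟩
  exact h (pt_inj.2 ⟨(key 0).1, Stream'.take_theorem _ _ fun n => (key n).2⟩)

theorem disjoint_cone_of_notMem {u w : Addr d k} {p : End d k} (hw : p ∈ cone w) (hu : p ∉ cone u)
    (hl : len u ≤ len w) : Disjoint (cone u) (cone w) := by
  rcases disjoint_or_extend hl with h | ⟨s, rfl⟩
  · exact h
  · exact absurd (cone_extend_subset _ _ hw) hu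

theorem exists_treeLike_extend (g : NeretinGroup d k) {p : End d k} {v : Addr d k}
    (hp : g • p ∈ cone v) :
    ∃ n, ∀ u : Addr d k, n ≤ len u → p ∈ cone u → ∃ s, TreeLike g u (extend v s) := by
  obtain ⟨n, hn⟩ := exists_table g
  obtain ⟨u, hu, hpu⟩ := exists_mem_cone p n
  obtain ⟨w, hw⟩ := hn u hu.ge
  refine ⟨n + len v, fun u' hu' hpu' => ?_⟩
  obtain ⟨t, rfl⟩ := exists_extend_of_mem hpu hpu' (by omega)
  obtain ⟨t', ht', hT⟩ := hw.extend t
  rw [len_extend] at hu'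
  obtain ⟨s, hs⟩ := exists_extend_of_mem hp (hT.smul_mem hpu') (by rw [len_extend]; omega)
  exact ⟨s, hs ▸ hT⟩

theorem mem_zeroGerm_of_forall_eq {g : NeretinGroup d k} {n : ℕ}
    (h : ∀ p ∈ cone (zeroAddr d k n), g • p = p) : g ∈ zeroGerm d k :=
  ⟨h _ (zeroEnd_mem_cone n), n, .of_forall_eq h⟩

/-- By continuity `j` maps some cone around `zeroEnd` into `cone v`, where `g` is trivial, so the
conjugate is trivial near `zeroEnd`. -/
theorem conj_mem_zeroGerm {g j : NeretinGroup d k} {v : Addr d k} (hv : j • zeroEnd d k ∈ cone v)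
    (h : ∀ p ∈ cone v, g • p = p) : j⁻¹ * g * j ∈ zeroGerm d k := by
  obtain ⟨n, hn⟩ := exists_treeLike_extend j hv
  obtain ⟨s, hs⟩ := hn (zeroAddr d k n) (by simp) (zeroEnd_mem_cone n)
  refine mem_zeroGerm_of_forall_eq (n := n) fun p hp => ?_
  rw [mul_smul, mul_smul, h _ (cone_extend_subset _ _ (hs.smul_mem hp)), inv_smul_smul]

/-- Exchange two sibling cones far from `zeroEnd`, one of which contains `p`. -/
theorem exists_zeroGerm_smul_ne {p : End d k} (hp : p ≠ zeroEnd d k) :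
    ∃ c ∈ zeroGerm d k, c • p ≠ p := by
  obtain ⟨n, hn⟩ := exists_forall_notMem_cone hp
  obtain ⟨u, hu, hpu⟩ := exists_mem_cone p n
  have h0 := hn u hu.ge hpu
  obtain ⟨s, hs, hps⟩ := exists_extend_mem_cone hpu 1
  obtain ⟨a, rfl⟩ := List.length_eq_one_iff.1 hs
  obtain ⟨b, hb⟩ := exists_fin_ne a
  have hab := disjoint_extend_cons (u := u) hb.symm
  have hdis : Disjoint (cone u) (cone (zeroAddr d k n)) :=
    disjoint_cone_of_notMem (zeroEnd_mem_cone n) h0 (by simp [hu])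
  refine ⟨swapCones hab, mem_zeroGerm_of_forall_eq (n := n) fun q hq => ?_, fun he => ?_⟩
  · exact swapCones_of_notMem hab
      (fun h => Set.disjoint_right.1 hdis hq (cone_extend_subset _ _ h))
      (fun h => Set.disjoint_right.1 hdis hq (cone_extend_subset _ _ h))
  · have h1 := (swapCones_treeLike_left hab []).smul_mem (by rwa [extend_nil])
    rw [he, extend_nil] at h1
    exact Set.disjoint_left.1 hab hps h1

/-- A group that contains `zeroGerm` and moves `zeroEnd` is everything. -/
theorem eq_top_of_zeroGerm_le {Γ : Subgroup (NeretinGroup d k)} (hΓ : zeroGerm d k ≤ Γ)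
    {j : NeretinGroup d k} (hjΓ : j ∈ Γ) (hj : j • zeroEnd d k ≠ zeroEnd d k) : Γ = ⊤ := by
  set ξ := zeroEnd d k with hξ
  set η := j • ξ with hη
  -- The conjugate of `zeroGerm` by `j` lies in `Γ` and contains everything that is trivial near
  -- `η`.
  have hconj : ∀ (g : NeretinGroup d k) (v : Addr d k), η ∈ cone v → (∀ p ∈ cone v, g • p = p) →
      g ∈ Γ := fun g v hv hg => by
    have h1 := mul_mem (mul_mem hjΓ (hΓ (conj_mem_zeroGerm hv hg))) (inv_mem hjΓ)
    have h2 : j * (j⁻¹ * g * j) * j⁻¹ = g := by group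
    rwa [h2] at h1
  -- Swapping a small cone at `ξ` with its image and then undoing the twist `α` brings `g` into
  -- `zeroGerm`. Both corrections are trivial near `η`, which is why `g • ξ` has to avoid `ξ` and
  -- `η`.
  have main : ∀ g : NeretinGroup d k, g • ξ ≠ ξ → g • ξ ≠ η → g ∈ Γ := fun g h1 h2 => by
    obtain ⟨n1, hn1⟩ := exists_forall_notMem_cone h1
    obtain ⟨n2, hn2⟩ := exists_forall_notMem_cone h2
    obtain ⟨n3, hn3⟩ := exists_forall_notMem_cone hj.symm
    obtain ⟨n4, hn4⟩ := exists_forall_notMem_cone h1.symm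
    obtain ⟨v0, hv0, hm0⟩ := exists_mem_cone (g • ξ) (n1 + n2 + n3 + n4)
    obtain ⟨n0, hn0⟩ := exists_treeLike_extend g hm0
    set u := zeroAddr d k (n0 + (n1 + n2 + n3 + n4)) with hu
    have hlu : len u = n0 + (n1 + n2 + n3 + n4) := len_zeroAddr _
    have hξu : ξ ∈ cone u := zeroEnd_mem_cone _
    obtain ⟨s, hT⟩ := hn0 u (by omega) hξu
    set v := extend v0 s
    have hlv : n1 + n2 + n3 + n4 ≤ len v := by rw [len_extend]; omega
    have hgv : g • ξ ∈ cone v := hT.smul_mem hξu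
    have huv : Disjoint (cone u) (cone v) := by
      rcases le_total (len u) (len v) with hl | hl
      · exact disjoint_cone_of_notMem hgv (hn4 u (by omega) hξu) hl
      · exact (disjoint_cone_of_notMem hξu (hn1 v (by omega) hgv) hl).symm
    obtain ⟨w, hw, hηw⟩ := exists_mem_cone η (len u + len v)
    have huw : Disjoint (cone u) (cone w) :=
      disjoint_cone_of_notMem hηw (hn3 u (by omega) hξu) (by omega)
    have hvw : Disjoint (cone v) (cone w) :=
      disjoint_cone_of_notMem hηw (hn2 v (by omega) hgv) (by omega)
    obtain ⟨α, hα, hgα⟩ := hT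
    obtain ⟨f, hf1, hf2⟩ := exists_local u (inv_mem hα)
    have hfΓ : f ∈ Γ := hconj f w hηw fun p hp => hf2 p (Set.disjoint_right.1 huw hp)
    have hsΓ : swapCones huv ∈ Γ := hconj _ w hηw fun p hp =>
      swapCones_of_notMem huv (Set.disjoint_right.1 huw hp) (Set.disjoint_right.1 hvw hp)
    have hfsg : f * swapCones huv * g ∈ zeroGerm d k := by
      refine mem_zeroGerm_of_forall_eq (n := n0 + (n1 + n2 + n3 + n4)) ?_
      rintro _ ⟨x, rfl⟩
      change (f * swapCones huv * g) • below u x = below u x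
      rw [mul_smul, mul_smul, hgα, swapCones_below_right, hf1, perm_inv_apply]
    exact (Subgroup.mul_mem_cancel_left Γ (mul_mem hfΓ hsΓ)).1 (hΓ hfsg)
  refine (Subgroup.eq_top_iff' Γ).2 fun g => ?_
  -- The two exceptional cases reduce to the generic one on multiplying by an element of `Γ` that
  -- sends `g • ξ` to a third point: a conjugate by `j` of some `c` in `zeroGerm` if `g • ξ = ξ`,
  -- and such a `c` itself if `g • ξ = η`.
  by_cases h1 : g • ξ = ξ
  · have hne : j⁻¹ • ξ ≠ ξ := fun h => hj (by rw [inv_smul_eq_iff] at h; exact h.symm)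
    obtain ⟨c, hc, hcne⟩ := exists_zeroGerm_smul_ne hne
    have hcΓ : j * c * j⁻¹ ∈ Γ := mul_mem (mul_mem hjΓ (hΓ hc)) (inv_mem hjΓ)
    refine (Subgroup.mul_mem_cancel_left Γ hcΓ).1 (main _ ?_ ?_)
    · rw [mul_smul, h1, mul_smul, mul_smul]
      intro h
      rw [← eq_inv_smul_iff] at h
      exact hcne h
    · rw [mul_smul, h1, mul_smul, mul_smul, hη]
      intro h
      have h3 := smul_left_cancel j h
      have h4 : c • ξ = ξ := hc.1
      exact hne (smul_left_cancel c (h3.trans h4.symm))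
  · by_cases h2 : g • ξ = η
    · obtain ⟨c, hc, hcne⟩ := exists_zeroGerm_smul_ne hj
      refine (Subgroup.mul_mem_cancel_left Γ (hΓ hc)).1 (main _ ?_ ?_)
      · rw [mul_smul, h2]
        intro h
        have h4 : c • ξ = ξ := hc.1
        rw [← h4] at h
        exact hj (smul_left_cancel c h)
      · rw [mul_smul, h2]
        exact hcne
    · exact main g h1 h2

end Separation

/-! ### Counting vertices below the images of a level. -/

section Counting

variable {d k : ℕ} [hd : Fact (2 ≤ d)] [hk : Fact (2 ≤ k)]

theorem exists_extend_iff_below_mem {u v : Addr d k} (hl : len u ≤ len v) (x : Stream' (Fin d)) :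
    below v x ∈ cone u ↔ ∃ s, v = extend u s := by
  constructor
  · exact fun h => exists_extend_of_mem h (below_mem_cone v x) hl
  · rintro ⟨s, rfl⟩
    exact cone_extend_subset _ _ (below_mem_cone _ x)

open Classical in
theorem card_extend {u : Addr d k} {m : ℕ} (hl : len u ≤ m) :
    (Finset.univ.filter fun v : Level d k m => ∃ s, v.1 = extend u s).card = d ^ (m - len u) := by
  have h1 : Fintype.card (List.Vector (Fin d) (m - len u)) = d ^ (m - len u) := by
    rw [card_vector, Fintype.card_fin]
  rw [← h1, ← Finset.card_univ, eq_comm]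
  refine Finset.card_bij (fun s _ => (⟨extend u s.1, by rw [len_extend, s.2]; omega⟩ : Level d k m))
    (fun s _ => ?_) (fun s _ t _ h => ?_) (fun v hv => ?_)
  · simp only [Finset.mem_filter, Finset.mem_univ, true_and]
    exact ⟨s.1, rfl⟩
  · exact Subtype.ext (extend_right_inj.1 (congrArg Subtype.val h))
  · simp only [Finset.mem_filter, Finset.mem_univ, true_and] at hv
    obtain ⟨s, hs⟩ := hv
    have hl' := v.2
    rw [hs, len_extend] at hl'
    exact ⟨⟨s, by omega⟩, Finset.mem_univ _, Subtype.ext hs.symm⟩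

/-- Kraft's equality for the images of the subtrees of level `n`. -/
theorem sum_pow_table {n m : ℕ} {g : NeretinGroup d k} {F : Level d k n → Addr d k}
    (hF : ∀ u, TreeLike g u.1 (F u)) (hm : ∀ u, len (F u) ≤ m) :
    ∑ u, d ^ (m - len (F u)) = k * d ^ m := by
  classical
  rw [← card_level (d := d) (k := k) m, ← Finset.card_univ]
  -- Sort the vertices of level `m` by the unique image cone containing them; the fibre over `u` has
  -- `d ^ (m - len (F u))` elements.
  choose f hf _ using fun v : Level d k m =>
    existsUnique_level n (g⁻¹ • below v.1 (Stream'.const (0 : Fin d)))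
  rw [Finset.card_eq_sum_card_fiberwise (f := f) (t := Finset.univ) (fun _ _ => Finset.mem_univ _)]
  refine Finset.sum_congr rfl fun u _ => ?_
  rw [← card_extend (hm u)]
  refine congrArg Finset.card (Finset.ext fun v => ?_)
  simp only [Finset.mem_filter, Finset.mem_univ, true_and]
  rw [← exists_extend_iff_below_mem (by rw [v.2]; exact hm u) (Stream'.const (0 : Fin d)),
    ← (hF u).inv.smul_mem_iff]
  constructor
  · intro h
    exact (existsUnique_level n _).unique (hf v) h |>.symm ▸ rfl
  · rintro rfl
    exact hf v

/-- By Kraft's equality the weights `d ^ (-len (F u))` have the same sum as for lengths all equal to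
`n`, so the lengths cannot deviate in one direction only. -/
theorem exists_lt_and_exists_gt {n : ℕ} {g : NeretinGroup d k} {F : Level d k n → Addr d k}
    (hF : ∀ u, TreeLike g u.1 (F u)) (h : ¬ ∀ u, len (F u) = n) :
    (∃ u, len (F u) < n) ∧ ∃ u, n < len (F u) := by
  have hd1 : 1 < d := hd.out
  constructor
  · by_contra! H
    obtain ⟨m, hm⟩ := (Set.finite_range fun u => len (F u)).bddAbove
    have hm' : ∀ u, len (F u) ≤ m + n := fun u => (hm ⟨u, rfl⟩).trans (Nat.le_add_right _ _)
    push Not at h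
    obtain ⟨u0, hu0⟩ := h
    have h1 : ∑ u, d ^ (m + n - len (F u)) < ∑ _u : Level d k n, d ^ m := by
      refine Finset.sum_lt_sum (fun u _ => ?_) ⟨u0, Finset.mem_univ _, ?_⟩
      · have := H u
        exact Nat.pow_le_pow_right (by omega) (by omega)
      · have := H u0
        have := hm' u0
        exact Nat.pow_lt_pow_right hd1 (by omega)
    rw [sum_pow_table hF hm', Finset.sum_const, Finset.card_univ, card_level, smul_eq_mul, pow_add]
      at h1
    exact absurd h1 (by rw [mul_assoc, mul_comm (d ^ m)]; exact lt_irrefl _)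
  · by_contra! H
    push Not at h
    obtain ⟨u0, hu0⟩ := h
    have h1 : ∑ _u : Level d k n, 1 < ∑ u, d ^ (n - len (F u)) := by
      refine Finset.sum_lt_sum (fun u _ => Nat.one_le_pow _ _ (by omega))
        ⟨u0, Finset.mem_univ _, ?_⟩
      have := H u0
      exact Nat.one_lt_pow (by omega) hd1
    rw [sum_pow_table hF H, Finset.sum_const, Finset.card_univ, card_level, smul_eq_mul, mul_one]
      at h1
    exact lt_irrefl _ h1

end Counting

/-! ### Level-permuting elements and exchanges generate `zeroGerm`. -/

section Generation

variable {d k : ℕ} [hd : Fact (2 ≤ d)] [hk : Fact (2 ≤ k)]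

/-- The transformation `j` exchanges the subtrees at `u` and `v` and is the identity elsewhere. -/
structure Exchanges (j : NeretinGroup d k) (u v : Addr d k) : Prop where
  left : TreeLike j u v
  right : TreeLike j v u
  off : ∀ p ∉ cone u, p ∉ cone v → j • p = p

theorem exchanges_swapCones {u v : Addr d k} (huv : Disjoint (cone u) (cone v)) :
    Exchanges (swapCones huv) u v where
  left := by simpa using swapCones_treeLike_left huv []
  right := by simpa using swapCones_treeLike_right huv []
  off _ := swapCones_of_notMem huv

theorem Exchanges.conj {j h : NeretinGroup d k} {u v u' v' : Addr d k} (hj : Exchanges j u v)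
    (hu : TreeLike h u u') (hv : TreeLike h v v') : Exchanges (h * j * h⁻¹) u' v' where
  left := (hv.mul hj.left).mul hu.inv
  right := (hu.mul hj.right).mul hv.inv
  off p hp hp' := by
    rw [mul_smul, mul_smul, hj.off, smul_inv_smul]
    · exact fun h' => hp (hu.inv.smul_mem_iff.1 h')
    · exact fun h' => hp' (hv.inv.smul_mem_iff.1 h')

theorem Exchanges.symm {j : NeretinGroup d k} {u v : Addr d k} (hj : Exchanges j u v) :
    Exchanges j v u :=
  ⟨hj.right, hj.left, fun p hp hp' => hj.off p hp' hp⟩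

theorem Exchanges.treeLike {j : NeretinGroup d k} {u v w : Addr d k} (hj : Exchanges j u v)
    (hu : Disjoint (cone w) (cone u)) (hv : Disjoint (cone w) (cone v)) : TreeLike j w w :=
  .of_forall_eq fun p hp => hj.off p (Set.disjoint_left.1 hu hp) (Set.disjoint_left.1 hv hp)

/-- The transformation `g` permutes the subtrees of level `n`. -/
def PermutesLevel (g : NeretinGroup d k) (n : ℕ) : Prop :=
  ∀ u : Addr d k, len u = n → ∃ v, len v = n ∧ TreeLike g u v

theorem disjoint_table {n : ℕ} {g : NeretinGroup d k} {F : Level d k n → Addr d k}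
    (hF : ∀ u, TreeLike g u.1 (F u)) {u v : Level d k n} (huv : u ≠ v) :
    Disjoint (cone (F u)) (cone (F v)) :=
  (hF u).disjoint (hF v) (disjoint_of_ne (u.2.trans v.2.symm) fun h => huv (Subtype.ext h))

/-- If the table of `g` is not level preserving, then multiplication by an exchange brings it
closer to being so. -/
theorem exists_exchange_step {n : ℕ} {g : NeretinGroup d k} {F : Level d k n → Addr d k}
    (hF : ∀ u, TreeLike g u.1 (F u)) (h : ¬ ∀ u, len (F u) = n) :
    ∃ (p : Addr d k) (u1 : Level d k n), Disjoint (cone p) (cone (F u1)) ∧ n ≤ len p ∧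
      len (F u1) < n ∧ (∃ u0 a, F u0 = extend p [a]) ∧
      ∀ j, Exchanges j p (F u1) → ∃ F' : Level d k n → Addr d k,
        (∀ u, TreeLike (j * g) u.1 (F' u)) ∧
        (∀ u, F' u = p ∨ F' u = F u ∨ len (F' u) = len (F u1) + 1) ∧
        (∀ u, u ≠ u1 → (∀ a, F u ≠ extend p [a]) → F' u = F u) ∧
        ∑ u, (len (F' u) - n) < ∑ u, (len (F u) - n) := by
  classical
  obtain ⟨⟨u1, hu1⟩, ⟨u2, hu2⟩⟩ := exists_lt_and_exists_gt hF h
  -- Take `F u0` deepest and `p` its parent. By maximality and disjointness, the images meeting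
  -- `cone p` are exactly children of `p`, so exchanging `cone p` with the shallow cone `F u1` keeps
  -- a table on level `n`.
  obtain ⟨u0, -, hmax⟩ := Finset.exists_max_image Finset.univ (fun u => len (F u))
    ⟨u2, Finset.mem_univ _⟩
  have hu0 : n < len (F u0) := hu2.trans_le (hmax u2 (Finset.mem_univ _))
  have hmax' : ∀ u, len (F u) ≤ len (F u0) := fun u => hmax u (Finset.mem_univ _)
  obtain ⟨p, a0, hp⟩ : ∃ p a, F u0 = extend p [a] := by
    have hne : (F u0).2 ≠ [] := by
      intro h0
      rw [len, h0] at hu0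
      exact absurd hu0 (Nat.not_lt_zero _)
    refine ⟨((F u0).1, (F u0).2.dropLast), (F u0).2.getLast hne, ?_⟩
    rw [extend, List.dropLast_concat_getLast]
  have hlp : len (F u0) = len p + 1 := by rw [hp, len_extend]; rfl
  have h01 : u0 ≠ u1 := by
    rintro rfl
    omega
  have hpq : Disjoint (cone p) (cone (F u1)) := by
    rcases disjoint_or_extend (show len (F u1) ≤ len p by omega) with hd | ⟨s, hs⟩
    · exact hd.symm
    · have h1 := disjoint_table hF h01
      rw [hp, hs, extend_extend] at h1
      exact absurd (cone_extend_subset _ _ (below_mem_cone _ (Stream'.const 0)))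
        (Set.disjoint_left.1 h1 (below_mem_cone _ (Stream'.const 0)))
  refine ⟨p, u1, hpq, by omega, hu1, ⟨u0, a0, hp⟩, fun j hj => ?_⟩
  have hcase : ∀ u, (∃ a, F u = extend p [a]) ∨ Disjoint (cone (F u)) (cone p) := fun u => by
    rcases le_or_gt (len (F u)) (len p) with hl | hl
    · rcases disjoint_or_extend hl with hd | ⟨s, hs⟩
      · exact Or.inr hd
      · have hne : u ≠ u0 := by
          rintro rfl
          omega
        have h1 := disjoint_table hF hne
        rw [hp, hs, extend_extend] at h1
        exact absurd (below_mem_cone _ (Stream'.const 0)) (Set.disjoint_left.1 h1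
          (cone_extend_subset _ _ (below_mem_cone _ (Stream'.const 0))))
    · rcases disjoint_or_extend hl.le with hd | ⟨s, hs⟩
      · exact Or.inr hd.symm
      · have h1 := hmax' u
        have h2 := congrArg len hs
        rw [len_extend] at h2
        obtain ⟨a, rfl⟩ := List.length_eq_one_iff.1 (show s.length = 1 by omega)
        exact Or.inl ⟨a, hs⟩
  have hex : ∀ u, ∃ v, TreeLike (j * g) u.1 v ∧ ((u = u1 ∧ v = p) ∨
      (u ≠ u1 ∧ (∀ a, F u ≠ extend p [a]) ∧ v = F u) ∨
      (u ≠ u1 ∧ (∃ a, F u = extend p [a]) ∧ len v = len (F u1) + 1)) := fun u => by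
    by_cases hu : u = u1
    · subst hu
      exact ⟨p, hj.right.mul (hF _), Or.inl ⟨rfl, rfl⟩⟩
    · by_cases ha : ∃ a, F u = extend p [a]
      · obtain ⟨a, ha⟩ := ha
        obtain ⟨s', hs', hT⟩ := hj.left.extend [a]
        rw [← ha] at hT
        refine ⟨_, hT.mul (hF u), Or.inr (Or.inr ⟨hu, ⟨a, ha⟩, ?_⟩)⟩
        rw [len_extend, hs']
        rfl
      · have hd := (hcase u).resolve_left ha
        push Not at ha
        exact ⟨F u, (hj.treeLike hd (disjoint_table hF hu)).mul (hF u), Or.inr (Or.inl ⟨hu, ha, rfl⟩)⟩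
  choose F' hF' hF'' using hex
  refine ⟨F', hF', fun u => ?_, fun u hu ha => ?_, ?_⟩
  · rcases hF'' u with h1 | h1 | h1
    · exact Or.inl h1.2
    · exact Or.inr (Or.inl h1.2.2)
    · exact Or.inr (Or.inr h1.2.2)
  · rcases hF'' u with h1 | h1 | h1
    · exact absurd h1.1 hu
    · exact h1.2.2
    · obtain ⟨a, ha'⟩ := h1.2.1
      exact absurd ha' (ha a)
  -- The truncated difference counts only the excess over `n`. After interchanging the roles of `u0`
  -- and `u1`, the excess drops at `u0`, where `F u0` is compared with its parent `p`. The cones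
  -- moved below `F u1` have length at most `n`, hence no excess.
  · rw [← Equiv.sum_comp (Equiv.swap u0 u1) fun u => len (F' u) - n]
    have hF'0 : len (F' u0) = len (F u1) + 1 := by
      rcases hF'' u0 with h1 | h1 | h1
      · exact absurd h1.1 h01
      · exact absurd hp (h1.2.1 a0)
      · exact h1.2.2
    have hF'1 : F' u1 = p := by
      rcases hF'' u1 with h1 | h1 | h1
      · exact h1.2
      · exact absurd rfl h1.1
      · exact absurd rfl h1.1
    refine Finset.sum_lt_sum (fun u _ => ?_) ⟨u0, Finset.mem_univ _, ?_⟩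
    · by_cases hu0' : u = u0
      · subst hu0'
        rw [Equiv.swap_apply_left, hF'1]
        omega
      · by_cases hu1' : u = u1
        · subst hu1'
          rw [Equiv.swap_apply_right, hF'0]
          omega
        · rw [Equiv.swap_apply_of_ne_of_ne hu0' hu1']
          rcases hF'' u with h1 | h1 | h1
          · exact absurd h1.1 hu1'
          · rw [h1.2.2]
          · omega
    · rw [Equiv.swap_apply_left, hF'1]
      omega

/-- The group `zeroGerm` is generated by its level preserving elements and by exchanges. -/
theorem zeroGerm_le_of_exchanges {Γ : Subgroup (NeretinGroup d k)} (l : ℕ)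
    (hO : ∀ g : NeretinGroup d k, g • zeroEnd d k = zeroEnd d k → (∃ n, PermutesLevel g n) → g ∈ Γ)
    (hS : ∀ u v : Addr d k, Disjoint (cone u) (cone v) → zeroEnd d k ∉ cone u →
      zeroEnd d k ∉ cone v → l ≤ len u → l ≤ len v → ∃ j ∈ Γ, Exchanges j u v) :
    zeroGerm d k ≤ Γ := by
  rintro g ⟨hg, n0, hg0⟩
  obtain ⟨n1, hn1⟩ := exists_table g
  set m := max n0 n1
  -- Level `m` already gives a table with `zeroAddr` fixed; descending `l` more levels makes all
  -- image addresses at least `l` long, as the available exchanges require.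
  set n := m + l with hn
  let w : Level d k n := ⟨zeroAddr d k n, len_zeroAddr n⟩
  have key : ∀ (c : ℕ) (g : NeretinGroup d k), g • zeroEnd d k = zeroEnd d k →
      ∀ F : Level d k n → Addr d k, (∀ u, TreeLike g u.1 (F u)) → (∀ u, l ≤ len (F u)) →
        F w = w.1 → ∑ u, (len (F u) - n) = c → g ∈ Γ := by
    intro c
    induction c using Nat.strong_induction_on with
    | _ c ih =>
      intro g hg F hF hl hw hc
      by_cases h : ∀ u, len (F u) = n
      · exact hO g hg ⟨n, fun u hu => ⟨_, h ⟨u, hu⟩, hF ⟨u, hu⟩⟩⟩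
      · obtain ⟨p, u1, hdis, hnp, hu1, ⟨u0, a, hu0⟩, H⟩ := exists_exchange_step hF h
        have hwF : zeroEnd d k ∈ cone (F w) := by
          rw [hw]
          exact zeroEnd_mem_cone n
        have hlw : len (F w) = n := by rw [hw]; exact len_zeroAddr n
        have hw1 : w ≠ u1 := by
          rintro rfl
          omega
        have hq : zeroEnd d k ∉ cone (F u1) := Set.disjoint_left.1 (disjoint_table hF hw1) hwF
        -- Otherwise `p` would lie below `F w`, and so would its child `F u0`, against the
        -- disjointness of the images. Thus the exchange used is trivial near `zeroEnd` and leaves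
        -- the value at `w` unchanged.
        have hp : zeroEnd d k ∉ cone p := fun hp => by
          obtain ⟨s, hs⟩ := exists_extend_of_mem hwF hp (by omega)
          have hw0 : w ≠ u0 := by
            rintro rfl
            rw [hu0, len_extend] at hlw
            change len p + 1 = n at hlw
            omega
          have h1 := disjoint_table hF hw0
          rw [hu0, hs, extend_extend] at h1
          exact absurd (cone_extend_subset _ _ (below_mem_cone _ (Stream'.const 0)))
            (Set.disjoint_right.1 h1 (below_mem_cone _ (Stream'.const 0)))
        obtain ⟨j, hjΓ, hj⟩ := hS p (F u1) hdis hp hq (by omega) (hl u1)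
        obtain ⟨F', h1, h2, h3, h4⟩ := H j hj
        refine (Subgroup.mul_mem_cancel_left Γ hjΓ).1 (ih _ (hc ▸ h4) (j * g) ?_ F' h1 (fun u => ?_)
          ?_ rfl)
        · rw [mul_smul, hg, hj.off _ hp hq]
        · have := hl u1
          have := hl u
          rcases h2 u with h | h | h
          · rw [h]; omega
          · rw [h]; assumption
          · omega
        · rw [h3 w hw1 (fun b hb => ?_), hw]
          rw [hb] at hwF
          exact hp (cone_extend_subset _ _ hwF)
  have hex : ∀ u : Level d k n, ∃ v, TreeLike g u.1 v ∧ l ≤ len v := fun u => by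
    obtain ⟨u', hu', hm⟩ := exists_mem_cone (below u.1 (Stream'.const 0)) m
    obtain ⟨s, hs⟩ := exists_extend_of_mem hm (below_mem_cone u.1 _) (by rw [u.2]; omega)
    obtain ⟨v, hv⟩ := hn1 u' (by omega)
    obtain ⟨s', hs', hT⟩ := hv.extend s
    have h1 := congrArg len hs
    rw [u.2, len_extend, hu'] at h1
    exact ⟨_, hs ▸ hT, by rw [len_extend]; omega⟩
  choose F hF hl using hex
  refine key _ g hg F hF hl ?_ rfl
  have h1 := hg0.zeroAddr_of_le hg (show n0 ≤ n by omega)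
  rw [Nat.add_sub_cancel' (show n0 ≤ n by omega)] at h1
  exact (hF w).unique h1

end Generation

/-! ### Large subgroups of finite symmetric groups -/

section LargeSubgroups

open Equiv

variable {α : Type*} [DecidableEq α]

/-- The subgroup `S` contains the cycle `x ↦ y ↦ z ↦ x`. -/
structure ContainsCycle (S : Subgroup (Perm α)) (x y z : α) : Prop where
  ne₁₂ : x ≠ y
  ne₂₃ : y ≠ z
  ne₁₃ : x ≠ z
  mem : swap x y * swap y z ∈ S

variable {S : Subgroup (Perm α)}

theorem cycle_apply_left {x y z : α} (h : x ≠ y) (h' : x ≠ z) : (swap x y * swap y z) x = y := by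
  rw [Perm.mul_apply, swap_apply_of_ne_of_ne h h', swap_apply_left]

theorem cycle_apply_middle {x y z : α} (h : x ≠ z) (h' : y ≠ z) :
    (swap x y * swap y z) y = z := by
  rw [Perm.mul_apply, swap_apply_left, swap_apply_of_ne_of_ne h.symm h'.symm]

theorem cycle_apply_right {x y z : α} : (swap x y * swap y z) z = x := by
  rw [Perm.mul_apply, swap_apply_right, swap_apply_right]

theorem cycle_apply_of_ne {x y z w : α} (h1 : w ≠ x) (h2 : w ≠ y) (h3 : w ≠ z) :
    (swap x y * swap y z) w = w := by
  rw [Perm.mul_apply, swap_apply_of_ne_of_ne h2 h3, swap_apply_of_ne_of_ne h1 h2]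

theorem ContainsCycle.conj {x y z : α} (h : ContainsCycle S x y z) {f : Perm α} (hf : f ∈ S) :
    ContainsCycle S (f x) (f y) (f z) where
  ne₁₂ := f.injective.ne h.ne₁₂
  ne₂₃ := f.injective.ne h.ne₂₃
  ne₁₃ := f.injective.ne h.ne₁₃
  mem := by
    have h1 := mul_mem (mul_mem hf h.mem) (inv_mem hf)
    have h2 : f * (swap x y * swap y z) * f⁻¹ = swap (f x) (f y) * swap (f y) (f z) := by
      rw [swap_apply_apply, swap_apply_apply]
      group
    rwa [h2] at h1

theorem ContainsCycle.inv {x y z : α} (h : ContainsCycle S x y z) : ContainsCycle S z y x where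
  ne₁₂ := h.ne₂₃.symm
  ne₂₃ := h.ne₁₂.symm
  ne₁₃ := h.ne₁₃.symm
  mem := by
    have := inv_mem h.mem
    rwa [mul_inv_rev, swap_inv, swap_inv, swap_comm y z, swap_comm x y] at this

theorem ContainsCycle.rotate {x y z : α} (h : ContainsCycle S x y z) : ContainsCycle S y z x := by
  have := h.conj h.mem
  rwa [cycle_apply_left h.ne₁₂ h.ne₁₃, cycle_apply_middle h.ne₁₃ h.ne₂₃, cycle_apply_right] at this

/-- Two points are linked if they are equal or lie on a common cycle of length three. -/
def Linked (S : Subgroup (Perm α)) (x y : α) : Prop := x = y ∨ ∃ z, ContainsCycle S x y z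

theorem Linked.symm {x y : α} (h : Linked S x y) : Linked S y x := by
  rcases h with rfl | ⟨z, h⟩
  · exact Or.inl rfl
  · exact Or.inr ⟨z, h.inv.rotate⟩

/-- Conjugating the cycle through `x` and `y` by a cycle taking `y` to `w` and fixing `x` gives a
cycle through `x` and `w`. If the second cycle does not fix `x`, it contains both points already. -/
theorem Linked.trans {x y w : α} (h : Linked S x y) (h' : Linked S y w) : Linked S x w := by
  by_cases hxw : x = w
  · exact Or.inl hxw
  rcases h with rfl | ⟨z, h⟩
  · exact h'
  rcases h' with rfl | ⟨v, h'⟩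
  · exact Or.inr ⟨z, h⟩
  by_cases hxv : x = v
  · subst hxv
    exact Or.inr ⟨y, h'.inv⟩
  · have h1 := h.conj h'.mem
    rw [cycle_apply_of_ne h.ne₁₂ hxw hxv, cycle_apply_left h'.ne₁₂ h'.ne₁₃] at h1
    exact Or.inr ⟨_, h1⟩

/-- In a cycle `x ↦ y ↦ z ↦ x`, replace `z` by `w` by conjugating with a cycle taking `z` to `w`. If
the third point of that cycle is `x` or `y`, a second conjugation repairs the result. -/
theorem containsCycle_of_linked {x y w : α} (hxy : x ≠ y) (hyw : y ≠ w) (hxw : x ≠ w)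
    (h1 : Linked S x y) (h2 : Linked S x w) : ContainsCycle S x y w := by
  obtain ⟨z, h⟩ := h1.resolve_left hxy
  by_cases hzw : z = w
  · exact hzw ▸ h
  have hzx : Linked S z x := Or.inr ⟨y, h.rotate.rotate⟩
  obtain ⟨u, h'⟩ := (hzx.trans h2).resolve_left hzw
  by_cases hux : u = x
  · subst hux
    have h3 := h.conj h'.mem
    rw [cycle_apply_right, cycle_apply_of_ne h.ne₂₃ hyw hxy.symm,
      cycle_apply_left h'.ne₁₂ h'.ne₁₃] at h3
    have h4 := h3.conj h.inv.mem
    rw [cycle_apply_left h.inv.ne₁₂ h.inv.ne₁₃, cycle_apply_middle h.inv.ne₁₃ h.inv.ne₂₃,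
      cycle_apply_of_ne (Ne.symm hzw) hyw.symm hxw.symm] at h4
    exact h4.inv.rotate
  by_cases huy : u = y
  · subst huy
    have h3 := h.conj h'.mem
    rw [cycle_apply_right, cycle_apply_of_ne h.ne₁₃ hxw hxy,
      cycle_apply_left h'.ne₁₂ h'.ne₁₃] at h3
    have h4 := h3.conj h.mem
    rw [cycle_apply_left h.ne₁₂ h.ne₁₃, cycle_apply_right,
      cycle_apply_of_ne hxw.symm hyw.symm (Ne.symm hzw)] at h4
    exact h4.inv.rotate
  · have h3 := h.conj h'.mem
    rwa [cycle_apply_of_ne h.ne₁₃ hxw (Ne.symm hux), cycle_apply_of_ne h.ne₂₃ hyw (Ne.symm huy),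
      cycle_apply_left h'.ne₁₂ h'.ne₁₃] at h3

/-- If the supports of two elements have exactly one common point, then their commutator is a
cycle of length three. -/
theorem containsCycle_of_commutator {g h : Perm α} (hg : g ∈ S) (hh : h ∈ S) {a : α}
    (hga : g a ≠ a) (hha : h a ≠ a) (H : ∀ x, g x ≠ x → h x ≠ x → x = a) :
    ContainsCycle S a (g a) (h a) := by
  have hgs : ∀ x, g x ≠ x → x ≠ a → h x = x := fun x h1 h2 => by
    by_contra h3
    exact h2 (H x h1 h3)
  have hhs : ∀ x, h x ≠ x → x ≠ a → g x = x := fun x h1 h2 => by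
    by_contra h3
    exact h2 (H x h3 h1)
  have hgga : g (g a) ≠ g a := g.injective.ne hga
  have hhha : h (h a) ≠ h a := h.injective.ne hha
  have hb : h (g a) = g a := hgs _ hgga hga
  have hc : g (h a) = h a := hhs _ hhha hha
  have hne : g a ≠ h a := fun he => hhha (by rw [← he, hb])
  refine ⟨hga.symm, hne, hha.symm, ?_⟩
  -- Outside the three points the supports do not interact, so the check is pointwise, according to
  -- which of `g` and `h` moves the point.
  have key : g * h * g⁻¹ * h⁻¹ = swap a (g a) * swap (g a) (h a) := by
    rw [mul_inv_eq_iff_eq_mul, mul_inv_eq_iff_eq_mul]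
    ext x
    simp only [Perm.mul_apply]
    rw [← Perm.mul_apply (swap a (g a)) (swap (g a) (h a))]
    by_cases hxa : x = a
    · subst hxa
      rw [hc, hb, cycle_apply_middle hha.symm hne]
    by_cases hgx : g x = x
    · rw [hgx]
      by_cases hhx : h x = x
      · rw [hhx, hgx, cycle_apply_of_ne hxa (fun h1 => hxa (g.injective (hgx.trans h1)))
          (fun h1 => hxa (h.injective (hhx.trans h1)))]
      · have h3 : h (h x) ≠ h x := h.injective.ne hhx
        by_cases h4 : h x = a
        · rw [h4, cycle_apply_left hga.symm hha.symm]
        · rw [hhs _ h3 h4, cycle_apply_of_ne h4 (fun h5 => h3 (by rw [h5, hb]))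
            (fun h5 => hxa (h.injective h5))]
    · have hhx := hgs x hgx hxa
      have h3 : g (g x) ≠ g x := g.injective.ne hgx
      rw [hhx]
      by_cases h4 : g x = a
      · rw [h4, cycle_apply_right]
      · rw [hgs _ h3 h4, cycle_apply_of_ne h4 (fun h5 => hxa (g.injective h5))
          (fun h5 => h3 (by rw [h5, hc]))]
  rw [← key]
  exact mul_mem (mul_mem (mul_mem hg hh) (inv_mem hg)) (inv_mem hh)

/-- Take `Γ₁ ⊆ Γ` maximal supporting no nontrivial element of `S`; it has fewer than `m` points.
Some `g` is supported in `Γ \ Γ₁`, and if it moves `a`, maximality gives an `h` supported in `Γ₁ ∪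
{a}` that moves `a`. Their supports meet only in `a`, so the commutator is a 3-cycle. -/
theorem exists_cycle_of_large {m : ℕ}
    (hS : ∀ Γ : Finset α, m ≤ Γ.card → ∃ s ∈ S, s ≠ 1 ∧ ∀ x ∉ Γ, s x = x)
    (Γ : Finset α) (hΓ : 2 * m ≤ Γ.card) : ∃ x ∈ Γ, ∃ y ∈ Γ, ∃ z ∈ Γ, ContainsCycle S x y z := by
  classical
  obtain ⟨Γ₁, h1, hmax⟩ := Finset.exists_max_image
    (Γ.powerset.filter fun Δ => ∀ s ∈ S, (∀ x ∉ Δ, s x = x) → s = 1) Finset.card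
    ⟨∅, by
      rw [Finset.mem_filter]
      exact ⟨Finset.empty_mem_powerset _, fun s _ hs => Equiv.ext fun x => hs x (by simp)⟩⟩
  rw [Finset.mem_filter, Finset.mem_powerset] at h1
  obtain ⟨h1Γ, h1⟩ := h1
  have hcard : Γ₁.card < m := by
    by_contra! hc
    obtain ⟨s, hs, hs1, hsx⟩ := hS Γ₁ hc
    exact hs1 (h1 s hs hsx)
  obtain ⟨g, hg, hg1, hgx⟩ := hS (Γ \ Γ₁) (by rw [Finset.card_sdiff_of_subset h1Γ]; omega)
  obtain ⟨a, ha⟩ : ∃ a, g a ≠ a := by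
    by_contra! h
    exact hg1 (Equiv.ext h)
  have haΓ : a ∈ Γ \ Γ₁ := by
    by_contra h
    exact ha (hgx a h)
  rw [Finset.mem_sdiff] at haΓ
  obtain ⟨h, hh, hh1, hhx⟩ : ∃ h ∈ S, h ≠ 1 ∧ ∀ x ∉ insert a Γ₁, h x = x := by
    by_contra! hc
    have h2 := hmax (insert a Γ₁) (by
      rw [Finset.mem_filter, Finset.mem_powerset, Finset.insert_subset_iff]
      refine ⟨⟨haΓ.1, h1Γ⟩, fun s hs hsx => ?_⟩
      by_contra hs1
      obtain ⟨x, hx, hx'⟩ := hc s hs hs1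
      exact hx' (hsx x hx))
    rw [Finset.card_insert_of_notMem haΓ.2] at h2
    omega
  have hha : h a ≠ a := fun hha => hh1 (h1 h hh fun x hx => by
    by_cases hxa : x = a
    · rw [hxa, hha]
    · exact hhx x (by rw [Finset.mem_insert, not_or]; exact ⟨hxa, hx⟩))
  have key := containsCycle_of_commutator hg hh ha hha fun x h3 h4 => by
    by_contra hxa
    have h5 : x ∈ Γ \ Γ₁ := by
      by_contra h
      exact h3 (hgx x h)
    refine h4 (hhx x ?_)
    rw [Finset.mem_insert, not_or]
    exact ⟨hxa, (Finset.mem_sdiff.1 h5).2⟩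
  have hgΓ : g a ∈ Γ := by
    by_contra hc
    have := hgx (g a) fun h => hc (Finset.mem_sdiff.1 h).1
    exact ha (g.injective this)
  have hhΓ : h a ∈ Γ := by
    by_contra hc
    have := hhx (h a) fun h => hc (by
      rw [Finset.mem_insert] at h
      rcases h with h | h
      · rw [h]; exact haΓ.1
      · exact h1Γ h)
    exact hha (h.injective this)
  exact ⟨a, haΓ.1, _, hgΓ, _, hhΓ, key⟩

/-- A subgroup with nontrivial elements supported in every large set contains the alternating
group of a large set. -/
theorem exists_finset_containsCycle [Fintype α] {m q : ℕ} (hα : 0 < Fintype.card α)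
    (hS : ∀ Γ : Finset α, m ≤ Γ.card → ∃ s ∈ S, s ≠ 1 ∧ ∀ x ∉ Γ, s x = x)
    (hq : 2 * m * q ≤ Fintype.card α) :
    ∃ Δ : Finset α, q ≤ Δ.card ∧ ∀ x ∈ Δ, ∀ y ∈ Δ, ∀ z ∈ Δ, x ≠ y → y ≠ z → x ≠ z →
      ContainsCycle S x y z := by
  classical
  let r : Setoid α := ⟨Linked S, ⟨fun _ => Or.inl rfl, Linked.symm, Linked.trans⟩⟩
  let f : α → α := fun x => (Quotient.mk r x).out
  have hf : ∀ x, Linked S (f x) x := fun x => Quotient.exact (s := r) (Quotient.out_eq _)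
  have hf' : ∀ x y, Linked S x y → f x = f y := fun x y h => by
    simp only [f]
    rw [Quotient.sound (s := r) h]
  -- A set of `2 * m` representatives of distinct classes would contain a 3-cycle, linking two of
  -- them. With so few classes, one has at least `q` elements.
  have himg : (Finset.univ.image f).card < 2 * m := by
    by_contra! hc
    obtain ⟨x, hx, y, hy, z, -, h⟩ := exists_cycle_of_large hS _ hc
    simp only [Finset.mem_image, Finset.mem_univ, true_and] at hx hy
    obtain ⟨x', rfl⟩ := hx
    obtain ⟨y', rfl⟩ := hy
    have h1 : Linked S x' y' := ((hf x').symm.trans (Or.inr ⟨z, h⟩)).trans (hf y')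
    exact h.ne₁₂ (hf' _ _ h1)
  obtain ⟨x0⟩ := Fintype.card_pos_iff.1 hα
  obtain ⟨y, -, hy⟩ := Finset.exists_le_card_fiber_of_mul_le_card_of_maps_to
    (s := (Finset.univ : Finset α)) (t := Finset.univ.image f) (n := q) (f := f)
    (fun x _ => Finset.mem_image_of_mem _ (Finset.mem_univ x))
    ⟨f x0, Finset.mem_image_of_mem _ (Finset.mem_univ x0)⟩
    (by
      rw [Finset.card_univ]
      exact (Nat.mul_le_mul_right q himg.le).trans hq)
  refine ⟨_, hy, fun a ha b hb c hc hab hbc hac => ?_⟩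
  simp only [Finset.mem_filter, Finset.mem_univ, true_and] at ha hb hc
  have key : ∀ u v, f u = y → f v = y → Linked S u v := fun u v hu hv =>
    (hf u).symm.trans (by rw [hu, ← hv]; exact hf v)
  exact containsCycle_of_linked hab hbc hac (key a b ha hb) (key a c ha hc)

/-- Three-cycles generate the alternating group, so only their images under the embedding need to be
recognized. -/
theorem viaEmbedding_mem_of_containsCycle {β : Type*} [Fintype β] [DecidableEq β] (ι : β ↪ α)
    (hS : ∀ x y z, x ≠ y → y ≠ z → x ≠ z → ContainsCycle S (ι x) (ι y) (ι z)) {σ : Perm β}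
    (hσ : Perm.sign σ = 1) : Perm.viaEmbeddingHom ι σ ∈ S := by
  have h1 : σ ∈ alternatingGroup β := Perm.mem_alternatingGroup.2 hσ
  rw [← Perm.closure_three_cycles_eq_alternating] at h1
  suffices h : Subgroup.closure {τ : Perm β | τ.IsThreeCycle} ≤
      S.comap (Perm.viaEmbeddingHom ι) from h h1
  rw [Subgroup.closure_le]
  intro τ hτ
  obtain ⟨x, hx⟩ : ∃ x, τ x ≠ x := by
    by_contra! h
    exact hτ.isCycle.ne_one (Equiv.ext h)
  have h3 : τ (τ (τ x)) = x := by
    have := hτ.orderOf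
    have h4 : (τ ^ 3) x = x := by rw [← this, pow_orderOf_eq_one]; rfl
    exact h4
  have hxy : x ≠ τ x := hx.symm
  have hyz : τ x ≠ τ (τ x) := fun h => hx (τ.injective h).symm
  have hxz : x ≠ τ (τ x) := fun h => by
    rw [← h] at h3
    exact hx h3
  have hfix : ∀ w, w ≠ x → w ≠ τ x → w ≠ τ (τ x) → τ w = w := fun w h4 h5 h6 => by
    by_contra h7
    obtain ⟨i, hi⟩ := hτ.isCycle.exists_pow_eq hx h7
    have : ∀ i : ℕ, (τ ^ i) x = x ∨ (τ ^ i) x = τ x ∨ (τ ^ i) x = τ (τ x) := fun i => by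
      induction i with
      | zero => exact Or.inl rfl
      | succ i ih =>
        rw [pow_succ', Perm.mul_apply]
        rcases ih with h | h | h <;> rw [h]
        · exact Or.inr (Or.inl rfl)
        · exact Or.inr (Or.inr rfl)
        · exact Or.inl h3
    rcases this i with h | h | h
    · exact h4 (hi.symm.trans h)
    · exact h5 (hi.symm.trans h)
    · exact h6 (hi.symm.trans h)
  have hc := hS x (τ x) (τ (τ x)) hxy hyz hxz
  have he : Perm.viaEmbeddingHom ι τ = swap (ι x) (ι (τ x)) * swap (ι (τ x)) (ι (τ (τ x))) := by
    ext w
    rw [Perm.viaEmbeddingHom_apply]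
    by_cases hw : w ∈ Set.range ι
    · obtain ⟨w, rfl⟩ := hw
      rw [Perm.viaEmbedding_apply]
      by_cases h4 : w = x
      · rw [h4, cycle_apply_left hc.ne₁₂ hc.ne₁₃]
      by_cases h5 : w = τ x
      · rw [h5, cycle_apply_middle hc.ne₁₃ hc.ne₂₃]
      by_cases h6 : w = τ (τ x)
      · rw [h6, cycle_apply_right, h3]
      rw [hfix w h4 h5 h6, cycle_apply_of_ne (ι.injective.ne h4) (ι.injective.ne h5)
        (ι.injective.ne h6)]
    · rw [Perm.viaEmbedding_apply_of_notMem _ _ _ hw, cycle_apply_of_ne] <;>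
        exact fun h => hw ⟨_, h.symm⟩
  change Perm.viaEmbeddingHom ι τ ∈ S
  rw [he]
  exact hc.mem

end LargeSubgroups

/-! ### Permutations of levels induced by a cocompact subgroup -/

section LevelAction

variable {d k : ℕ} [hd : Fact (2 ≤ d)] [hk : Fact (2 ≤ k)]

/-- The permutations of a level induced by the elements of `H`. -/
def levelAction (H : Subgroup (NeretinGroup d k)) (n : ℕ) :
    Subgroup (Equiv.Perm (Level d k n)) where
  carrier := {σ | ∃ h ∈ H, ∀ u : Level d k n, TreeLike h u.1 (σ u).1}
  one_mem' := ⟨1, H.one_mem, fun _ => .one _⟩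
  mul_mem' := by
    rintro σ τ ⟨g, hg, h1⟩ ⟨h, hh, h2⟩
    exact ⟨g * h, H.mul_mem hg hh, fun u => (h1 (τ u)).mul (h2 u)⟩
  inv_mem' := by
    rintro σ ⟨g, hg, h1⟩
    refine ⟨g⁻¹, H.inv_mem hg, fun u => ?_⟩
    have := (h1 (σ⁻¹ u)).inv
    rwa [show σ (σ⁻¹ u) = u from σ.apply_symm_apply u] at this

theorem exists_extend_singleton {n : ℕ} (u : Level d k (n + 1)) :
    ∃ (v : Level d k n) (a : Fin d), u.1 = extend v.1 [a] := by
  obtain ⟨⟨i, w⟩, hw⟩ := u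
  have hne : w ≠ [] := by
    rintro rfl
    simp [len] at hw
  refine ⟨⟨(i, w.dropLast), ?_⟩, w.getLast hne, ?_⟩
  · simp only [len, List.length_dropLast] at hw ⊢
    omega
  · simp only [extend, List.dropLast_append_getLast]

/-- The number of the actions of tree automorphisms on a level is at most exponential in the size
of the level. -/
theorem exists_coloring (n : ℕ) : ∃ (C : Type) (_ : Fintype C) (c : NeretinGroup d k → C),
    Fintype.card C = k ^ k * d ^ (∑ j ∈ Finset.range n, k * d ^ (j + 1)) ∧
    ∀ l ∈ levelSubgroup d k 0, ∀ l' ∈ levelSubgroup d k 0, c l = c l' →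
      ∀ u v : Addr d k, len u = n → TreeLike l u v → TreeLike l' u v := by
  classical
  induction n with
  | zero =>
    have hex : ∀ (l : NeretinGroup d k) (i : Level d k 0), ∃ v : Level d k 0,
        l ∈ levelSubgroup d k 0 → TreeLike l i.1 v.1 := fun l i => by
      by_cases hl : l ∈ levelSubgroup d k 0
      · obtain ⟨v, hv, hT⟩ := exists_treeLike_of_mem hl i.1
        exact ⟨⟨v, hv.trans i.2⟩, fun _ => hT⟩
      · exact ⟨i, fun h => absurd h hl⟩
    choose c hc using hex
    refine ⟨Level d k 0 → Level d k 0, inferInstance, c, ?_, fun l hl l' hl' h u v hu hT => ?_⟩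
    · rw [Fintype.card_fun, card_level]
      simp
    · have h1 := hc l ⟨u, hu⟩ hl
      rw [hT.unique h1, h]
      exact hc l' ⟨u, hu⟩ hl'
  | succ n ih =>
    obtain ⟨C, hC, c, hcard, hc⟩ := ih
    have hex : ∀ (l : NeretinGroup d k) (u : Level d k (n + 1)), ∃ a : Fin d,
        l ∈ levelSubgroup d k 0 → ∃ v, TreeLike l u.1 (extend v [a]) := fun l u => by
      by_cases hl : l ∈ levelSubgroup d k 0
      · obtain ⟨v, hv, hT⟩ := exists_treeLike_of_mem hl u.1
        obtain ⟨w, a, hw⟩ := exists_extend_singleton ⟨v, hv.trans u.2⟩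
        exact ⟨a, fun _ => ⟨w.1, hw ▸ hT⟩⟩
      · exact ⟨0, fun h => absurd h hl⟩
    choose b hb using hex
    -- The image of a vertex of level `n + 1` is known from the image of its parent, recorded by
    -- `c`, and the last digit, recorded by `b`.
    refine ⟨C × (Level d k (n + 1) → Fin d), inferInstance, fun l => (c l, b l), ?_, ?_⟩
    · rw [Fintype.card_prod, hcard, Fintype.card_fun, card_level, Fintype.card_fin,
        Finset.sum_range_succ, pow_add d (∑ j ∈ _, _), mul_assoc, pow_mul]
    · intro l hl l' hl' h u v hu hT
      rw [Prod.mk.injEq] at h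
      have key : ∀ g ∈ levelSubgroup d k 0, ∀ (w v' : Addr d k) (a : Fin d),
          TreeLike g w v' → ∀ hu : len (extend w [a]) = n + 1,
          TreeLike g (extend w [a]) (extend v' [b g ⟨_, hu⟩]) := by
        intro g hg w v' a hT hu
        obtain ⟨s, hs, hT'⟩ := hT.extend [a]
        obtain ⟨x, hx⟩ := hb g ⟨_, hu⟩ hg
        have h1 := hT'.unique hx
        obtain ⟨e, rfl⟩ := List.length_eq_one_iff.1 hs
        have h2 : e = b g ⟨_, hu⟩ := by
          have h3 := congrArg (fun u : Addr d k => u.2.getLast?) h1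
          simpa [extend] using h3
        rwa [← h2]
      obtain ⟨w, a, hw⟩ := exists_extend_singleton ⟨u, hu⟩
      simp only at hw
      subst hw
      obtain ⟨v', -, hT'⟩ := exists_treeLike_of_mem hl w.1
      have h1 := key l hl _ _ a hT' hu
      have h2 := key l' hl' _ _ a (hc l hl l' hl' h.1 _ _ w.2 hT') hu
      rw [hT.unique h1, h.2]
      exact h2

/-- The images of the open sets `K t` cover the coset space, with `K` the subgroup of level `0`, and
finitely many suffice by compactness. -/
theorem exists_finset_cover (H : Subgroup (NeretinGroup d k))
    (hH : CompactSpace (NeretinGroup d k ⧸ H)) :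
    ∃ T : Finset (NeretinGroup d k), ∀ g, ∃ t ∈ T, ∃ l ∈ levelSubgroup d k 0, ∃ h ∈ H,
      g = l * t * h := by
  obtain ⟨T, hT⟩ := isCompact_univ.elim_finite_subcover
    (fun t : NeretinGroup d k => ((↑) : NeretinGroup d k → NeretinGroup d k ⧸ H) ''
      ((fun l => l * t) '' (levelSubgroup d k 0 : Set (NeretinGroup d k))))
    (fun t => QuotientGroup.isOpenMap_coe _ ((Homeomorph.mulRight t).isOpenMap _
      (isOpen_levelSubgroup 0))) (fun x _ => by
        obtain ⟨g, rfl⟩ := QuotientGroup.mk_surjective x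
        exact Set.mem_iUnion.2 ⟨g, g, ⟨1, one_mem _, one_mul g⟩, rfl⟩)
  refine ⟨T, fun g => ?_⟩
  obtain ⟨t, ht, x, ⟨l, hl, rfl⟩, hx⟩ := Set.mem_iUnion₂.1
    (hT (Set.mem_univ (g : NeretinGroup d k ⧸ H)))
  refine ⟨t, ht, l, hl, _, QuotientGroup.eq.1 hx, ?_⟩
  group

/-- Send a permutation of `Γ`, realized in the group as `l * t * h`, to `t` and the colour of `l`.
There are more permutations than values, so two collide, and their quotient is induced by an element
of `H`. -/
theorem exists_mem_levelAction {H : Subgroup (NeretinGroup d k)} {T : Finset (NeretinGroup d k)}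
    (hT : ∀ g, ∃ t ∈ T, ∃ l ∈ levelSubgroup d k 0, ∃ h ∈ H, g = l * t * h) {n m : ℕ}
    (hm : T.card * (k ^ k * d ^ (∑ j ∈ Finset.range n, k * d ^ (j + 1))) < m.factorial)
    (Γ : Finset (Level d k n)) (hΓ : m ≤ Γ.card) :
    ∃ s ∈ levelAction H n, s ≠ 1 ∧ ∀ x ∉ Γ, s x = x := by
  classical
  obtain ⟨C, hC, c, hcard, hc⟩ := exists_coloring (d := d) (k := k) n
  choose t ht l hl h hh hg using hT
  choose e he using fun σ : Equiv.Perm (Level d k n) => exists_levelPerm σ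
  let f : Equiv.Perm Γ → T × C := fun σ =>
    let g := e (Equiv.Perm.ofSubtype σ)
    (⟨t g, ht g⟩, c (l g))
  obtain ⟨σ, τ, hne, heq⟩ := Fintype.exists_ne_map_eq_of_card_lt f (by
    rw [Fintype.card_prod, Fintype.card_coe, hcard, Fintype.card_perm, Fintype.card_coe]
    exact hm.trans_le (Nat.factorial_le hΓ))
  simp only [f, Prod.mk.injEq, Subtype.mk.injEq] at heq
  set g := e (Equiv.Perm.ofSubtype σ) with hgdef
  set g' := e (Equiv.Perm.ofSubtype τ) with hgdef'
  refine ⟨(Equiv.Perm.ofSubtype τ)⁻¹ * Equiv.Perm.ofSubtype σ, ?_, fun h1 => hne ?_, ?_⟩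
  · refine ⟨(h g')⁻¹ * h g, H.mul_mem (H.inv_mem (hh _)) (hh _), fun u => ?_⟩
    -- The common `t` cancels, and the middle factor fixes all vertices of level `n` because the
    -- colours agree.
    have e1 : (h g')⁻¹ * h g = g'⁻¹ * (l g' * (l g)⁻¹) * g := by
      have h1 := hg g
      have h2 := hg g'
      rw [← heq.1] at h2
      have aux : ∀ a b c x : NeretinGroup d k, x = a * b * c → c = b⁻¹ * a⁻¹ * x := by
        rintro a b c _ rfl
        group
      rw [aux _ _ _ _ h1, aux _ _ _ _ h2]
      group
    rw [e1]
    have h5 : ∀ v : Level d k n, TreeLike (l g' * (l g)⁻¹) v.1 v.1 := fun v => by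
      obtain ⟨w, hw, hT⟩ := exists_treeLike_of_mem (inv_mem (hl g)) v.1
      have h6 := hT.inv
      rw [inv_inv] at h6
      exact (hc _ (hl g) _ (hl g') heq.2 _ _ (hw.trans v.2) h6).mul hT
    have h7 : TreeLike g u.1 (Equiv.Perm.ofSubtype σ u).1 := .of_forall_below (he _ u)
    have h8 : TreeLike g' ((Equiv.Perm.ofSubtype τ)⁻¹ (Equiv.Perm.ofSubtype σ u)).1
        (Equiv.Perm.ofSubtype σ u).1 := by
      have := TreeLike.of_forall_below
        (he (Equiv.Perm.ofSubtype τ) ((Equiv.Perm.ofSubtype τ)⁻¹ (Equiv.Perm.ofSubtype σ u)))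
      rwa [show ∀ x, Equiv.Perm.ofSubtype τ ((Equiv.Perm.ofSubtype τ)⁻¹ x) = x from
        fun x => Equiv.apply_symm_apply _ x] at this
    rw [Equiv.Perm.mul_apply]
    exact (h8.inv.mul (h5 _)).mul h7
  · exact (Equiv.Perm.ofSubtype_injective (inv_mul_eq_one.1 h1)).symm
  · intro x hx
    rw [Equiv.Perm.mul_apply, Equiv.Perm.ofSubtype_apply_of_not_mem σ hx, Equiv.Perm.inv_eq_iff_eq,
      Equiv.Perm.ofSubtype_apply_of_not_mem τ hx]

theorem exists_factorial_gt (C D : ℕ) : ∃ m0, ∀ m, m0 ≤ m → C * D ^ (m + 1) < m.factorial := by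
  have h := FloorSemiring.tendsto_pow_div_factorial_atTop (D : ℝ)
  have h2 := (h.const_mul ((C : ℝ) * D)).eventually (gt_mem_nhds (show (C : ℝ) * D * 0 < 1 by simp))
  obtain ⟨m0, hm0⟩ := eventually_atTop.1 h2
  refine ⟨m0, fun m hm => ?_⟩
  have h3 := hm0 m hm
  have h4 : (0 : ℝ) < m.factorial := by positivity
  rw [← mul_div_assoc, div_lt_one h4] at h3
  have : ((C * D ^ (m + 1) : ℕ) : ℝ) < (m.factorial : ℕ) := by
    push_cast
    rw [pow_succ']
    linarith
  exact_mod_cast this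

/-- As `d ≥ 2`, the last level outweighs the previous ones, so the exponent in `exists_coloring` is
linear in the size of level `n`. -/
theorem sum_pow_le (n : ℕ) : ∑ j ∈ Finset.range n, k * d ^ (j + 1) ≤ 2 * (k * d ^ n) := by
  have h2 : 2 ≤ d := hd.out
  induction n with
  | zero => simp
  | succ n ih =>
    rw [Finset.sum_range_succ]
    have : 2 * (k * d ^ n) ≤ k * d ^ (n + 1) := by
      rw [pow_succ]
      calc 2 * (k * d ^ n) = k * (d ^ n * 2) := by ring
        _ ≤ k * (d ^ n * d) := by gcongr
    omega

/-- A cocompact subgroup induces all even permutations of a set of `q` vertices of every large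
level. -/
theorem exists_containsCycle_levelAction (H : Subgroup (NeretinGroup d k))
    (hH : CompactSpace (NeretinGroup d k ⧸ H)) (q : ℕ) (hq : 0 < q) :
    ∃ n0, ∀ n, n0 ≤ n → ∃ Δ : Finset (Level d k n), q ≤ Δ.card ∧
      ∀ x ∈ Δ, ∀ y ∈ Δ, ∀ z ∈ Δ, x ≠ y → y ≠ z → x ≠ z →
        ContainsCycle (levelAction H n) x y z := by
  obtain ⟨T, hT⟩ := exists_finset_cover H hH
  obtain ⟨m0, hm0⟩ := exists_factorial_gt (T.card * k ^ k) (d ^ (4 * q))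
  have h2 : 2 ≤ d := hd.out
  have hk2 : 2 ≤ k := hk.out
  -- With `m = N / (2 * q)` one has `2 * N ≤ 4 * q * (m + 1)`, whence the base `d ^ (4 * q)` above.
  -- The bound on `n` ensures `m ≥ m0`, since `N > n`.
  refine ⟨2 * q * m0, fun n hn => ?_⟩
  have h3 : n < d ^ n := Nat.lt_pow_self h2
  have h4 : d ^ n ≤ k * d ^ n := Nat.le_mul_of_pos_left _ (by omega)
  set N := k * d ^ n with hN
  have h5 : m0 ≤ N / (2 * q) := by
    rw [Nat.le_div_iff_mul_le (by omega)]
    nlinarith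
  have h6 : N < 2 * q * (N / (2 * q) + 1) := Nat.lt_mul_div_succ N (by omega)
  refine exists_finset_containsCycle (m := N / (2 * q)) (by rw [card_level]; omega) (fun Γ hΓ =>
    exists_mem_levelAction hT ?_ Γ hΓ) ?_
  · refine lt_of_le_of_lt ?_ (hm0 _ h5)
    rw [mul_assoc, ← pow_mul]
    have := sum_pow_le (d := d) (k := k) n
    gcongr
    · omega
    · nlinarith
  · rw [card_level, ← hN]
    have := Nat.div_mul_le_self N (2 * q)
    nlinarith

end LevelAction

/-! ### Point stabilizers inducing all even permutations -/

section EvenStabilizer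

variable {d k : ℕ} [hd : Fact (2 ≤ d)] [hk : Fact (2 ≤ k)]

/-- Partitions of a cone along a branch. -/
theorem exists_partition (r : ℕ) : ∀ w : Addr d k, ∃ F : Finset (Addr d k),
    F.card = 1 + (d - 1) * r ∧ (∀ p ∈ cone w, ∃! u, u ∈ F ∧ p ∈ cone u) ∧
    (∀ u ∈ F, cone u ⊆ cone w) ∧
    ∀ g : NeretinGroup d k, (∀ u ∈ F, TreeLike g u u) → TreeLike g w w := by
  classical
  induction r with
  | zero =>
    intro w
    refine ⟨{w}, by simp, fun p hp => ⟨w, by simp [hp], by simp⟩, by simp, by simp⟩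
  | succ r ih =>
    intro w
    obtain ⟨F, hcard, hF, hsub, hT⟩ := ih (extend w [0])
    have hdisj : ∀ a : Fin d, a ≠ 0 → ∀ u ∈ F, Disjoint (cone u) (cone (extend w [a])) :=
      fun a ha u hu => (disjoint_extend_cons ha.symm).mono_left (hsub u hu)
    have hinj : Function.Injective fun a : Fin d => extend w [a] := fun a b h => by
      simpa using extend_right_inj.1 h
    refine ⟨F ∪ (Finset.univ.erase 0).image fun a => extend w [a], ?_, ?_, ?_, ?_⟩
    · rw [Finset.card_union_of_disjoint, hcard, Finset.card_image_of_injective _ hinj,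
        Finset.card_erase_of_mem (Finset.mem_univ _), Finset.card_univ, Fintype.card_fin]
      · ring
      · rw [Finset.disjoint_left]
        intro u hu hu'
        obtain ⟨a, ha, rfl⟩ := Finset.mem_image.1 hu'
        have h1 := hdisj a (Finset.mem_erase.1 ha).1 _ hu
        rw [disjoint_self] at h1
        exact Set.notMem_empty _ (h1.le (below_mem_cone (extend w [a]) (Stream'.const 0)))
    · intro p hp
      obtain ⟨v, hv, hpv⟩ := exists_extend_mem_cone hp 1
      obtain ⟨a, rfl⟩ := List.length_eq_one_iff.1 hv
      have huniq : ∀ b, p ∈ cone (extend w [b]) → b = a := fun b hb => by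
        by_contra hne
        exact Set.disjoint_left.1 (disjoint_extend_cons hne) hb hpv
      by_cases ha : a = 0
      · subst ha
        obtain ⟨u, hu, huu⟩ := hF p hpv
        refine ⟨u, ⟨Finset.mem_union_left _ hu.1, hu.2⟩, fun u' hu' => ?_⟩
        rcases Finset.mem_union.1 hu'.1 with h | h
        · exact huu _ ⟨h, hu'.2⟩
        · obtain ⟨b, hb, rfl⟩ := Finset.mem_image.1 h
          exact absurd (huniq b hu'.2) (Finset.mem_erase.1 hb).1
      · refine ⟨extend w [a], ⟨Finset.mem_union_right _ (Finset.mem_image.2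
          ⟨a, Finset.mem_erase.2 ⟨ha, Finset.mem_univ _⟩, rfl⟩), hpv⟩, fun u' hu' => ?_⟩
        rcases Finset.mem_union.1 hu'.1 with h | h
        · exact absurd hpv (Set.disjoint_left.1 (hdisj a ha u' h) hu'.2)
        · obtain ⟨b, hb, rfl⟩ := Finset.mem_image.1 h
          rw [huniq b hu'.2]
    · intro u hu
      rcases Finset.mem_union.1 hu with h | h
      · exact (hsub u h).trans (cone_extend_subset _ _)
      · obtain ⟨b, hb, rfl⟩ := Finset.mem_image.1 h
        exact cone_extend_subset _ _
    · intro g hg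
      refine .of_children fun a => ⟨a, ?_⟩
      by_cases ha : a = 0
      · subst ha
        exact hT g fun u hu => hg u (Finset.mem_union_left _ hu)
      · exact hg _ (Finset.mem_union_right _ (Finset.mem_image.2
          ⟨a, Finset.mem_erase.2 ⟨ha, Finset.mem_univ _⟩, rfl⟩))

/-- The vertex of level `n` on the ray to `zeroEnd`. -/
def zeroLevel (d k n : ℕ) [Fact (2 ≤ d)] [Fact (2 ≤ k)] : Level d k n :=
  ⟨zeroAddr d k n, len_zeroAddr n⟩

/-- The points of a coset space whose stabilizers induce every even permutation of level `n`
fixing `zeroLevel`. -/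
def evenPoints (H : Subgroup (NeretinGroup d k)) (n : ℕ) : Set (NeretinGroup d k ⧸ H) :=
  {ω | ∀ σ : Equiv.Perm (Level d k n), Equiv.Perm.sign σ = 1 →
    σ (zeroLevel d k n) = zeroLevel d k n →
    σ ∈ levelAction (MulAction.stabilizer (NeretinGroup d k) ω) n}

/-- The elements inducing `σ` form the compact coset `e * levelSubgroup d k n`. So the condition is
the projection, along a compact factor, of a closed set defined by membership in `H`. -/
theorem isClosed_evenPoints {H : Subgroup (NeretinGroup d k)}
    (hH : IsClosed (H : Set (NeretinGroup d k))) (n : ℕ) : IsClosed (evenPoints H n) := by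
  simp only [evenPoints, Set.ofPred_forall]
  refine isClosed_iInter fun σ => isClosed_iInter fun _ => isClosed_iInter fun _ => ?_
  rw [← (QuotientGroup.isQuotientMap_mk H).isClosed_preimage]
  obtain ⟨e, he⟩ := exists_levelPerm σ
  have hC : CompactSpace (levelSubgroup d k n) :=
    isCompact_iff_compactSpace.1 (isCompact_levelSubgroup n)
  have h1 : IsClosed {p : levelSubgroup d k n × NeretinGroup d k |
      p.2⁻¹ * (e * p.1) * p.2 ∈ H} :=
    hH.preimage (by fun_prop)
  convert isClosedMap_snd_of_compactSpace _ h1 using 1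
  ext g
  simp only [Set.mem_preimage, Set.mem_ofPred_eq, levelAction, Set.mem_image, Prod.exists,
    exists_eq_right]
  have h2 : ∀ c : NeretinGroup d k, c ∈ MulAction.stabilizer (NeretinGroup d k)
      (g : NeretinGroup d k ⧸ H) ↔ g⁻¹ * c * g ∈ H := fun c => by
    rw [MulAction.mem_stabilizer_iff, eq_comm, MulAction.Quotient.smul_coe, QuotientGroup.eq,
      smul_eq_mul, mul_assoc]
  constructor
  · rintro ⟨c, hc, hT⟩
    refine ⟨⟨e⁻¹ * c, fun u hu => ?_⟩, ?_⟩
    · exact (TreeLike.of_forall_below (he ⟨u, hu⟩)).inv.mul (hT ⟨u, hu⟩)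
    · rw [mul_inv_cancel_left]
      exact (h2 c).1 hc
  · rintro ⟨⟨l, hl⟩, hm⟩
    exact ⟨e * l, (h2 _).2 hm, fun u => (TreeLike.of_forall_below (he u)).mul (hl u.1 u.2)⟩

/-- Vertices of the next level as pairs. -/
noncomputable def levelSuccEquiv (d k n : ℕ) [Fact (2 ≤ d)] [Fact (2 ≤ k)] : Fin d × Level d k n ≃ Level d k (n + 1) :=
  Equiv.ofBijective (fun p => ⟨extend p.2.1 [p.1], by rw [len_extend, p.2.2]; rfl⟩) <| by
    constructor
    · rintro ⟨a, ⟨u, hu⟩⟩ ⟨b, ⟨v, hv⟩⟩ h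
      simp only [extend, Subtype.mk.injEq, Prod.mk.injEq] at h
      obtain ⟨h1, h2⟩ := h
      obtain ⟨h3, h4⟩ := List.append_inj' h2 rfl
      simp only [List.cons.injEq, and_true] at h4
      have h5 : u = v := Prod.ext h1 h3
      subst h4 h5
      rfl
    · intro u
      obtain ⟨v, a, h⟩ := exists_extend_singleton u
      exact ⟨(a, v), Subtype.ext h.symm⟩

/-- Let `σ` act on the next level without changing the last digit. The sign becomes `sign σ ^ d =
1`, the base vertex is still fixed, and an element inducing this permutation induces `σ`. -/
theorem evenPoints_succ_subset (H : Subgroup (NeretinGroup d k)) (n : ℕ) :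
    evenPoints H (n + 1) ⊆ evenPoints H n := by
  classical
  intro ω hω σ hσ h0
  let τ : Equiv.Perm (Level d k (n + 1)) :=
    (levelSuccEquiv d k n).permCongr (Equiv.prodCongrRight fun _ => σ)
  have hτ : ∀ (u : Level d k n) (a : Fin d),
      (τ ⟨extend u.1 [a], by rw [len_extend, u.2]; rfl⟩).1 = extend (σ u).1 [a] := fun u a => by
    have h1 : (levelSuccEquiv d k n).symm ⟨extend u.1 [a], by rw [len_extend, u.2]; rfl⟩ =
        (a, u) := by
      rw [Equiv.symm_apply_eq]
      rfl
    simp only [τ, Equiv.permCongr_apply, h1]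
    rfl
  obtain ⟨g, hg, hT⟩ := hω τ (by
    rw [Equiv.Perm.sign_permCongr, Equiv.Perm.sign_prodCongrRight]
    simp [hσ]) (by
      have h1 : zeroLevel d k (n + 1) = ⟨extend (zeroLevel d k n).1 [0],
          by rw [len_extend, (zeroLevel d k n).2]; rfl⟩ := Subtype.ext (zeroAddr_add n 1)
      refine Subtype.ext ?_
      rw [h1, hτ, h0])
  refine ⟨g, hg, fun u => .of_children fun a => ⟨a, ?_⟩⟩
  rw [← hτ]
  exact hT ⟨extend u.1 [a], by rw [len_extend, u.2]; rfl⟩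

/-- Subdividing a vertex adds `d - 1` pieces. This congruence makes the leftover vertices in
`evenPoints_nonempty` as numerous as the pieces of a partition of the base cone. -/
theorem card_level_add (n j : ℕ) :
    ∃ r, Fintype.card (Level d k (n + j)) = Fintype.card (Level d k n) + (d - 1) * r := by
  have h2 : 2 ≤ d := hd.out
  simp only [card_level]
  induction j with
  | zero => exact ⟨0, by simp⟩
  | succ j ih =>
    obtain ⟨r, hr⟩ := ih
    refine ⟨r + k * d ^ (n + j), ?_⟩
    rw [mul_add, ← add_assoc (k * d ^ n), ← hr, ← add_assoc n, pow_succ]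
    obtain ⟨e, rfl⟩ := Nat.exists_eq_add_of_le' (show 1 ≤ d by omega)
    rw [Nat.add_sub_cancel]
    ring

/-- Choose `g` carrying a set `Δ'` of deep vertices, on which `H` induces all even permutations,
onto the vertices of level `n` off the base ray, and the remaining deep vertices onto a partition of
the base cone. Then `g * H * g⁻¹`, the stabilizer of the coset of `g`, has the required elements. -/
theorem evenPoints_nonempty (H : Subgroup (NeretinGroup d k))
    (hH : CompactSpace (NeretinGroup d k ⧸ H)) (n : ℕ) : (evenPoints H n).Nonempty := by
  classical
  let W := {u : Level d k n // u ≠ zeroLevel d k n}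
  have hW : Fintype.card W + 1 = Fintype.card (Level d k n) := by
    rw [Fintype.card_subtype_compl, Fintype.card_subtype_eq]
    exact Nat.sub_add_cancel (Fintype.card_pos_iff.2 ⟨zeroLevel d k n⟩)
  -- Only `Fintype.card W` points are used; the additional one makes the requested number visibly
  -- positive.
  obtain ⟨n0, hn0⟩ := exists_containsCycle_levelAction H hH (Fintype.card W + 1) (Nat.succ_pos _)
  obtain ⟨Δ, hΔ, hcyc⟩ := hn0 (n + n0) (by omega)
  obtain ⟨Δ', hΔ', hcard⟩ := Finset.exists_subset_card_eq ((Nat.le_succ _).trans hΔ)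
  let e : W ≃ Δ' := Fintype.equivOfCardEq (by rw [Fintype.card_coe, hcard])
  let ι : W ↪ Level d k (n + n0) := ⟨fun w => (e w).1, fun a b h => e.injective (Subtype.ext h)⟩
  obtain ⟨r, hr⟩ := card_level_add (d := d) (k := k) n n0
  obtain ⟨F, hFc, hF, hsub, hFT⟩ := exists_partition r (zeroAddr d k n)
  have hrest : Fintype.card F = Fintype.card {x : Level d k (n + n0) // x ∉ Δ'} := by
    rw [Fintype.card_coe, hFc, Fintype.card_subtype_compl, Fintype.card_coe, hcard, hr, ← hW]
    omega
  let f : F ≃ {x : Level d k (n + n0) // x ∉ Δ'} := Fintype.equivOfCardEq hrest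
  obtain ⟨g, hg⟩ := exists_glue (I := W ⊕ F) (Sum.elim (fun w => (ι w).1) fun x => (f x).1.1)
    (Sum.elim (fun w => w.1.1) fun x => x.1) (fun p => by
      obtain ⟨x, hx, hxu⟩ := existsUnique_level (n + n0) p
      by_cases hxΔ : x ∈ Δ'
      · refine ⟨Sum.inl (e.symm ⟨x, hxΔ⟩), by
          change p ∈ cone (e (e.symm ⟨x, hxΔ⟩)).1.1
          rwa [Equiv.apply_symm_apply], ?_⟩
        rintro (w | y) hw
        · have := hxu _ hw
          rw [Sum.inl.injEq, Equiv.eq_symm_apply]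
          exact Subtype.ext this
        · have := hxu _ hw
          exact absurd (this ▸ hxΔ) (f y).2
      · refine ⟨Sum.inr (f.symm ⟨x, hxΔ⟩), by simpa using hx, ?_⟩
        rintro (w | y) hw
        · have := hxu _ hw
          exact absurd (this ▸ (e w).2) hxΔ
        · have := hxu _ hw
          rw [Sum.inr.injEq, Equiv.eq_symm_apply]
          exact Subtype.ext this) (fun p => by
      obtain ⟨x, hx, hxu⟩ := existsUnique_level n p
      by_cases hx0 : x = zeroLevel d k n
      · subst hx0
        obtain ⟨y, hy, hyu⟩ := hF p hx
        refine ⟨Sum.inr ⟨y, hy.1⟩, hy.2, ?_⟩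
        rintro (w | z) hw
        · exact absurd (hxu _ hw) w.2
        · rw [Sum.inr.injEq]
          exact Subtype.ext (hyu _ ⟨z.2, hw⟩)
      · refine ⟨Sum.inl ⟨x, hx0⟩, hx, ?_⟩
        rintro (w | z) hw
        · rw [Sum.inl.injEq]
          exact Subtype.ext (hxu _ hw)
        · exact absurd (hxu (zeroLevel d k n) (hsub _ z.2 hw)).symm hx0)
  have hgT : ∀ i, TreeLike g _ _ := fun i => .of_forall_below (hg i)
  refine ⟨(g : NeretinGroup d k ⧸ H), fun σ hσ h0 => ?_⟩
  have hσ' : ∀ x, σ x ≠ zeroLevel d k n ↔ x ≠ zeroLevel d k n := fun x => by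
    rw [Ne, Ne, not_iff_not]
    constructor
    · intro h
      exact σ.injective (h.trans h0.symm)
    · rintro rfl
      exact h0
  let σ' : Equiv.Perm W := σ.subtypePerm hσ'
  have hsign : Equiv.Perm.sign σ' = 1 := by
    exact (Equiv.Perm.sign_subtypePerm (p := (· ≠ zeroLevel d k n)) σ hσ'
      fun x hx h => hx (by rw [h, h0])).trans hσ
  obtain ⟨h, hh, hT⟩ := viaEmbedding_mem_of_containsCycle (S := levelAction H (n + n0)) ι
    (fun x y z hxy hyz hxz => hcyc _ (hΔ' (e x).2) _ (hΔ' (e y).2) _ (hΔ' (e z).2)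
      (ι.injective.ne hxy) (ι.injective.ne hyz) (ι.injective.ne hxz)) hsign
  refine ⟨g * h * g⁻¹, ?_, fun u => ?_⟩
  · rw [MulAction.mem_stabilizer_iff, eq_comm, MulAction.Quotient.smul_coe, QuotientGroup.eq,
      smul_eq_mul]
    simpa using hh
  · by_cases hu : u = zeroLevel d k n
    · rw [hu, h0]
      -- The vertices outside `Δ'` are fixed by the even permutation, so the conjugate preserves
      -- each piece of the partition and therefore the base cone as a tree.
      refine hFT _ fun x hx => ?_
      have h1 := hgT (Sum.inr ⟨x, hx⟩)
      have h2 := hT (f ⟨x, hx⟩).1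
      rw [Equiv.Perm.viaEmbeddingHom_apply, Equiv.Perm.viaEmbedding_apply_of_notMem _ _ _
        (by
          rintro ⟨w, hw⟩
          exact (f ⟨x, hx⟩).2 (hw ▸ (e w).2))] at h2
      exact (h1.mul h2).mul h1.inv
    · have h1 := hgT (Sum.inl ⟨u, hu⟩)
      have h1' := hgT (Sum.inl (σ' ⟨u, hu⟩))
      have h2 := hT (ι ⟨u, hu⟩)
      rw [Equiv.Perm.viaEmbeddingHom_apply, Equiv.Perm.viaEmbedding_apply] at h2
      exact (h1'.mul h2).mul h1.inv

theorem exists_forall_mem_evenPoints {H : Subgroup (NeretinGroup d k)}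
    (hc : IsClosed (H : Set (NeretinGroup d k))) (hH : CompactSpace (NeretinGroup d k ⧸ H)) :
    ∃ ω, ∀ n, ω ∈ evenPoints H n := by
  obtain ⟨ω, hω⟩ := IsCompact.nonempty_iInter_of_sequence_nonempty_isCompact_isClosed
    (evenPoints H) (evenPoints_succ_subset H) (evenPoints_nonempty H hH)
    (isClosed_evenPoints hc 0).isCompact (isClosed_evenPoints hc)
  exact ⟨ω, Set.mem_iInter.1 hω⟩

end EvenStabilizer

/-! ### Groups containing the level preserving transformations fixing the base end -/

section Exchange

variable {d k : ℕ} [hd : Fact (2 ≤ d)] [hk : Fact (2 ≤ k)]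

theorem disjoint_of_fst_ne {u v : Addr d k} (h : u.1 ≠ v.1) : Disjoint (cone u) (cone v) := by
  rw [Set.disjoint_left]
  rintro p hu hv
  obtain ⟨i, x, rfl⟩ := exists_pt p
  exact h ((mem_cone_iff.1 hu).1.symm.trans (mem_cone_iff.1 hv).1)

theorem zeroEnd_notMem_of_fst_ne {u : Addr d k} (h : u.1 ≠ 0) : zeroEnd d k ∉ cone u := fun hu =>
  h (mem_cone_iff.1 hu).1.symm

theorem permutesLevel_swapCones {u v : Addr d k} (huv : Disjoint (cone u) (cone v))
    (hl : len u = len v) : PermutesLevel (swapCones huv) (len u) := fun w hw => by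
  by_cases hu : w = u
  · exact ⟨v, hl.symm, hu ▸ (exchanges_swapCones huv).left⟩
  · by_cases hv : w = v
    · exact ⟨u, rfl, hv ▸ (exchanges_swapCones huv).right⟩
    · exact ⟨w, hw, (exchanges_swapCones huv).treeLike (disjoint_of_ne hw hu)
        (disjoint_of_ne (hw.trans hl) hv)⟩

/-- The images of the children `0` and `1` are disjoint, so one of them avoids `p`. -/
theorem TreeLike.exists_extend_notMem {g : NeretinGroup d k} {u v : Addr d k} (h : TreeLike g u v)
    (p : End d k) : ∃ a v', len v' = len v + 1 ∧ p ∉ cone v' ∧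
      TreeLike g (NeretinTree.extend u [a]) v' := by
  obtain ⟨s, hs, h0⟩ := h.extend [0]
  obtain ⟨t, ht, h1⟩ := h.extend [1]
  by_cases hp : p ∈ cone (NeretinTree.extend v s)
  · refine ⟨1, _, by rw [len_extend, ht]; rfl, fun hp' => ?_, h1⟩
    exact Set.disjoint_left.1 (h0.disjoint h1 (disjoint_extend_cons fin_zero_ne_one)) hp hp'
  · exact ⟨0, _, by rw [len_extend, hs]; rfl, hp, h0⟩

variable {Γ : Subgroup (NeretinGroup d k)}

theorem swapCones_mem (hO : ∀ g : NeretinGroup d k, g • zeroEnd d k = zeroEnd d k →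
    (∃ n, PermutesLevel g n) → g ∈ Γ) {u v : Addr d k} (huv : Disjoint (cone u) (cone v))
    (hu : zeroEnd d k ∉ cone u) (hv : zeroEnd d k ∉ cone v) (hl : len u = len v) :
    swapCones huv ∈ Γ :=
  hO _ (swapCones_of_notMem huv hu hv) ⟨_, permutesLevel_swapCones huv hl⟩

theorem exchanges_transport_left (hO : ∀ g : NeretinGroup d k, g • zeroEnd d k = zeroEnd d k →
    (∃ n, PermutesLevel g n) → g ∈ Γ) {u v u' : Addr d k} (huv : Disjoint (cone u) (cone v))
    (hu'v : Disjoint (cone u') (cone v)) (hu : zeroEnd d k ∉ cone u) (hu' : zeroEnd d k ∉ cone u')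
    (hl : len u = len u') (h : ∃ j ∈ Γ, Exchanges j u v) : ∃ j ∈ Γ, Exchanges j u' v := by
  by_cases huu : u = u'
  · exact huu ▸ h
  obtain ⟨j, hj, hjE⟩ := h
  have hd := disjoint_of_ne hl huu
  have hs := swapCones_mem hO hd hu hu' hl
  exact ⟨_, Γ.mul_mem (Γ.mul_mem hs hj) (Γ.inv_mem hs), hjE.conj (exchanges_swapCones hd).left
    ((exchanges_swapCones hd).treeLike huv.symm hu'v.symm)⟩

theorem exchanges_transport (hO : ∀ g : NeretinGroup d k, g • zeroEnd d k = zeroEnd d k →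
    (∃ n, PermutesLevel g n) → g ∈ Γ) {u v u' v' : Addr d k} (huv : Disjoint (cone u) (cone v))
    (huv' : Disjoint (cone u') (cone v')) (hu : zeroEnd d k ∉ cone u) (hu' : zeroEnd d k ∉ cone u')
    (hv : zeroEnd d k ∉ cone v) (hv' : zeroEnd d k ∉ cone v') (hlu : len u = len u')
    (hlv : len v = len v') (hl : len v ≤ len u) (h : ∃ j ∈ Γ, Exchanges j u v) :
    ∃ j ∈ Γ, Exchanges j u' v' := by
  by_cases hvv : v = v'
  · subst hvv
    exact exchanges_transport_left hO huv huv' hu hu' hlu h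
  have hd := disjoint_of_ne hlv hvv
  have hs := swapCones_mem hO hd hv hv' hlv
  obtain ⟨u1, hu1, hT⟩ : ∃ u1, len u1 = len u ∧ TreeLike (swapCones hd) u u1 := by
    rcases disjoint_or_extend (hlv ▸ hl) with h1 | ⟨s, rfl⟩
    · exact ⟨u, rfl, (exchanges_swapCones hd).treeLike huv h1.symm⟩
    · exact ⟨extend v s, by rw [len_extend, len_extend, hlv], swapCones_treeLike_right hd s⟩
  obtain ⟨j, hj, hjE⟩ := h
  have h2 := hjE.conj hT (exchanges_swapCones hd).left
  refine exchanges_transport_left hO (hT.disjoint (exchanges_swapCones hd).left huv) huv' ?_ hu'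
    (hu1.trans hlu) ⟨_, Γ.mul_mem (Γ.mul_mem hs hj) (Γ.inv_mem hs), h2⟩
  intro hc
  have h3 := hT.smul_mem_iff (p := zeroEnd d k)
  rw [swapCones_of_notMem hd hv hv'] at h3
  exact hu (h3.1 hc)

/-- The element `τ n` pushes the child `0` of the vertex `P n` one level down and fixes the child
`1`. Two of its instances with the same representative in `T` combine to an element of `Γ` that
carries two cones of different lengths to cones of equal length. A swap of equal-length cones away
from `zeroEnd` lies in `Γ`, and conjugating it back gives the exchange. -/
theorem exists_exchanges_succ (hO : ∀ g : NeretinGroup d k, g • zeroEnd d k = zeroEnd d k →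
    (∃ n, PermutesLevel g n) → g ∈ Γ) {T : Finset (NeretinGroup d k)}
    (hT : ∀ g, ∃ t ∈ T, ∃ l ∈ levelSubgroup d k 0, ∃ h ∈ Γ, g = l * t * h) :
    ∃ u v : Addr d k, u.1 = 1 ∧ v.1 = 1 ∧ len u = len v + 1 ∧ ∃ j ∈ Γ, Exchanges j u v := by
  have h10 : (1 : Fin k) ≠ 0 := fin_zero_ne_one.symm
  let P : ℕ → Addr d k := fun n => (1, List.replicate n 0)
  let Z : Addr d k := (0, [])
  have hP : ∀ n s, Disjoint (cone (extend (P n) s)) (cone Z) := fun n s => disjoint_of_fst_ne h10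
  have hlP : ∀ n, len (P n) = n := fun n => List.length_replicate
  have h01 : ∀ n, Disjoint (cone (extend (P n) [1])) (cone (extend (P n) [0])) := fun n =>
    disjoint_extend_cons fin_zero_ne_one.symm
  let τ : ℕ → NeretinGroup d k := fun n =>
    swapCones (hP n [0, 0]) * swapCones (hP n [0])
  have hτ0 : ∀ n, TreeLike (τ n) (extend (P n) [0]) (extend (P n) [0, 0]) := fun n =>
    (exchanges_swapCones (hP n [0, 0])).right.mul (exchanges_swapCones (hP n [0])).left
  have hτ1 : ∀ n, TreeLike (τ n) (extend (P n) [1]) (extend (P n) [1]) := fun n => by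
    refine ((exchanges_swapCones (hP n [0, 0])).treeLike ?_ (hP n _)).mul
      ((exchanges_swapCones (hP n [0])).treeLike (h01 n) (hP n _))
    have : extend (P n) [0, 0] = extend (extend (P n) [0]) [0] := by rw [extend_extend]; rfl
    rw [this]
    exact (h01 n).mono_right (cone_extend_subset _ _)
  choose t ht l hl h hh hg using fun n => hT (τ n)⁻¹
  obtain ⟨y, hy⟩ := Finite.exists_infinite_fiber fun n => (⟨t n, ht n⟩ : T)
  have hy' := Set.infinite_coe_iff.1 hy
  obtain ⟨m, hm⟩ := hy'.nonempty
  obtain ⟨N, hN⟩ := exists_table (τ m)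
  -- For `n` beyond the table of `τ m`, the product `c` is tree-like on all of the cone at `P n`, so
  -- only `τ n` changes relative depths there.
  obtain ⟨n, hn, hNn⟩ := hy'.exists_gt N
  have htt : t m = t n := congrArg Subtype.val (hm.trans hn.symm)
  have hκ : l m * (l n)⁻¹ ∈ levelSubgroup d k 0 := mul_mem (hl m) (inv_mem (hl n))
  have hmem : τ m * (l m * (l n)⁻¹) * (τ n)⁻¹ ∈ Γ := by
    have h1 : τ m * (l m * (l n)⁻¹) * (τ n)⁻¹ = (h m)⁻¹ * h n := by
      rw [← inv_inv (τ m), hg m, hg n, htt]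
      group
    rw [h1]
    exact Γ.mul_mem (Γ.inv_mem (hh m)) (hh n)
  set c := τ m * (l m * (l n)⁻¹) with hc
  obtain ⟨P', hlP', hTP⟩ := exists_treeLike_of_mem hκ (P n)
  obtain ⟨Y, hY⟩ := hN P' (by rw [hlP', hlP]; omega)
  have hcT : TreeLike c (P n) Y := hY.mul hTP
  obtain ⟨s, hs, h1⟩ := hcT.extend [0]
  obtain ⟨s', hs', h2⟩ := hcT.extend [1]
  -- One further digit on each side keeps the image cones away from `zeroEnd`, as membership of the
  -- swap in `Γ` requires.
  obtain ⟨a, x, hlx, hx, hTx⟩ := (h1.mul (hτ0 n).inv).exists_extend_notMem (zeroEnd d k)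
  obtain ⟨a', x', hlx', hx', hTx'⟩ := (h2.mul (hτ1 n).inv).exists_extend_notMem (zeroEnd d k)
  have huv : Disjoint (cone (extend (extend (P n) [0, 0]) [a]))
      (cone (extend (extend (P n) [1]) [a'])) := by
    have : extend (P n) [0, 0] = extend (extend (P n) [0]) [0] := by rw [extend_extend]; rfl
    rw [this, extend_extend]
    exact (h01 n).symm.mono (cone_extend_subset _ _) (cone_extend_subset _ _)
  have hxx := hTx.disjoint hTx' huv
  have hj := swapCones_mem hO hxx hx hx' (by rw [hlx, hlx', len_extend, len_extend, hs, hs']; rfl)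
  refine ⟨extend (extend (P n) [0, 0]) [a], extend (extend (P n) [1]) [a'], rfl, rfl, by simp, _,
    Γ.mul_mem (Γ.mul_mem (Γ.inv_mem hmem) hj) (Γ.inv_mem (Γ.inv_mem hmem)),
    (exchanges_swapCones hxx).conj hTx.inv hTx'.inv⟩

/-- The sibling of a vertex on the ray to `zeroEnd`. -/
def sideAddr (d k n : ℕ) [Fact (2 ≤ d)] [Fact (2 ≤ k)] : Addr d k := extend (zeroAddr d k n) [1]

theorem len_sideAddr (n : ℕ) : len (sideAddr d k n) = n + 1 := by simp [sideAddr]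

theorem zeroEnd_notMem_sideAddr (n : ℕ) : zeroEnd d k ∉ cone (sideAddr d k n) := fun h => by
  have h1 := zeroEnd_mem_cone (d := d) (k := k) (n + 1)
  rw [zeroAddr_add] at h1
  exact Set.disjoint_left.1 (disjoint_extend_cons fin_zero_ne_one) h1 h

theorem disjoint_sideAddr {m n : ℕ} (h : m < n) :
    Disjoint (cone (sideAddr d k m)) (cone (sideAddr d k n)) := by
  obtain ⟨r, rfl⟩ := Nat.exists_eq_add_of_lt h
  have h1 : cone (sideAddr d k (m + r + 1)) ⊆ cone (extend (zeroAddr d k m) [0]) := by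
    rw [sideAddr, show m + r + 1 = m + 1 + r by ring, zeroAddr_add (m + 1), zeroAddr_add m]
    exact (cone_extend_subset _ _).trans (cone_extend_subset _ _)
  exact (disjoint_extend_cons fin_zero_ne_one.symm).mono_right h1

/-- The given exchange `j` carries a cone below `u` to one below `v` that is shorter by one, and
fixes the cone `y` below the child `0` of the root. Conjugating a swap with `y` by `j⁻¹` therefore
gives a difference of one at every deeper level. -/
theorem exists_exchanges_sideAddr (hO : ∀ g : NeretinGroup d k, g • zeroEnd d k = zeroEnd d k →
    (∃ n, PermutesLevel g n) → g ∈ Γ) {u v : Addr d k} (hu : u.1 = 1) (hv : v.1 = 1)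
    (hl : len u = len v + 1) (h : ∃ j ∈ Γ, Exchanges j u v) {n : ℕ} (hn : len v ≤ n) :
    ∃ j ∈ Γ, Exchanges j (sideAddr d k (n + 1)) (sideAddr d k n) := by
  obtain ⟨j, hj, hjE⟩ := h
  obtain ⟨r, rfl⟩ := Nat.exists_eq_add_of_le hn
  have h10 : (1 : Fin k) ≠ 0 := fin_zero_ne_one.symm
  let y : Addr d k := (0, List.replicate (len v + r + 1) 1)
  have hly : len y = len v + r + 1 := List.length_replicate
  have hy : zeroEnd d k ∉ cone y := fun hm => by
    have h1 := zeroEnd_mem_cone_iff.1 hm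
    rw [hly] at h1
    simp only [y, zeroAddr, List.replicate_succ, Prod.mk.injEq, List.cons.injEq] at h1
    exact fin_zero_ne_one h1.2.1.symm
  obtain ⟨s, hs, hT⟩ := hjE.left.extend (List.replicate (r + 1) 0)
  rw [List.length_replicate] at hs
  have hd : Disjoint (cone (extend v s)) (cone y) := disjoint_of_fst_ne (by
    change v.1 ≠ 0
    rw [hv]
    exact h10)
  have hm : swapCones hd ∈ Γ := swapCones_mem hO hd (zeroEnd_notMem_of_fst_ne (by
    change v.1 ≠ 0
    rw [hv]
    exact h10)) hy (by rw [len_extend, hs, hly]; ring)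
  have hyT : TreeLike j y y := hjE.treeLike
    (disjoint_of_fst_ne (by rw [hu]; exact h10.symm)) (disjoint_of_fst_ne (by rw [hv]; exact h10.symm))
  have hE := (exchanges_swapCones hd).conj hT.inv hyT.inv
  refine exchanges_transport hO (disjoint_of_fst_ne (by
    change u.1 ≠ 0
    rw [hu]
    exact h10)) (disjoint_sideAddr (Nat.lt_succ_self _)).symm (zeroEnd_notMem_of_fst_ne (by
    change u.1 ≠ 0
    rw [hu]
    exact h10)) (zeroEnd_notMem_sideAddr _) hy (zeroEnd_notMem_sideAddr _) ?_ ?_ ?_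
    ⟨_, Γ.mul_mem (Γ.mul_mem (Γ.inv_mem hj) hm) (Γ.inv_mem (Γ.inv_mem hj)), hE⟩
  · rw [len_extend, List.length_replicate, len_sideAddr, hl]; ring
  · rw [hly, len_sideAddr]
  · rw [hly, len_extend, List.length_replicate, hl]; omega

/-- Conjugating exchanges of consecutive side cones by one another yields all differences of length,
and `exchanges_transport` then all pairs of deep cones away from `zeroEnd`. -/
theorem zeroGerm_le_of_cover (hO : ∀ g : NeretinGroup d k, g • zeroEnd d k = zeroEnd d k →
    (∃ n, PermutesLevel g n) → g ∈ Γ) {T : Finset (NeretinGroup d k)}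
    (hT : ∀ g, ∃ t ∈ T, ∃ l ∈ levelSubgroup d k 0, ∃ h ∈ Γ, g = l * t * h) :
    zeroGerm d k ≤ Γ := by
  obtain ⟨u, v, hu, hv, hl, h⟩ := exists_exchanges_succ hO hT
  have key : ∀ n, len v ≤ n → ∀ i,
      ∃ j ∈ Γ, Exchanges j (sideAddr d k (n + i + 1)) (sideAddr d k n) := by
    intro n hn i
    induction i with
    | zero => exact exists_exchanges_sideAddr hO hu hv hl h hn
    | succ i ih =>
      obtain ⟨j, hj, hjE⟩ := ih
      obtain ⟨f, hf, hfE⟩ := exists_exchanges_sideAddr hO hu hv hl h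
        (show len v ≤ n + i + 1 by omega)
      refine ⟨_, Γ.mul_mem (Γ.mul_mem hf hj) (Γ.inv_mem hf), hjE.conj hfE.right
        (hfE.treeLike (disjoint_sideAddr (by omega)) (disjoint_sideAddr (by omega)))⟩
  have key' : ∀ u' v' : Addr d k, Disjoint (cone u') (cone v') → zeroEnd d k ∉ cone u' →
      zeroEnd d k ∉ cone v' → len v + 1 ≤ len v' → len v' < len u' → ∃ j ∈ Γ, Exchanges j u' v' := by
    intro u' v' hd hu' hv' h1 h2
    obtain ⟨n, hn⟩ := Nat.exists_eq_add_of_le' (show 1 ≤ len v' by omega)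
    obtain ⟨i, hi⟩ := Nat.exists_eq_add_of_lt h2
    refine exchanges_transport hO (disjoint_sideAddr (by omega)).symm hd
      (zeroEnd_notMem_sideAddr _) hu' (zeroEnd_notMem_sideAddr _) hv' ?_ ?_ ?_
      (key n (by omega) i)
    all_goals
      simp only [len_sideAddr]
      omega
  refine zeroGerm_le_of_exchanges (len v + 1) hO fun u' v' hd hu' hv' h1 h2 => ?_
  rcases lt_trichotomy (len u') (len v') with h3 | h3 | h3
  · obtain ⟨j, hj, hjE⟩ := key' v' u' hd.symm hv' hu' h1 h3
    exact ⟨j, hj, hjE.symm⟩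
  · exact ⟨_, swapCones_mem hO hd hu' hv' h3, exchanges_swapCones hd⟩
  · exact key' u' v' hd hu' hv' h2 h3

end Exchange

/-! ### Cocompact subgroups -/

section Cocompact

variable {d k : ℕ} [hd : Fact (2 ≤ d)] [hk : Fact (2 ≤ k)]

theorem PermutesLevel.of_le {g : NeretinGroup d k} {m n : ℕ} (h : PermutesLevel g m) (hmn : m ≤ n) :
    PermutesLevel g n := by
  intro u hu
  obtain ⟨w, hw, hm⟩ := exists_mem_cone (below u (Stream'.const 0)) m
  obtain ⟨s, rfl⟩ := exists_extend_of_mem hm (below_mem_cone u _) (by omega)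
  obtain ⟨v, hv, hT⟩ := h w hw
  obtain ⟨s', hs', hT'⟩ := hT.extend s
  exact ⟨_, by rw [← hu, len_extend, len_extend, hs', hv, hw], hT'⟩

theorem PermutesLevel.exists_perm {g : NeretinGroup d k} {n : ℕ} (h : PermutesLevel g n) :
    ∃ σ : Equiv.Perm (Level d k n), ∀ u, TreeLike g u.1 (σ u).1 := by
  choose f hf hT using h
  refine ⟨Equiv.ofBijective (fun u : Level d k n => ⟨f u.1 u.2, hf u.1 u.2⟩)
    (Finite.injective_iff_bijective.1 fun u v huv => Subtype.ext ?_), fun u => hT u.1 u.2⟩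
  have h1 := hT u.1 u.2
  rw [Subtype.mk.injEq] at huv
  rw [huv] at h1
  exact h1.unique_left (hT v.1 v.2)

/-- An odd permutation of level `M + 1` becomes even after composing with the transposition of two
siblings, which is invisible on level `M`. Hence `f` is approximated by elements of `Γ` to any
level, and `Γ` is closed. -/
theorem mem_of_isClosed_of_levelAction {Γ : Subgroup (NeretinGroup d k)}
    (hc : IsClosed (Γ : Set (NeretinGroup d k)))
    (hΓ : ∀ n (σ : Equiv.Perm (Level d k n)), Equiv.Perm.sign σ = 1 →
      σ (zeroLevel d k n) = zeroLevel d k n → σ ∈ levelAction Γ n)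
    {f : NeretinGroup d k} (hf : f • zeroEnd d k = zeroEnd d k) (hp : ∃ n, PermutesLevel f n) :
    f ∈ Γ := by
  classical
  obtain ⟨n, hn⟩ := hp
  refine mem_of_isClosed_of_forall_exists hc fun m => ?_
  set M := max n m
  obtain ⟨σ, hσ⟩ := (hn.of_le (show n ≤ M + 1 by omega)).exists_perm
  have h0 : σ (zeroLevel d k (M + 1)) = zeroLevel d k (M + 1) := by
    have h1 := (hσ (zeroLevel d k (M + 1))).smul_mem (zeroEnd_mem_cone _)
    rw [hf] at h1
    exact Subtype.ext (eq_of_mem_of_len_eq h1 (zeroEnd_mem_cone _) ((σ _).2.trans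
      (zeroLevel d k (M + 1)).2.symm))
  let b : Fin d → Level d k (M + 1) := fun a =>
    ⟨extend ((1, List.replicate M 0) : Addr d k) [a], by rw [len_extend]; simp [len]⟩
  have hb : ∀ a, b a ≠ zeroLevel d k (M + 1) := fun a h =>
    fin_zero_ne_one (congrArg (fun u : Level d k (M + 1) => u.1.1) h).symm
  have hbne : b 0 ≠ b 1 := fun h =>
    fin_zero_ne_one (List.cons.inj (extend_right_inj.1 (congrArg Subtype.val h))).1
  obtain ⟨τ, hτ, hστ⟩ : ∃ τ : Equiv.Perm (Level d k (M + 1)),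
      (τ = 1 ∨ τ = Equiv.swap (b 0) (b 1)) ∧ Equiv.Perm.sign (σ * τ) = 1 := by
    rcases Int.units_eq_one_or (Equiv.Perm.sign σ) with h | h
    · exact ⟨1, Or.inl rfl, by rw [mul_one, h]⟩
    · exact ⟨_, Or.inr rfl, by rw [map_mul, h, Equiv.Perm.sign_swap hbne]; rfl⟩
  obtain ⟨g, hg, hgT⟩ := hΓ _ (σ * τ) hστ (by
    rw [Equiv.Perm.mul_apply]
    rcases hτ with rfl | rfl
    · exact h0
    · rw [Equiv.swap_apply_of_ne_of_ne (hb 0).symm (hb 1).symm, h0])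
  have hττ : ∀ u, τ (τ u) = u := fun u => by
    rcases hτ with rfl | rfl
    · rfl
    · exact Equiv.swap_apply_self _ _ _
  have hgf : ∀ u, TreeLike (g⁻¹ * f) u.1 (τ u).1 := fun u => by
    have h1 := hgT (τ u)
    rw [Equiv.Perm.mul_apply, hττ] at h1
    exact h1.inv.mul (hσ u)
  refine ⟨g, hg, levelSubgroup_antitone (le_max_right n m) (mem_levelSubgroup.2 fun u hu =>
    .of_children fun a => ?_)⟩
  have hu' : len (extend u [a]) = M + 1 := by rw [len_extend, hu]; rfl
  have h1 := hgf ⟨_, hu'⟩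
  by_cases h2 : τ ⟨_, hu'⟩ = ⟨_, hu'⟩
  · rw [h2] at h1
    exact ⟨a, h1⟩
  · rcases hτ with rfl | rfl
    · exact absurd rfl h2
    have hU : ∀ c, (⟨extend u [a], hu'⟩ : Level d k (M + 1)) = b c →
        u = (1, List.replicate M 0) := fun c hc => by
      have h3 : extend u [a] = extend (1, List.replicate M 0) [c] := congrArg Subtype.val hc
      rw [extend, extend, Prod.mk.injEq] at h3
      exact Prod.ext h3.1 (List.append_inj' h3.2 rfl).1
    by_cases h3 : (⟨extend u [a], hu'⟩ : Level d k (M + 1)) = b 0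
    · rw [h3, Equiv.swap_apply_left] at h1
      refine ⟨1, ?_⟩
      rw [← h3] at h1
      have h4 := hU 0 h3
      subst h4
      exact h1
    by_cases h4 : (⟨extend u [a], hu'⟩ : Level d k (M + 1)) = b 1
    · rw [h4, Equiv.swap_apply_right] at h1
      refine ⟨0, ?_⟩
      rw [← h4] at h1
      have h5 := hU 1 h4
      subst h5
      exact h1
    exact absurd (Equiv.swap_apply_of_ne_of_ne h3 h4) h2

theorem isClosed_stabilizer {H : Subgroup (NeretinGroup d k)}
    (hc : IsClosed (H : Set (NeretinGroup d k))) (ω : NeretinGroup d k ⧸ H) :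
    IsClosed (MulAction.stabilizer (NeretinGroup d k) ω : Set (NeretinGroup d k)) := by
  obtain ⟨g, rfl⟩ := QuotientGroup.mk_surjective ω
  have : (MulAction.stabilizer (NeretinGroup d k) (g : NeretinGroup d k ⧸ H) :
      Set (NeretinGroup d k)) = (fun c => g⁻¹ * c * g) ⁻¹' H := by
    ext c
    rw [SetLike.mem_coe, MulAction.mem_stabilizer_iff, eq_comm, MulAction.Quotient.smul_coe,
      QuotientGroup.eq, smul_eq_mul, Set.mem_preimage, mul_assoc, SetLike.mem_coe]
  rw [this]
  exact hc.preimage (by fun_prop)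

/-- The stabilizer of the coset of `a` is `a * H * a⁻¹`, so right translation of the representatives
by `a⁻¹` suffices. -/
theorem exists_finset_cover_stabilizer {H : Subgroup (NeretinGroup d k)}
    (hH : CompactSpace (NeretinGroup d k ⧸ H)) (ω : NeretinGroup d k ⧸ H) :
    ∃ T : Finset (NeretinGroup d k), ∀ g, ∃ t ∈ T, ∃ l ∈ levelSubgroup d k 0,
      ∃ h ∈ MulAction.stabilizer (NeretinGroup d k) ω, g = l * t * h := by
  classical
  obtain ⟨a, rfl⟩ := QuotientGroup.mk_surjective ω
  obtain ⟨T, hT⟩ := exists_finset_cover H hH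
  refine ⟨T.image (· * a⁻¹), fun g => ?_⟩
  obtain ⟨t, ht, l, hl, h, hh, hg⟩ := hT (g * a)
  refine ⟨_, Finset.mem_image_of_mem _ ht, l, hl, a * h * a⁻¹, ?_, ?_⟩
  · rw [MulAction.mem_stabilizer_iff, eq_comm, MulAction.Quotient.smul_coe, QuotientGroup.eq,
      smul_eq_mul]
    simpa using hh
  · rw [eq_mul_inv_of_mul_eq hg]
    group

/-- Every closed cocompact subgroup has a conjugate containing `zeroGerm`. -/
theorem exists_zeroGerm_le_stabilizer {H : Subgroup (NeretinGroup d k)}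
    (hc : IsClosed (H : Set (NeretinGroup d k))) (hH : CompactSpace (NeretinGroup d k ⧸ H)) :
    ∃ ω : NeretinGroup d k ⧸ H,
      zeroGerm d k ≤ MulAction.stabilizer (NeretinGroup d k) ω := by
  obtain ⟨ω, hω⟩ := exists_forall_mem_evenPoints hc hH
  obtain ⟨T, hT⟩ := exists_finset_cover_stabilizer hH ω
  exact ⟨ω, zeroGerm_le_of_cover (fun g hg hp =>
    mem_of_isClosed_of_levelAction (isClosed_stabilizer hc ω) hω hg hp) hT⟩

end Cocompact

/-! ### Proper cocompact subgroups -/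

section Proper

variable {d k : ℕ} [hd : Fact (2 ≤ d)] [hk : Fact (2 ≤ k)]

/-- Near `zeroEnd`, `s` shifts the base ray by a constant, and the conjugate has the same zero shift
as `f`. So `zeroGerm` is normal in the stabilizer. -/
theorem inv_mul_mul_mem_zeroGerm {s f : NeretinGroup d k} (hs : s • zeroEnd d k = zeroEnd d k)
    (hf : f ∈ zeroGerm d k) : s⁻¹ * f * s ∈ zeroGerm d k := by
  obtain ⟨hf0, n, hn⟩ := hf
  obtain ⟨N, hN⟩ := exists_table s
  obtain ⟨v, hv⟩ := hN (zeroAddr d k N) (by simp)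
  have h1 := hv.smul_mem (zeroEnd_mem_cone _)
  rw [hs, zeroEnd_mem_cone_iff] at h1
  rw [h1] at hv
  have h2 := hv.zeroAddr_of_le hs (Nat.le_add_right N n)
  rw [Nat.add_sub_cancel_left] at h2
  have h3 := hn.zeroAddr_of_le hf0 (Nat.le_add_left n (len v))
  rw [Nat.add_sub_cancel' (Nat.le_add_left n (len v))] at h3
  exact ⟨by rw [mul_smul, mul_smul, hs, hf0, inv_smul_eq_iff, hs], N + n, (h2.inv.mul h3).mul h2⟩

theorem mem_zeroGerm_of_mem_levelSubgroup {f : NeretinGroup d k} (hf : f ∈ levelSubgroup d k 0)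
    (h0 : f • zeroEnd d k = zeroEnd d k) : f ∈ zeroGerm d k :=
  ⟨h0, 0, hf _ (len_zeroAddr 0)⟩

/-- A proper closed cocompact subgroup has a conjugate which contains `zeroGerm` and fixes
`zeroEnd`. -/
theorem exists_conj_of_ne_top {H : Subgroup (NeretinGroup d k)} (hne : H ≠ ⊤)
    (hc : IsClosed (H : Set (NeretinGroup d k))) (hH : CompactSpace (NeretinGroup d k ⧸ H)) :
    ∃ g : NeretinGroup d k, (∀ f ∈ zeroGerm d k, g⁻¹ * f * g ∈ H) ∧
      ∀ h ∈ H, (g * h * g⁻¹) • zeroEnd d k = zeroEnd d k := by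
  obtain ⟨ω, hω⟩ := exists_zeroGerm_le_stabilizer hc hH
  obtain ⟨g, rfl⟩ := QuotientGroup.mk_surjective ω
  have key : ∀ c, c ∈ MulAction.stabilizer (NeretinGroup d k) (g : NeretinGroup d k ⧸ H) ↔
      g⁻¹ * c * g ∈ H := fun c => by
    rw [MulAction.mem_stabilizer_iff, eq_comm, MulAction.Quotient.smul_coe, QuotientGroup.eq,
      smul_eq_mul, mul_assoc]
  refine ⟨g, fun f hf => (key f).1 (hω hf), fun h hh => ?_⟩
  by_contra hmove
  refine hne (eq_top_iff.2 fun x _ => ?_)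
  have h1 := eq_top_of_zeroGerm_le hω ((key (g * h * g⁻¹)).2 (by simpa [mul_assoc] using hh)) hmove
  have h2 := (key (g * x * g⁻¹)).1 (by rw [h1]; trivial)
  simpa [mul_assoc] using h2

/-- Two elements of the stabilizer with the same representative in `T` differ by an element of `H`,
so the index is at most the cardinality of `T`. -/
theorem finiteIndex_subgroupOf_stabilizer {H : Subgroup (NeretinGroup d k)}
    (hH : CompactSpace (NeretinGroup d k ⧸ H)) {g : NeretinGroup d k}
    (hg : ∀ f ∈ zeroGerm d k, g⁻¹ * f * g ∈ H)
    (hgH : ∀ h ∈ H, (g * h * g⁻¹) • zeroEnd d k = zeroEnd d k) :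
    (H.subgroupOf (MulAction.stabilizer (NeretinGroup d k) (g⁻¹ • zeroEnd d k))).FiniteIndex := by
  obtain ⟨T, hT⟩ := exists_finset_cover H hH
  choose t ht l hl h hh hx using fun x => hT (g * x)
  set S := MulAction.stabilizer (NeretinGroup d k) (g⁻¹ • zeroEnd d k)
  have hS : ∀ s ∈ S, (g * s * g⁻¹) • zeroEnd d k = zeroEnd d k := fun s hs => by
    rw [mul_smul, mul_smul, MulAction.mem_stabilizer_iff.1 hs, smul_inv_smul]
  have key : ∀ s ∈ S, ∀ s' ∈ S, t s = t s' → s⁻¹ * s' ∈ H := by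
    intro s hs s' hs' hts
    have h1 : l s' * (l s)⁻¹ = (g * s' * g⁻¹) * (g * ((h s')⁻¹ * h s) * g⁻¹) * (g * s * g⁻¹)⁻¹ := by
      have h2 : g * s' * (h s')⁻¹ = l s' * t s' := by rw [hx s']; group
      have h3 : g * s * (h s)⁻¹ = l s * t s' := by rw [hx s, hts]; group
      calc l s' * (l s)⁻¹ = (l s' * t s') * (l s * t s')⁻¹ := by group
        _ = _ := by rw [← h2, ← h3]; group
    -- The quotient of the two compact parts fixes `zeroEnd`, and since it preserves levels it lies
    -- in `zeroGerm`; by normality its relevant conjugate lands in `H`.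
    have h0 : (l s' * (l s)⁻¹) • zeroEnd d k = zeroEnd d k := by
      rw [h1, mul_smul, mul_smul, inv_smul_eq_iff.2 (hS s hs).symm,
        hgH _ (H.mul_mem (H.inv_mem (hh s')) (hh s)), hS s' hs']
    have h4 := hg _ (inv_mul_mul_mem_zeroGerm (hS s hs)
      (mem_zeroGerm_of_mem_levelSubgroup (mul_mem (hl s') (inv_mem (hl s))) h0))
    rw [h1] at h4
    have h5 : s⁻¹ * s' = g⁻¹ * ((g * s * g⁻¹)⁻¹ * ((g * s' * g⁻¹) *
        (g * ((h s')⁻¹ * h s) * g⁻¹) * (g * s * g⁻¹)⁻¹) * (g * s * g⁻¹)) * g *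
        ((h s)⁻¹ * h s') := by group
    rw [h5]
    exact H.mul_mem h4 (H.mul_mem (H.inv_mem (hh s)) (hh s'))
  have : Finite (S ⧸ H.subgroupOf S) := by
    refine Finite.of_injective (fun q : S ⧸ H.subgroupOf S => (⟨t q.out, ht _⟩ : T)) ?_
    intro q q' hq
    rw [← q.out_eq, ← q'.out_eq]
    exact QuotientGroup.eq.2 (key _ q.out.2 _ q'.out.2 (congrArg Subtype.val hq))
  exact Subgroup.finiteIndex_of_finite_quotient

end Proper

/-! ### Unimodularity -/

section Unimodular

/-- The set `c * V * c⁻¹` contains `V` and has the same finite measure. Their difference is open and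
null, hence empty. -/
theorem IsUnimodular.conj_mem {Γ : Type*} [Group Γ] [TopologicalSpace Γ] [IsTopologicalGroup Γ]
    (h : IsUnimodular Γ) {V : Subgroup Γ} (hVo : IsOpen (V : Set Γ)) (hVc : IsCompact (V : Set Γ))
    {c : Γ} (hc : ∀ v ∈ V, c⁻¹ * v * c ∈ V) {x : Γ} (hx : c⁻¹ * x * c ∈ V) : x ∈ V := by
  let _ : MeasurableSpace Γ := borel Γ
  have : BorelSpace Γ := ⟨rfl⟩
  obtain ⟨μ, hμ, -, hμr⟩ := h
  by_contra hxV
  have hVcl := V.isClosed_of_isOpen hVo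
  have h1 : μ ((fun y => c⁻¹ * y * c) ⁻¹' (V : Set Γ)) = μ V := by
    have : (fun y => c⁻¹ * y * c) ⁻¹' (V : Set Γ) =
        (fun y => c⁻¹ * y) ⁻¹' ((fun y => y * c) ⁻¹' (V : Set Γ)) := rfl
    rw [this, measure_preimage_mul, measure_preimage_mul_right]
  have h2 : (V : Set Γ) ⊆ (fun y => c⁻¹ * y * c) ⁻¹' (V : Set Γ) := hc
  have h3 : μ ((fun y => c⁻¹ * y * c) ⁻¹' (V : Set Γ) \ V) = 0 := by
    rw [measure_sdiff h2 hVo.measurableSet.nullMeasurableSet hVc.measure_ne_top, h1, tsub_self]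
  have h4 : IsOpen ((fun y => c⁻¹ * y * c) ⁻¹' (V : Set Γ) \ V) :=
    (hVo.preimage (by fun_prop)).sdiff hVcl
  exact (h4.measure_pos μ ⟨x, hx, hxV⟩).ne' h3

theorem IsUnimodular.of_continuousMulEquiv {Γ Δ : Type*} [Group Γ] [TopologicalSpace Γ]
    [IsTopologicalGroup Γ] [Group Δ] [TopologicalSpace Δ] [IsTopologicalGroup Δ]
    (h : IsUnimodular Γ) (e : Γ ≃ₜ* Δ) : IsUnimodular Δ := by
  let _ : MeasurableSpace Γ := borel Γ
  have : BorelSpace Γ := ⟨rfl⟩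
  let _ : MeasurableSpace Δ := borel Δ
  have : BorelSpace Δ := ⟨rfl⟩
  obtain ⟨μ, hμ, hμ', hμr⟩ := h
  refine ⟨μ.map e, e.isHaarMeasure_map μ, Measure.Regular.map e.toHomeomorph, ⟨fun g => ?_⟩⟩
  have h1 : Measurable e := e.continuous.measurable
  rw [Measure.map_map (measurable_mul_const g) h1]
  conv_rhs => rw [← map_mul_right_eq_self μ (e.symm g),
    Measure.map_map h1 (measurable_mul_const _)]
  congr 1
  funext x
  simp

variable {d k : ℕ} [hd : Fact (2 ≤ d)] [hk : Fact (2 ≤ k)]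

/-- The elements whose right translation preserves the measure `μ`. -/
def rightInvariance [MeasurableSpace (NeretinGroup d k)] [BorelSpace (NeretinGroup d k)]
    (μ : Measure (NeretinGroup d k)) : Subgroup (NeretinGroup d k) where
  carrier := {g | μ.map (· * g) = μ}
  one_mem' := by simp
  mul_mem' := by
    intro g h hg hh
    have : (fun x : NeretinGroup d k => x * (g * h)) = (· * h) ∘ (· * g) := by
      funext x
      simp [mul_assoc]
    rw [Set.mem_ofPred_eq] at hg hh ⊢
    rw [this, ← Measure.map_map (by fun_prop) (by fun_prop), hg, hh]
  inv_mem' := by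
    intro g hg
    rw [Set.mem_ofPred_eq] at hg ⊢
    conv_lhs => rw [← hg, Measure.map_map (by fun_prop) (by fun_prop)]
    convert Measure.map_id using 2
    funext x
    simp

end Unimodular

section Unimodular

variable {d k : ℕ} [hd : Fact (2 ≤ d)] [hk : Fact (2 ≤ k)]

/-! ### Right translations preserving Haar measure. -/

section Invariance

variable [MeasurableSpace (NeretinGroup d k)] [BorelSpace (NeretinGroup d k)]
  (μ : Measure (NeretinGroup d k)) [μ.IsHaarMeasure] [μ.Regular]

theorem exists_map_mul_right_eq_smul (g : NeretinGroup d k) :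
    ∃ c : NNReal, μ.map (· * g) = c • μ := by
  have : (μ.map (· * g)).Regular := Measure.Regular.map (Homeomorph.mulRight g)
  exact ⟨_, Measure.isMulLeftInvariant_eq_smul_of_regular _ _⟩

/-- Right translation scales Haar measure by a constant, which is detected by one set of positive
finite measure. -/
theorem mem_rightInvariance_of_measure_eq {g : NeretinGroup d k} {V : Set (NeretinGroup d k)}
    (hVo : IsOpen V) (hVc : IsCompact V) (hV : V.Nonempty) (h : μ ((· * g) ⁻¹' V) = μ V) :
    g ∈ rightInvariance μ := by
  obtain ⟨c, hc⟩ := exists_map_mul_right_eq_smul μ g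
  have h1 := congrArg (fun ν => ν V) hc
  simp only [Measure.smul_apply] at h1
  rw [Measure.map_apply (measurable_mul_const g) hVo.measurableSet, h] at h1
  have h2 : c = 1 := by
    have h3 : μ V ≠ 0 := (hVo.measure_pos μ hV).ne'
    have h4 : μ V ≠ ⊤ := hVc.measure_ne_top
    have h5 : (c : ENNReal) * μ V = 1 * μ V := by
      rw [one_mul]
      exact h1.symm
    exact_mod_cast (ENNReal.mul_left_inj h3 h4).1 h5
  change μ.map (· * g) = μ
  rw [hc, h2, one_smul]

theorem mem_rightInvariance_of_mul_self {g : NeretinGroup d k} (h : g * g = 1) :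
    g ∈ rightInvariance μ := by
  obtain ⟨c, hc⟩ := exists_map_mul_right_eq_smul μ g
  have h1 : μ = (c * c) • μ := by
    conv_lhs => rw [← Measure.map_id (μ := μ)]
    have h2 : (id : NeretinGroup d k → NeretinGroup d k) = (· * g) ∘ (· * g) := by
      funext x
      simp [mul_assoc, h]
    rw [h2, ← Measure.map_map (measurable_mul_const g) (measurable_mul_const g), hc,
      Measure.map_smul, hc, smul_smul]
  have h2 : c * c = 1 := by
    have h3 : μ (levelSubgroup d k 0) ≠ 0 :=
      ((isOpen_levelSubgroup 0).measure_pos μ ⟨1, one_mem _⟩).ne'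
    have h4 : μ (levelSubgroup d k 0) ≠ ⊤ := (isCompact_levelSubgroup 0).measure_ne_top
    have h5 : ((c * c : NNReal) : ENNReal) * μ (levelSubgroup d k 0) =
        1 * μ (levelSubgroup d k 0) := by
      rw [one_mul]
      exact (congrArg (fun ν => ν (levelSubgroup d k 0 : Set (NeretinGroup d k))) h1).symm
    exact_mod_cast (ENNReal.mul_left_inj h3 h4).1 h5
  have h3 : c = 1 := by
    rw [← sq] at h2
    exact (pow_eq_one_iff_of_nonneg zero_le two_ne_zero).1 h2
  change μ.map (· * g) = μ
  rw [hc, h3, one_smul]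

/-- Such an element normalizes the compact open group `levelSubgroup d k n`, so right translation
can be replaced by left translation on it. -/
theorem mem_rightInvariance_of_permutesLevel {g : NeretinGroup d k} {n : ℕ}
    (h : PermutesLevel g n) : g ∈ rightInvariance μ := by
  obtain ⟨σ, hσ⟩ := h.exists_perm
  have hσ' : ∀ u, TreeLike g⁻¹ u.1 (σ⁻¹ u).1 := fun u => by
    have := (hσ (σ⁻¹ u)).inv
    rwa [show σ (σ⁻¹ u) = u from σ.apply_symm_apply u] at this
  refine mem_rightInvariance_of_measure_eq μ (isOpen_levelSubgroup n) (isCompact_levelSubgroup n)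
    ⟨1, one_mem _⟩ ?_
  have h1 : (· * g) ⁻¹' (levelSubgroup d k n : Set (NeretinGroup d k)) =
      (g * ·) ⁻¹' (levelSubgroup d k n : Set (NeretinGroup d k)) := by
    ext x
    simp only [Set.mem_preimage, SetLike.mem_coe, mem_levelSubgroup]
    constructor
    · intro hx u hu
      have h2 := ((hσ _).mul (hx _ (σ⁻¹ ⟨u, hu⟩).2)).mul (hσ' ⟨u, hu⟩)
      rw [show σ (σ⁻¹ ⟨u, hu⟩) = ⟨u, hu⟩ from σ.apply_symm_apply _] at h2
      simpa [mul_assoc] using h2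
    · intro hx u hu
      have h2 := ((hσ' _).mul (hx _ (σ ⟨u, hu⟩).2)).mul (hσ ⟨u, hu⟩)
      rw [show σ⁻¹ (σ ⟨u, hu⟩) = ⟨u, hu⟩ from σ.symm_apply_apply _] at h2
      simpa [mul_assoc] using h2
  rw [h1, measure_preimage_mul]

theorem rightInvariance_eq_top : rightInvariance μ = ⊤ := by
  have hd01 : Disjoint (cone ((0, []) : Addr d k)) (cone ((1, []) : Addr d k)) :=
    disjoint_of_fst_ne fin_zero_ne_one
  refine eq_top_of_zeroGerm_le (zeroGerm_le_of_exchanges 0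
    (fun g _ ⟨n, hn⟩ => mem_rightInvariance_of_permutesLevel μ hn)
    fun u v huv _ _ _ _ => ⟨_, mem_rightInvariance_of_mul_self μ (swapCones_mul_self huv),
      exchanges_swapCones huv⟩)
    (mem_rightInvariance_of_mul_self μ (swapCones_mul_self hd01)) fun h => ?_
  have h1 := (exchanges_swapCones hd01).left.smul_mem (zeroEnd_mem_cone (d := d) (k := k) 0)
  rw [h] at h1
  exact zeroEnd_notMem_of_fst_ne (u := ((1, []) : Addr d k)) fin_zero_ne_one.symm h1

end Invariance

theorem isUnimodular_neretinGroup (d k : ℕ) [Fact (2 ≤ d)] [Fact (2 ≤ k)] :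
    IsUnimodular (NeretinGroup d k) := by
  let _ : MeasurableSpace (NeretinGroup d k) := borel _
  have : BorelSpace (NeretinGroup d k) := ⟨rfl⟩
  refine ⟨Measure.haar, inferInstance, inferInstance, ⟨fun g => ?_⟩⟩
  have h : g ∈ rightInvariance (Measure.haar (G := NeretinGroup d k)) := by
    rw [rightInvariance_eq_top]
    trivial
  exact h

/-- A transformation fixing `zeroEnd` and expanding towards it. -/
theorem exists_expanding (d k : ℕ) [Fact (2 ≤ d)] [Fact (2 ≤ k)] :
    ∃ f : NeretinGroup d k, f • zeroEnd d k = zeroEnd d k ∧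
      (∀ u ∈ levelSubgroup d k 0, u • zeroEnd d k = zeroEnd d k →
        f⁻¹ * u * f ∈ levelSubgroup d k 0) ∧
      ∃ u ∈ levelSubgroup d k 0, u • zeroEnd d k = zeroEnd d k ∧
        f * u * f⁻¹ ∉ levelSubgroup d k 0 := by
  have h01 : (0 : Fin k) ≠ 1 := fin_zero_ne_one
  have hA : Disjoint (cone ((1, []) : Addr d k)) (cone (extend ((0, []) : Addr d k) [0])) :=
    disjoint_of_fst_ne h01.symm
  have hB : Disjoint (cone ((0, []) : Addr d k)) (cone ((1, []) : Addr d k)) :=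
    disjoint_of_fst_ne h01
  -- `f` maps the cone of the child `0` of the root onto that of its own child `0`, the subcone `0`
  -- below the child `1` onto the whole cone of the child `1`, and the other children of `1` onto
  -- the corresponding children of `0`.
  let f := swapCones hA * swapCones hB
  have f0 : TreeLike f (0, []) (extend (0, []) [0]) :=
    (exchanges_swapCones hA).left.mul (exchanges_swapCones hB).left
  have f10 : TreeLike f (extend (1, []) [0]) (1, []) :=
    (exchanges_swapCones hA).right.mul (swapCones_treeLike_right hB [0])
  have f1a : ∀ a : Fin d, a ≠ 0 → TreeLike f (extend (1, []) [a]) (extend (0, []) [a]) :=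
    fun a ha => ((exchanges_swapCones hA).treeLike (disjoint_of_fst_ne h01)
      (disjoint_extend_cons ha)).mul (swapCones_treeLike_right hB [a])
  have fi : ∀ i : Fin k, i ≠ 0 → i ≠ 1 → TreeLike f (i, []) (i, []) := fun i h0 h1 =>
    ((exchanges_swapCones hA).treeLike (disjoint_of_fst_ne h1) (disjoint_of_fst_ne h0)).mul
      ((exchanges_swapCones hB).treeLike (disjoint_of_fst_ne h0) (disjoint_of_fst_ne h1))
  have hf0 : f • zeroEnd d k = zeroEnd d k := by
    have h1 : ∀ x : Stream' (Fin d), f • below ((0, []) : Addr d k) x =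
        below (extend ((0, []) : Addr d k) [0]) x := fun x => by
      rw [mul_smul, swapCones_below_left, swapCones_below_left]
    have h2 : zeroEnd d k = below ((0, []) : Addr d k) (Stream'.const 0) := rfl
    have h3 : zeroEnd d k = below (extend ((0, []) : Addr d k) [0]) (Stream'.const 0) := by
      rw [below_extend, h2, show [(0 : Fin d)] ++ₛ Stream'.const 0 = Stream'.const 0 from
        (Stream'.const_eq 0).symm]
    rw [h2, h1, ← h3, h2]
  refine ⟨f, hf0, fun u hu hu0 => mem_levelSubgroup.2 ?_, ?_⟩
  · have u00 : TreeLike u (extend (0, []) [0]) (extend (0, []) [0]) :=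
      (hu (0, []) rfl).zeroAddr_of_le (i := 0) (l := 0) hu0 (j := 1) (Nat.zero_le 1)
    rintro ⟨i, w⟩ hw
    obtain rfl : w = [] := List.length_eq_zero_iff.1 hw
    by_cases h0 : i = 0
    · subst h0
      exact (f0.inv.mul u00).mul f0
    by_cases h1 : i = 1
    · subst h1
      refine .of_children fun a => ?_
      by_cases ha : a = 0
      · subst ha
        exact ⟨0, (f10.inv.mul (hu (1, []) rfl)).mul f10⟩
      · obtain ⟨s, hs, hT⟩ := (hu (0, []) rfl).extend [a]
        obtain ⟨b, rfl⟩ := List.length_eq_one_iff.1 hs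
        have hb : b ≠ 0 := fun hb => by
          subst hb
          exact ha (List.cons.inj (extend_right_inj.1 (hT.unique_left u00))).1
        exact ⟨b, ((f1a b hb).inv.mul hT).mul (f1a a ha)⟩
    · exact ((fi i h0 h1).inv.mul (hu (i, []) rfl)).mul (fi i h0 h1)
  · have hC : Disjoint (cone (extend ((1, []) : Addr d k) [0])) (cone (extend (1, []) [1])) :=
      disjoint_extend_cons fin_zero_ne_one
    -- Swapping the children `0` and `1` below the root child `1` is conjugated by `f` to an
    -- exchange of the root child `1` with a vertex below the root child `0`, which does not
    -- preserve levels.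
    refine ⟨swapCones hC, mem_levelSubgroup.2 ?_, ?_, fun h => ?_⟩
    · have hP := permutesLevel_swapCones hC rfl
      rintro ⟨i, w⟩ hw
      obtain rfl : w = [] := List.length_eq_zero_iff.1 hw
      by_cases h1 : i = 1
      · subst h1
        refine .of_children fun a => ?_
        by_cases ha0 : a = 0
        · subst ha0
          exact ⟨1, (exchanges_swapCones hC).left⟩
        by_cases ha1 : a = 1
        · subst ha1
          exact ⟨0, (exchanges_swapCones hC).right⟩
        exact ⟨a, (exchanges_swapCones hC).treeLike (disjoint_extend_cons ha0)
          (disjoint_extend_cons ha1)⟩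
      · exact (exchanges_swapCones hC).treeLike (disjoint_of_fst_ne h1) (disjoint_of_fst_ne h1)
    · exact swapCones_of_notMem hC (zeroEnd_notMem_of_fst_ne h01.symm)
        (zeroEnd_notMem_of_fst_ne h01.symm)
    · have h1 := ((f1a 1 fin_zero_ne_one.symm).mul (exchanges_swapCones hC).left).mul f10.inv
      have h2 := congrArg Prod.fst (h1.unique (h (1, []) rfl))
      exact h01 h2

/-- A proper closed cocompact subgroup is not unimodular. -/
theorem eq_top_of_isUnimodular {H : Subgroup (NeretinGroup d k)}
    (hc : IsClosed (H : Set (NeretinGroup d k))) (hH : CompactSpace (NeretinGroup d k ⧸ H))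
    (hu : IsUnimodular H) : H = ⊤ := by
  by_contra hne
  obtain ⟨g, hg, hgH⟩ := exists_conj_of_ne_top hne hc hH
  have hfin := finiteIndex_subgroupOf_stabilizer hH hg hgH
  obtain ⟨f, hf0, hfU, u, huL, hu0, huf⟩ := exists_expanding d k
  have hfS : g⁻¹ * f * g ∈ MulAction.stabilizer (NeretinGroup d k) (g⁻¹ • zeroEnd d k) := by
    rw [MulAction.mem_stabilizer_iff, mul_smul, mul_smul, smul_inv_smul, hf0]
  -- Finite index supplies a positive power of the conjugated expanding element inside `H`.
  obtain ⟨n, hn, -, hmem⟩ := Subgroup.exists_pow_mem_of_index_ne_zero hfin.index_ne_zero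
    (⟨_, hfS⟩ : MulAction.stabilizer (NeretinGroup d k) (g⁻¹ • zeroEnd d k))
  have hcH : g⁻¹ * f ^ n * g ∈ H := by
    have h1 : (g⁻¹ * f * g) ^ n ∈ H := hmem
    have h2 : ∀ m : ℕ, (g⁻¹ * f * g) ^ m = g⁻¹ * f ^ m * g := fun m => by
      have := conj_pow (i := m) (a := g⁻¹) (b := f)
      rwa [inv_inv] at this
    rwa [h2] at h1
  let V : Subgroup H :=
    (levelSubgroup d k 0).comap ((MulAut.conj g).toMonoidHom.comp H.subtype)
  have hV : ∀ x : H, x ∈ V ↔ g * x.1 * g⁻¹ ∈ levelSubgroup d k 0 := fun x => Iff.rfl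
  have hVo : IsOpen (V : Set H) := (isOpen_levelSubgroup 0).preimage (by
    change Continuous fun x : H => g * x.1 * g⁻¹
    fun_prop)
  have hVc : IsCompact (V : Set H) := by
    have h1 : IsCompact ((fun x => g * x * g⁻¹) ⁻¹' (levelSubgroup d k 0 :
        Set (NeretinGroup d k))) := by
      have : (fun x => g * x * g⁻¹) = (Homeomorph.mulLeft g).trans (Homeomorph.mulRight g⁻¹) := rfl
      rw [this, Homeomorph.isCompact_preimage]
      exact isCompact_levelSubgroup 0
    exact hc.isClosedEmbedding_subtypeVal.isCompact_preimage h1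
  have hiter : ∀ (m : ℕ) (v : NeretinGroup d k), v ∈ levelSubgroup d k 0 →
      v • zeroEnd d k = zeroEnd d k → (f ^ m)⁻¹ * v * f ^ m ∈ levelSubgroup d k 0 := by
    intro m
    induction m with
    | zero => intro v hv _; simpa using hv
    | succ m ih =>
      intro v hv hv0
      have h1 := ih _ (hfU v hv hv0) (by rw [mul_smul, mul_smul, hf0, hv0, inv_smul_eq_iff, hf0])
      convert h1 using 1
      rw [pow_succ']
      group
  -- By normality `f * u * f⁻¹` is still in `zeroGerm`, so its conjugate by `g⁻¹` lies in `H`. It is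
  -- outside `V` but is conjugated into `V`, contradicting unimodularity.
  have huz := inv_mul_mul_mem_zeroGerm (s := f⁻¹) (by rw [inv_smul_eq_iff, hf0])
    (mem_zeroGerm_of_mem_levelSubgroup huL hu0)
  rw [inv_inv] at huz
  have h1 := hu.conj_mem hVo hVc (c := ⟨_, hcH⟩) (x := ⟨_, hg _ huz⟩) (fun v hv => ?_) ?_
  · rw [hV] at h1
    refine huf ?_
    simpa [mul_assoc] using h1
  · have h2 := hiter n _ ((hV v).1 hv) (hgH v.1 v.2)
    rw [hV]
    convert h2 using 1
    simp only [Subgroup.coe_mul, Subgroup.coe_inv]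
    group
  · obtain ⟨m, rfl⟩ := Nat.exists_eq_add_of_le' hn
    have h2 := hiter m u huL hu0
    rw [hV]
    convert h2 using 1
    simp only [Subgroup.coe_mul, Subgroup.coe_inv]
    rw [pow_succ']
    group

end Unimodular

end NeretinTree

theorem mainTheorem5 (d k : ℕ) (hd : 2 ≤ d) (hk : 2 ≤ k) :
    (∀ H : Subgroup (NeretinTree.NeretinGroup d k),
      H ≠ ⊤ → IsClosed (H : Set (NeretinTree.NeretinGroup d k)) →
      CompactSpace (NeretinTree.NeretinGroup d k ⧸ H) →
      ∃ ξ : NeretinTree.End d k,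
        H ≤ MulAction.stabilizer (NeretinTree.NeretinGroup d k) ξ ∧
        (H.subgroupOf (MulAction.stabilizer (NeretinTree.NeretinGroup d k) ξ)).FiniteIndex) ∧
    (∀ H : Subgroup (NeretinTree.NeretinGroup d k),
      (IsClosed (H : Set (NeretinTree.NeretinGroup d k)) ∧
        CompactSpace (NeretinTree.NeretinGroup d k ⧸ H) ∧ NeretinTree.IsUnimodular H) ↔
      H = ⊤) := by
  have : Fact (2 ≤ d) := ⟨hd⟩
  have : Fact (2 ≤ k) := ⟨hk⟩
  refine ⟨fun H hne hc hH => ?_, fun H => ⟨fun ⟨hc, hH, hu⟩ =>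
    NeretinTree.eq_top_of_isUnimodular hc hH hu, ?_⟩⟩
  · obtain ⟨g, hg, hgH⟩ := NeretinTree.exists_conj_of_ne_top hne hc hH
    refine ⟨g⁻¹ • NeretinTree.zeroEnd d k, fun h hh => ?_,
      NeretinTree.finiteIndex_subgroupOf_stabilizer hH hg hgH⟩
    have h1 := hgH h hh
    rw [mul_smul, mul_smul, smul_eq_iff_eq_inv_smul] at h1
    exact h1
  · rintro rfl
    refine ⟨isClosed_univ, ?_, ?_⟩
    · have := QuotientGroup.subsingleton_quotient_top (G := NeretinTree.NeretinGroup d k)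
      infer_instance
    · exact (NeretinTree.isUnimodular_neretinGroup d k).of_continuousMulEquiv
        { Subgroup.topEquiv.symm with
          continuous_toFun := by
            change Continuous fun x : NeretinTree.NeretinGroup d k =>
              (⟨x, trivial⟩ : (⊤ : Subgroup (NeretinTree.NeretinGroup d k)))
            fun_prop
          continuous_invFun := continuous_subtype_val }
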